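/- **Setting.** There are $M$ agents, and agent $m$ has a context space $\mathcal X_m$ and $K$ actions $\mathcal A_m$. At each time step agent $m$ sees a context $x$, plays an action $a$ and receives $r(a)$, where $(x,r)\sim\mathcal D_m$ independently over time and agents, and $r\in[0,1]^{\mathcal A_m}$. Let $\mu_m(x,a)=\mathbb E[r(a)\mid x]$ and $\mathrm{Reg}(T)=\mathbb E\sum_{m}\sum_{t\le T}[\max_a\mu_m(x_{m,t},a)-\mu_m(x_{m,t},a_{m,t})]$. The reward functions are $\{f_\omega:\omega\in\Theta\}$ with $\Theta\subseteq\mathbb R^d$, and $f_{\omega^*}=\mu_m$ for every $m$, for some $\omega^*\in\Theta$. The loss $\ell_m(z;r)$ is $\mu_f$-strongly convex in $z$ ($\mu_f>0$), and $f_{\omega^*}(x,a)$ minimizes $y\mapsto\mathbb E[\ell_m(y;r(a))\mid x]$ for all $m,x,a$. All functions are measurable and $\mathbb E[\ell_m(y;r(a))\mid x]$ is finite for all $m,x,a,y$. For a dataset $\mathcal S$ with $n$ samples $(x_m^i,a_m^i,r_m^i)$ per agent, put $\widehat{\mathcal L}_m(\omega;\mathcal S)=\frac1n\sum_i\ell_m(f_\omega(x_m^i,a_m^i);r_m^i)$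 and $\widehat{\mathcal L}=\frac1M\sum_m\widehat{\mathcal L}_m$. **FedIGW.** Time is divided into epochs $l=1,2,\dots$ of lengths $E^l\ge1$. In epoch $l$, given context $x$, agent $m$ plays $a\ne\hat a:=\arg\max\hat f^l(x,\cdot)$ with probability $1/(K+\gamma^l(\hat f^l(x,\hat a)-\hat f^l(x,a)))$ and $\hat a$ with the remaining probability. Here $\hat f^1=0$, and $\hat f^{l}=f_{\hat\omega}$ for $l\ge2$, where $\hat\omega\in\Theta$ is the output of a (possibly randomized) federated learning (FL) protocol, the one used for epoch $l$, on the data of epoch $l-1$. Let $l(T)$ be the number of epochs that cover the first $T$ steps. Consider dataset laws with independent samples $(x,r)\sim\mathcal D_m$, $a\sim p_m(\cdot\mid x)$. Suprema below are over all families $(p_m)$ of action selection distributions. For $n=E^l$ let $$\mathfrak R^l\ \ge\ \sup_{p}\ \mathbb E_{\mathcal S,\sigma}\sup_{\omega\in\Theta}\frac1{Mn}\sum_{m,i}\sigma_{m,i}\,\ell_m(f_\omega(x_m^i,a_m^i);r_m^i),$$ with independent uniform signs $\sigma_{m,i}$. For $l\ge2$ let $$\varepsilon_{\rm opt}^l\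 \ge\ \sup_p\ \mathbb E_{\mathcal S,\xi}\big[\widehat{\mathcal L}(\hat\omega_{\mathcal S};\mathcal S)-\inf_{\omega\in\Theta}\widehat{\mathcal L}(\omega;\mathcal S)\big]$$ for the protocol used for epoch $l$ (run on $E^{l-1}$ samples per agent), with output $\hat\omega_{\mathcal S}$ and internal randomness $\xi$. Both are finite upper bounds, for instance the quantities on the right themselves, with $\mathfrak R^{l-1}+\varepsilon^l_{\rm opt}>0$. **(i) Regret.** For all $0<c_1\le c_2$ there is a constant $C$ depending only on $c_1,c_2$ such that the following holds. If, for every $l\ge2$, $\gamma^l$ lies between $c_1$ and $c_2$ times $\sqrt{K\mu_f/(\mathfrak R^{l-1}+\varepsilon_{\rm opt}^l)}$, and $\gamma^2\le\gamma^3\le\cdots$, then for every $T$ $$\mathrm{Reg}(T)\le C\Big(ME^1+\sum_{l=2}^{l(T)}\sqrt{K(\mathfrak R^{l-1}+\varepsilon_{\rm opt}^l)/\mu_f}\;ME^l\Big).$$ In (ii) and (iii) the protocol has $\rho$ communication rounds with $\kappa\ge1$ local steps each, each step using the gradient at one sample drawn uniformly from the agent's data. It has a local and a server step size and starts at $\omega^0\in\mathbb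 R^d$. Its output is a weighted average of the server models. The step sizes and weights depend only on the numerical parameters that are named, not on $d$, the data or the problem. Assume $M\ge1$, $\mu,\beta>0$ and $\sigma,G,B,D\ge0$. Call $\mathcal S$ regular if, on all of $\mathbb R^d$, the sample losses are differentiable in $\omega$, every $\widehat{\mathcal L}_m(\cdot;\mathcal S)$ is $\mu$-strongly convex and $\beta$-smooth, and $\frac1n\sum_i\|\nabla_\omega\ell_m(f_\omega(x_m^i,a_m^i);r_m^i)-\nabla\widehat{\mathcal L}_m(\omega)\|^2\le\sigma^2$ for all $m,\omega$. Let $\omega^*_{\mathcal S}$ be the minimizer of $\widehat{\mathcal L}(\cdot;\mathcal S)$ on $\mathbb R^d$. $C$ is an absolute constant and $\Lambda(A)=\log(e+\mu D^2/A)$, with $\Lambda(0)=1$. **(ii) FedAvg.** Let $\rho\ge8(1+B^2)\beta/\mu$. There are step sizes and weights, depending only on $(M,\rho,\kappa,\mu,\beta,\sigma,G,B,D)$, with the following property. Let $A_1=\frac{\sigma^2}{\mu\rho\kappa M}$, $A_2=\frac{\beta G^2}{(\mu\rho)^2}$ and $\Lambda=\Lambda(A_1+A_2)$. For every regular $\mathcal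 S$ with $\frac1M\sum_m\|\nabla\widehat{\mathcal L}_m(\omega)\|^2\le G^2+B^2\|\nabla\widehat{\mathcal L}(\omega)\|^2$ for all $\omega$ and $\|\omega^0-\omega^*_{\mathcal S}\|\le D$, $$\mathbb E_\xi\big[\widehat{\mathcal L}(\hat\omega_{\mathcal S};\mathcal S)-\inf_\Theta\widehat{\mathcal L}\big]_+\le C\Big(\Lambda A_1+\Lambda^2A_2+\mu D^2e^{-\mu\rho/(16(1+B^2)\beta)}\Big).$$ If all datasets with rewards in $[0,1]$ satisfy these conditions, then FedAvg has an $\varepsilon_{\rm opt}$ bounded by the right side, that is, $\tilde O((\rho\kappa M)^{-1}+\rho^{-2})$ up to an exponentially small term. **(iii) SCAFFOLD.** Let $\rho\ge\max\{162\beta/\mu,30\}$. Start with control variates $c_m^0$. There are step sizes and weights, depending only on $(M,\rho,\kappa,\mu,\beta,\sigma,D)$, with the following property. Let $A_1=\frac{\sigma^2}{\mu\rho\kappa M}$. For every regular $\mathcal S$ with $\|\omega^0-\omega^*_{\mathcal S}\|^2+\frac1{2M\beta^2}\sum_m\|c_m^0-\nabla\widehat{\mathcal L}_m(\omega^*_{\mathcal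 S})\|^2\le D^2$, $$\mathbb E_\xi\big[\widehat{\mathcal L}(\hat\omega_{\mathcal S};\mathcal S)-\inf_\Theta\widehat{\mathcal L}\big]_+\le C\Big(\Lambda(A_1)A_1+\mu D^2e^{-\min\{\rho/30,\ \mu\rho/(162\beta)\}}\Big).$$ If all datasets with rewards in $[0,1]$ satisfy these conditions, then SCAFFOLD has an $\varepsilon_{\rm opt}$ bounded by the right side, that is, $\tilde O((\rho\kappa M)^{-1})$ up to an exponentially small term. -/

import Mathlib

open MeasureTheory ProbabilityTheory
open scoped ENNReal NNReal

universe u v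

noncomputable section

namespace FedIGW

/-! ### Environment -/

/-- A synchronous federated contextual bandit with `M` agents and `K` actions per agent (the action
set of every agent is enumerated by `Fin K`). The joint law of (context, reward vector) of agent `m`
is given in disintegrated form: the context has law `ctxLaw m` and, given the context `x`, the
reward vector has law `rewardLaw m x`, which is carried by `[0,1]^K`. -/
structure Environment (M K : ℕ) where
  Ctx : Fin M → Type u
  mCtx : ∀ m, MeasurableSpace (Ctx m)
  ctxLaw : ∀ m, Measure (Ctx m)
  probCtx : ∀ m, IsProbabilityMeasure (ctxLaw m)
  rewardLaw : ∀ m, Kernel (Ctx m) (Fin K → ℝ)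
  markovReward : ∀ m, IsMarkovKernel (rewardLaw m)
  reward_mem : ∀ m x, ∀ᵐ r ∂(rewardLaw m x), ∀ a, r a ∈ Set.Icc (0 : ℝ) 1

attribute [instance] Environment.mCtx Environment.probCtx Environment.markovReward

variable {M K : ℕ}

/-- A real function of agent, context and action (a reward estimate, or action probabilities). -/
abbrev Predictor (env : Environment.{u} M K) := ∀ m, env.Ctx m → Fin K → ℝ

/-- The expected reward `μ_m(x, a)`. -/
def meanReward (env : Environment.{u} M K) : Predictor env :=
  fun m x a => ∫ r, r a ∂(env.rewardLaw m x)

/-- One observation `(x, a, r(a))` of agent `m`: only the reward of the played action is seen. -/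
abbrev Sample (env : Environment.{u} M K) (m : Fin M) := env.Ctx m × Fin K × ℝ

/-- The data of one epoch of length `n`: `n` samples for each agent. -/
abbrev Dataset (env : Environment.{u} M K) (n : ℕ) := ∀ m, Fin n → Sample env m

/-- All rewards in the dataset are in `[0,1]`. -/
def ValidData {env : Environment.{u} M K} {n : ℕ} (S : Dataset env n) : Prop :=
  ∀ m i, (S m i).2.2 ∈ Set.Icc (0 : ℝ) 1

/-- `p` is a family of action selection distributions: `p m x` is a probability vector on the
actions, depending measurably on the context `x`. -/
structure IsPolicy {env : Environment.{u} M K} (p : Predictor env) : Prop where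
  measurable : ∀ m a, Measurable fun x => p m x a
  nonneg : ∀ m x a, 0 ≤ p m x a
  sum_eq_one : ∀ m x, ∑ a, p m x a = 1

/-- The law of `(x, a, r(a))` when `(x, r)` has the law of agent `m`, and `a` is drawn from
`p m x` independently of `r` given `x`. -/
def sampleLaw (env : Environment.{u} M K) (p : Predictor env) (m : Fin M) :
    Measure (Sample env m) :=
  ∑ a : Fin K,
    ((env.ctxLaw m ⊗ₘ env.rewardLaw m).withDensity fun z => ENNReal.ofReal (p m z.1 a)).map
      fun z => (z.1, a, z.2 a)

/-- The law of a dataset: independent agents, `n` independent samples each. -/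
def dataLaw (env : Environment.{u} M K) (n : ℕ) (p : Predictor env) : Measure (Dataset env n) :=
  Measure.pi fun m => Measure.pi fun _ : Fin n => sampleLaw env p m

/-! ### The federated learning problem -/

/-- The parameter space `ℝ^d` with its Euclidean norm. -/
abbrev Param (d : ℕ) := EuclideanSpace ℝ (Fin d)

/-- The local empirical loss of agent `m`. -/
def localLoss {env : Environment.{u} M K} {n : ℕ} (loss : Fin M → ℝ → ℝ → ℝ)
    (S : Dataset env n) (h : Predictor env) (m : Fin M) : ℝ :=
  (1 / (n : ℝ)) * ∑ i, loss m (h m (S m i).1 (S m i).2.1) (S m i).2.2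

/-- The global empirical loss; all agents hold the same number of samples, so that the weight of
each agent is `1 / M`. -/
def globalLoss {env : Environment.{u} M K} {n : ℕ} (loss : Fin M → ℝ → ℝ → ℝ)
    (S : Dataset env n) (h : Predictor env) : ℝ :=
  (1 / (M : ℝ)) * ∑ m, localLoss loss S h m

/-- A (possibly randomized) federated learning protocol: from a dataset in `𝒮` and a random seed of
law `law` it computes a parameter in `V`. -/
structure FLProtocol (𝒮 : Type*) (V : Type*) where
  Seed : Type
  mSeed : MeasurableSpace Seed
  law : Measure Seed
  probLaw : IsProbabilityMeasure law
  out : 𝒮 → Seed → V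

attribute [instance] FLProtocol.mSeed FLProtocol.probLaw

variable {d : ℕ}

/-- The optimization gap of `ω̂` on the dataset `S`: the empirical loss at `ω̂` minus the minimal
empirical loss over the parameter set `Θ`. -/
def optGap {env : Environment.{u} M K} {n : ℕ} (f : Param d → Predictor env)
    (loss : Fin M → ℝ → ℝ → ℝ) (Θ : Set (Param d)) (S : Dataset env n) (ω' : Param d) : ℝ≥0∞ :=
  ⨆ ω ∈ Θ, ENNReal.ofReal (globalLoss loss S (f ω') - globalLoss loss S (f ω))

/-- The optimization error `ε_opt` of a protocol with `n` samples per agent: the expected gap of its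
output, over the data and the seed, uniformly over the action selection distributions. -/
def optError (env : Environment.{u} M K) (f : Param d → Predictor env)
    (loss : Fin M → ℝ → ℝ → ℝ) (Θ : Set (Param d)) (n : ℕ)
    (FL : FLProtocol (Dataset env n) (Param d)) : ℝ≥0∞ :=
  ⨆ (p : Predictor env) (_ : IsPolicy p),
    ∫⁻ S, ∫⁻ ξ, optGap f loss Θ S (FL.out S ξ) ∂FL.law ∂(dataLaw env n p)

/-- A Rademacher sign. -/
def rsign (b : Bool) : ℝ := if b then 1 else -1

/-- The empirical Rademacher complexity of the loss class on `S` (the average over all sign patterns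
of the supremum over `Θ`); with `Θ` nonempty it is in `[0, ∞]`. -/
def empRademacher {env : Environment.{u} M K} {n : ℕ} (f : Param d → Predictor env)
    (loss : Fin M → ℝ → ℝ → ℝ) (Θ : Set (Param d)) (S : Dataset env n) : EReal :=
  ((1 / 2 ^ (M * n) : ℝ) : EReal) * ∑ σ : Fin M → Fin n → Bool,
    ⨆ ω ∈ Θ, (((1 / ((M : ℝ) * n)) * ∑ m, ∑ i,
      rsign (σ m i) * loss m (f ω m (S m i).1 (S m i).2.1) (S m i).2.2 : ℝ) : EReal)

/-- The Rademacher complexity bound `ℜ` with `n` samples per agent: the supremum over all action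
selection distributions of the expected empirical Rademacher complexity. -/
def rademacher (env : Environment.{u} M K) (f : Param d → Predictor env)
    (loss : Fin M → ℝ → ℝ → ℝ) (Θ : Set (Param d)) (n : ℕ) : ℝ≥0∞ :=
  ⨆ (p : Predictor env) (_ : IsPolicy p),
    ∫⁻ S, (empRademacher f loss Θ S).toENNReal ∂(dataLaw env n p)

/-- Realizability by the parameter `ωs ∈ Θ`, strong convexity of the losses in their first argument,
and optimality of the true reward function for the conditional expected losses, together with the
measurability and integrability that these presuppose. -/
structure WellSpecified (env : Environment.{u} M K) (f : Param d → Predictor env)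
    (loss : Fin M → ℝ → ℝ → ℝ) (Θ : Set (Param d)) (μf : ℝ) (ωs : Param d) : Prop where
  measurable_f : ∀ m a, Measurable fun q : Param d × env.Ctx m => f q.1 m q.2 a
  measurable_loss : ∀ m, Measurable fun q : ℝ × ℝ => loss m q.1 q.2
  mem : ωs ∈ Θ
  realizable : ∀ m x a, f ωs m x a = meanReward env m x a
  strongConvex : ∀ m y, StrongConvexOn Set.univ μf fun z => loss m z y
  integrable : ∀ m x a z, Integrable (fun r => loss m z (r a)) (env.rewardLaw m x)
  optimal : ∀ m x a z, ∫ r, loss m (f ωs m x a) (r a) ∂(env.rewardLaw m x)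
    ≤ ∫ r, loss m z (r a) ∂(env.rewardLaw m x)

/-! ### FedIGW

Epochs are numbered from `0`; epoch `l` has length `E l`. -/

/-- `sel` is a (measurable) tie-breaking rule for `argmax`. -/
structure IsArgmax (sel : (Fin K → ℝ) → Fin K) : Prop where
  measurable : Measurable sel
  le : ∀ (y : Fin K → ℝ) (a : Fin K), y a ≤ y (sel y)

/-- Inverse gap weighting of the vector `y` of estimated rewards, with learning rate `γ`. -/
def igwProb (sel : (Fin K → ℝ) → Fin K) (γ : ℝ) (y : Fin K → ℝ) (a : Fin K) : ℝ :=
  if a = sel y then 1 - ∑ b ∈ Finset.univ.erase (sel y), 1 / ((K : ℝ) + γ * (y (sel y) - y b))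
  else 1 / ((K : ℝ) + γ * (y (sel y) - y a))

/-- The action selection distributions obtained from the estimate `h`. -/
def igwPolicy {env : Environment.{u} M K} (sel : Fin M → (Fin K → ℝ) → Fin K) (γ : ℝ)
    (h : Predictor env) : Predictor env :=
  fun m x => igwProb (sel m) γ (h m x)

section Run

variable {env : Environment.{u} M K} {E : ℕ → ℕ} {Ω : Type v}

/-- The estimate used in epoch `l`: zero in the first epoch, later the function whose parameter the
protocol returned on the data of the previous epoch. -/
def estimate (f : Param d → Predictor env) (FL : ∀ l, FLProtocol (Dataset env (E l)) (Param d))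
    (data : ∀ l, Ω → Dataset env (E l)) (seed : ∀ l, Ω → (FL l).Seed) :
    ℕ → Ω → Predictor env
  | 0, _ => 0
  | l + 1, w => f ((FL l).out (data l w) (seed l w))

/-- The data and the seeds of the epochs before `l`. -/
def history (FL : ∀ l, FLProtocol (Dataset env (E l)) (Param d))
    (data : ∀ l, Ω → Dataset env (E l)) (seed : ∀ l, Ω → (FL l).Seed) (l : ℕ) (w : Ω) :
    ∀ j : Fin l, Dataset env (E j) × (FL j).Seed :=
  fun j => (data j w, seed j w)

/-- A run of FedIGW on a probability space `(Ω, P)`. Given the past, the samples of epoch `l` are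
independent, with actions drawn by inverse gap weighting from the current estimate; the seed of each
call of the protocol is independent of everything before that call. -/
structure IsFedIGWRun [MeasurableSpace Ω] (P : Measure Ω) (f : Param d → Predictor env)
    (sel : Fin M → (Fin K → ℝ) → Fin K) (γ : ℕ → ℝ)
    (FL : ∀ l, FLProtocol (Dataset env (E l)) (Param d))
    (data : ∀ l, Ω → Dataset env (E l)) (seed : ∀ l, Ω → (FL l).Seed) : Prop where
  measurable_data : ∀ l, Measurable (data l)
  measurable_seed : ∀ l, Measurable (seed l)
  data_law : ∀ (l : ℕ)
    (g : (∀ j : Fin l, Dataset env (E j) × (FL j).Seed) × Dataset env (E l) → ℝ≥0∞),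
    Measurable g →
    ∫⁻ w, g (history FL data seed l w, data l w) ∂P =
      ∫⁻ w, ∫⁻ S, g (history FL data seed l w, S)
        ∂(dataLaw env (E l) (igwPolicy sel (γ l) (estimate f FL data seed l w))) ∂P
  seed_law : ∀ l, P.map (seed l) = (FL l).law
  seed_indep : ∀ l, IndepFun (seed l) (fun w => (history FL data seed l w, data l w)) P

/-- The number of time steps before epoch `l`. -/
def epochStart (E : ℕ → ℕ) (l : ℕ) : ℕ := ∑ j ∈ Finset.range l, E j

/-- The number `l(T)` of epochs that are needed to cover `T` time steps. -/
def epochCount (E : ℕ → ℕ) (T : ℕ) : ℕ := sInf {L | T ≤ epochStart E L}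

/-- The expected loss of a sample's action against the best action for its context. -/
def actionGap (env : Environment.{u} M K) (m : Fin M) (s : Sample env m) : ℝ :=
  (⨆ a, meanReward env m s.1 a) - meanReward env m s.1 s.2.1

/-- The overall regret of the `M` agents in the first `T` time steps. -/
def regret [MeasurableSpace Ω] (P : Measure Ω) (data : ∀ l, Ω → Dataset env (E l)) (T : ℕ) : ℝ :=
  ∫ w, ∑ m, ∑ l ∈ Finset.range (epochCount E T), ∑ i : Fin (E l),
    (if epochStart E l + i < T then actionGap env m (data l w m i) else 0) ∂P

end Run

/-! ### FedAvg and SCAFFOLD -/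

section Protocols

variable {V : Type*} [NormedAddCommGroup V] [NormedSpace ℝ V]

/-- `κ` local steps of stochastic gradient descent from `x` with step size `η`, in which step `k`
uses the gradient of sample `ξ k`, shifted by `corr`. -/
def localSteps {n κ : ℕ} (η : ℝ) (g : Fin n → V → V) (corr : V) (ξ : Fin κ → Fin n) (x : V) : V :=
  Fin.foldl κ (fun y k => y - η • (g (ξ k) y + corr)) x

/-- One communication round of FedAvg with local step size `ηl` and server step size `ηg`. -/
def fedAvgRound {n κ : ℕ} (ηl ηg : ℝ) (g : Fin M → Fin n → V → V) (ξ : Fin M → Fin κ → Fin n)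
    (x : V) : V :=
  x + (ηg / (M : ℝ)) • ∑ m, (localSteps ηl (g m) 0 (ξ m) x - x)

/-- One communication round of SCAFFOLD; the state is the server model `x` and the control variates
`c m` of the agents. All agents take part in every round, so that the server's control variate is
always the average of those of the agents. -/
def scaffoldRound {n κ : ℕ} (ηl ηg : ℝ) (g : Fin M → Fin n → V → V) (ξ : Fin M → Fin κ → Fin n)
    (s : V × (Fin M → V)) : V × (Fin M → V) :=
  let cbar : V := (1 / (M : ℝ)) • ∑ m, s.2 m
  let y : Fin M → V := fun m => localSteps ηl (g m) (cbar - s.2 m) (ξ m) s.1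
  (s.1 + (ηg / (M : ℝ)) • ∑ m, (y m - s.1),
    fun m => s.2 m - cbar + (1 / ((κ : ℝ) * ηl)) • (s.1 - y m))

/-- The states at the times `0, …, ρ` of the iteration `s ↦ step r s`. -/
def iterates {α : Type*} {ρ : ℕ} (step : Fin ρ → α → α) (s : α) : Fin (ρ + 1) → α :=
  Fin.induction (motive := fun _ => α) s fun r t => step r t

/-- The gradient in the parameter of the loss of sample `i` of agent `m`. -/
def sampleGrad {env : Environment.{u} M K} {n : ℕ} (f : Param d → Predictor env)
    (loss : Fin M → ℝ → ℝ → ℝ) (S : Dataset env n) (m : Fin M) (i : Fin n) (ω : Param d) :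
    Param d :=
  gradient (fun ω' => loss m (f ω' m (S m i).1 (S m i).2.1) (S m i).2.2) ω

/-- FedAvg with `ρ` communication rounds and `κ` local steps per round, each with a sample drawn
uniformly from the agent's data. The output is the average, with weights `wt`, of the server models. -/
def fedAvg {env : Environment.{u} M K} (f : Param d → Predictor env) (loss : Fin M → ℝ → ℝ → ℝ)
    (n : ℕ) [NeZero n] (ρ κ : ℕ) (ηl ηg : ℝ) (wt : Fin (ρ + 1) → ℝ) (ω₀ : Param d) :
    FLProtocol (Dataset env n) (Param d) where
  Seed := Fin ρ → Fin M → Fin κ → Fin n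
  mSeed := inferInstance
  law := uniformOn Set.univ
  probLaw := isProbabilityMeasure_uniformOn Set.finite_univ Set.univ_nonempty
  out S ξ := ∑ r, wt r •
    iterates (fun r => fedAvgRound ηl ηg (sampleGrad f loss S) (ξ r)) ω₀ r

/-- SCAFFOLD, likewise, started with the control variates `c₀`. -/
def scaffold {env : Environment.{u} M K} (f : Param d → Predictor env) (loss : Fin M → ℝ → ℝ → ℝ)
    (n : ℕ) [NeZero n] (ρ κ : ℕ) (ηl ηg : ℝ) (wt : Fin (ρ + 1) → ℝ) (ω₀ : Param d)
    (c₀ : Fin M → Param d) : FLProtocol (Dataset env n) (Param d) where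
  Seed := Fin ρ → Fin M → Fin κ → Fin n
  mSeed := inferInstance
  law := uniformOn Set.univ
  probLaw := isProbabilityMeasure_uniformOn Set.finite_univ Set.univ_nonempty
  out S ξ := ∑ r, wt r •
    (iterates (fun r => scaffoldRound ηl ηg (sampleGrad f loss S) (ξ r)) (ω₀, c₀) r).1

/-- Conditions on the local empirical losses of the dataset `S`: differentiability in the
parameter, `μ`-strong convexity, `β`-smoothness, and variance of the stochastic gradients bounded by
`σ ^ 2`. -/
structure RegularLosses {env : Environment.{u} M K} {n : ℕ} (f : Param d → Predictor env)
    (loss : Fin M → ℝ → ℝ → ℝ) (S : Dataset env n) (μ β σ : ℝ) : Prop where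
  differentiable : ∀ m i,
    Differentiable ℝ fun ω => loss m (f ω m (S m i).1 (S m i).2.1) (S m i).2.2
  strongConvex : ∀ m, StrongConvexOn Set.univ μ fun ω => localLoss loss S (f ω) m
  smooth : ∀ m ω ω', localLoss loss S (f ω') m - localLoss loss S (f ω) m ≤
    inner ℝ (gradient (fun η => localLoss loss S (f η) m) ω) (ω' - ω) + β / 2 * ‖ω' - ω‖ ^ 2
  variance : ∀ m ω, (1 / (n : ℝ)) * ∑ i,
    ‖sampleGrad f loss S m i ω - gradient (fun η => localLoss loss S (f η) m) ω‖ ^ 2 ≤ σ ^ 2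

/-- Bounded gradient dissimilarity, with constants `G` and `B`. -/
def BoundedDissimilarity {env : Environment.{u} M K} {n : ℕ} (f : Param d → Predictor env)
    (loss : Fin M → ℝ → ℝ → ℝ) (S : Dataset env n) (G B : ℝ) : Prop :=
  ∀ ω, (1 / (M : ℝ)) * ∑ m, ‖gradient (fun η => localLoss loss S (f η) m) ω‖ ^ 2 ≤
    G ^ 2 + B ^ 2 * ‖gradient (fun η => globalLoss loss S (f η)) ω‖ ^ 2

/-- The initial point is within `D` of the minimizer of the global empirical loss. -/
def InitWithin {env : Environment.{u} M K} {n : ℕ} (f : Param d → Predictor env)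
    (loss : Fin M → ℝ → ℝ → ℝ) (S : Dataset env n) (ω₀ : Param d) (D : ℝ) : Prop :=
  ∀ ω, IsMinOn (fun η => globalLoss loss S (f η)) Set.univ ω → ‖ω₀ - ω‖ ≤ D

/-- The initial point and the initial control variates are within `D` of the minimizer and of the
local gradients there, in the distance that is used for SCAFFOLD. -/
def ControlInitWithin {env : Environment.{u} M K} {n : ℕ} (f : Param d → Predictor env)
    (loss : Fin M → ℝ → ℝ → ℝ) (S : Dataset env n) (β : ℝ) (ω₀ : Param d) (c₀ : Fin M → Param d)
    (D : ℝ) : Prop :=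
  ∀ ω, IsMinOn (fun η => globalLoss loss S (f η)) Set.univ ω →
    ‖ω₀ - ω‖ ^ 2 + (1 / (2 * (M : ℝ) * β ^ 2)) *
      ∑ m, ‖c₀ m - gradient (fun η => localLoss loss S (f η) m) ω‖ ^ 2 ≤ D ^ 2

/-- The logarithmic factor `log (e + μ D² / A)`, where `A` is the polynomially decaying error. -/
def logFactor (μ D A : ℝ) : ℝ := Real.log (Real.exp 1 + μ * D ^ 2 / A)

/-- The error bound of FedAvg, with its logarithmic factors. -/
def fedAvgBound (M ρ κ : ℕ) (μ β σ G B D : ℝ) : ℝ :=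
  logFactor μ D (σ ^ 2 / (μ * ρ * κ * M) + β * G ^ 2 / (μ * ρ) ^ 2) *
      (σ ^ 2 / (μ * ρ * κ * M)) +
    logFactor μ D (σ ^ 2 / (μ * ρ * κ * M) + β * G ^ 2 / (μ * ρ) ^ 2) ^ 2 *
      (β * G ^ 2 / (μ * ρ) ^ 2) +
    μ * D ^ 2 * Real.exp (-(μ * ρ / (16 * (1 + B ^ 2) * β)))

/-- The error bound of SCAFFOLD, with its logarithmic factor. -/
def scaffoldBound (M ρ κ : ℕ) (μ β σ D : ℝ) : ℝ :=
  logFactor μ D (σ ^ 2 / (μ * ρ * κ * M)) * (σ ^ 2 / (μ * ρ * κ * M)) +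
    μ * D ^ 2 * Real.exp (-(min ((ρ : ℝ) / 30) (μ * ρ / (162 * β))))

end Protocols

end FedIGW

end

open FedIGW

/-! Regret. The heart is an estimate for the squared error of the fitted parameter under the law
that generated its data. Strong convexity and conditional optimality of the truth give that `μf / 2`
times this error is at most the excess risk (`WellSpecified.sq_le_integral`). The excess risk of a
data-dependent parameter is its generalization gap plus its empirical excess loss. Symmetrization
bounds the gap by `2 * R` (`WellSpecified.ofReal_integral_gap_le`), and the empirical excess is at
most the optimization error, since `ωs ∈ Θ`. Only loss differences to `ωs` occur; they are
integrable because the Rademacher complexity is finite. Suprema are replaced by measurable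
selections, so the supremum over `Θ` need not be measurable.

Inverse gap weighting makes `1 / p(a)` at most `K` plus `γ` times the estimated gap. If estimated
and true gaps are comparable in one epoch, then `1 / p(a)` is controlled by true gaps, so a small
squared error under `p` makes the next estimate comparable too (`gap_compare`). Carried out for each
context separately, this gives true gap `≤ 2 *` estimated gap `+ Y / γ`, and the reverse. The
accumulated error `Y` (`igwError`) obeys a recursion with contraction factor `1/3`, so its mean
stays of order `K` however many epochs there are (`IsFedIGWRun.lintegral_igwError_le`). The regret
per agent and step is then of order `K / γ`, which the tuning of `γ` turns into the stated root.

Optimization. In a round of FedAvg or SCAFFOLD the server makes a stochastic gradient step of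
effective size `η = ηg * ηl * κ`, with noise of variance at most `σ² / (κ M)` and a bias caused by
local drift (`server_update_eq`, `IsFedProblem.expect_round_le`). The drift is of order `ηl²`. Since
`ηg` is free, `η` can be fixed first and `ηl` taken so small that the drift is dominated by the
permitted errors; constants exponential in `κ` do no harm. For SCAFFOLD the potential also contains
a small multiple of the error of the control variates. A contraction by `1 - μη/2` per round,
geometric weights and Jensen's inequality bound the averaged model (`expect_gap_average_le`), and `η
= min (1/(8β)) (2L/(μρ))` with `L` the logarithmic factor balances the terms (`exists_stepSize`).
All choices precede the dimension, data and problem. If `β < μ`, regularity forces a one-point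
parameter space. -/

noncomputable section

namespace FedIGW

variable {M K d n : ℕ} {env : Environment.{u} M K} {p : Predictor env}

/-! ### Laws of samples and datasets -/

theorem lintegral_sampleLaw (hp : ∀ m a, Measurable fun x => p m x a) (m : Fin M)
    {g : Sample env m → ℝ≥0∞} (hg : Measurable g) :
    ∫⁻ s, g s ∂(sampleLaw env p m) = ∫⁻ x, ∑ a, ENNReal.ofReal (p m x a) *
      ∫⁻ r, g (x, a, r a) ∂(env.rewardLaw m x) ∂(env.ctxLaw m) := by
  have hmap : ∀ a : Fin K, Measurable
      fun z : env.Ctx m × (Fin K → ℝ) => ((z.1, a, z.2 a) : Sample env m) := fun a => by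
    fun_prop
  have hw : ∀ a : Fin K, Measurable
      fun z : env.Ctx m × (Fin K → ℝ) => ENNReal.ofReal (p m z.1 a) := fun a =>
    ((hp m a).comp measurable_fst).ennreal_ofReal
  rw [sampleLaw, lintegral_finsetSum_measure, lintegral_finsetSum]
  · refine Finset.sum_congr rfl fun a _ => ?_
    have hga : Measurable fun z : env.Ctx m × (Fin K → ℝ) => g (z.1, a, z.2 a) :=
      hg.comp (hmap a)
    rw [lintegral_map hg (hmap a), lintegral_withDensity_eq_lintegral_mul _ (hw a) hga,
      Measure.lintegral_compProd ((hw a).mul hga)]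
    refine lintegral_congr fun x => ?_
    simp only [Pi.mul_apply]
    rw [lintegral_const_mul _ (by fun_prop)]
  · intro a _
    refine ((hp m a).ennreal_ofReal).mul ?_
    exact Measurable.lintegral_kernel_prod_right' (κ := env.rewardLaw m)
      (f := fun z : env.Ctx m × (Fin K → ℝ) => g (z.1, a, z.2 a)) (hg.comp (hmap a))

theorem IsPolicy.isProbabilityMeasure_sampleLaw (hp : IsPolicy p) (m : Fin M) :
    IsProbabilityMeasure (sampleLaw env p m) := by
  constructor
  rw [← setLIntegral_one, Measure.restrict_univ, lintegral_sampleLaw hp.measurable m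
    measurable_const]
  have : ∀ x, ∑ a, ENNReal.ofReal (p m x a) * ∫⁻ _r, 1 ∂(env.rewardLaw m x) = 1 := by
    intro x
    simp only [lintegral_const, measure_univ, mul_one]
    rw [← ENNReal.ofReal_sum_of_nonneg fun a _ => hp.nonneg m x a, hp.sum_eq_one,
      ENNReal.ofReal_one]
  rw [lintegral_congr this]
  simp

theorem IsPolicy.isProbabilityMeasure_dataLaw (hp : IsPolicy p) (n : ℕ) :
    IsProbabilityMeasure (dataLaw env n p) := by
  have := fun m => hp.isProbabilityMeasure_sampleLaw m
  unfold dataLaw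
  infer_instance

theorem IsPolicy.measurePreserving_eval (hp : IsPolicy p) (m : Fin M) (i : Fin n) :
    MeasurePreserving (fun S : Dataset env n => S m i) (dataLaw env n p) (sampleLaw env p m) := by
  have := fun m => hp.isProbabilityMeasure_sampleLaw m
  exact (MeasureTheory.measurePreserving_eval (fun _ : Fin n => sampleLaw env p m) i).comp
    (MeasureTheory.measurePreserving_eval
      (fun m => Measure.pi fun _ : Fin n => sampleLaw env p m) m)

theorem measurableSet_validData : MeasurableSet {S : Dataset env n | ValidData S} := by
  have : {S : Dataset env n | ValidData S} =
      ⋂ m, ⋂ i, (fun S : Dataset env n => (S m i).2.2) ⁻¹' Set.Icc (0 : ℝ) 1 := by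
    ext S; simp [ValidData]
  rw [this]
  exact MeasurableSet.iInter fun m => MeasurableSet.iInter fun i =>
    (by fun_prop : Measurable fun S : Dataset env n => (S m i).2.2) measurableSet_Icc

theorem IsPolicy.ae_validData (hp : IsPolicy p) : ∀ᵐ S ∂(dataLaw env n p), ValidData S := by
  have key : ∀ m, ∀ᵐ s ∂(sampleLaw env p m), s.2.2 ∈ Set.Icc (0 : ℝ) 1 := by
    intro m
    have hA : MeasurableSet {s : Sample env m | ¬ s.2.2 ∈ Set.Icc (0 : ℝ) 1} :=
      ((by fun_prop : Measurable fun s : Sample env m => s.2.2) measurableSet_Icc).compl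
    rw [ae_iff, ← lintegral_indicator_one hA, lintegral_sampleLaw hp.measurable m
      (measurable_one.indicator hA)]
    have : ∀ x a, ∫⁻ r, ({s : Sample env m | ¬ s.2.2 ∈ Set.Icc (0 : ℝ) 1}).indicator
        (1 : Sample env m → ℝ≥0∞) (x, a, r a) ∂(env.rewardLaw m x) = 0 := by
      intro x a
      rw [← lintegral_zero (μ := env.rewardLaw m x)]
      refine lintegral_congr_ae ?_
      filter_upwards [env.reward_mem m x] with r hr
      simpa using hr a
    simp only [this, mul_zero, Finset.sum_const_zero, lintegral_zero]
  simp only [ValidData, ae_all_iff]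
  intro m i
  exact (hp.measurePreserving_eval m i).quasiMeasurePreserving.ae (key m)

/-- Pairing coordinates identifies the product of two product measures with the product of the
pairwise products. -/
theorem measurePreserving_unzip {ι : Type*} [Fintype ι] {α β : ι → Type*}
    [∀ i, MeasurableSpace (α i)] [∀ i, MeasurableSpace (β i)]
    (μ : ∀ i, Measure (α i)) (ν : ∀ i, Measure (β i))
    [∀ i, IsProbabilityMeasure (μ i)] [∀ i, IsProbabilityMeasure (ν i)] :
    MeasurePreserving (fun z : ∀ i, α i × β i => ((fun i => (z i).1, fun i => (z i).2) :
      (∀ i, α i) × (∀ i, β i)))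
      (Measure.pi fun i => (μ i).prod (ν i)) ((Measure.pi μ).prod (Measure.pi ν)) := by
  refine ⟨by fun_prop, ?_⟩
  symm
  have hμ : (Measure.pi μ).FiniteSpanningSetsIn
      (Set.pi Set.univ '' Set.pi Set.univ fun i => {s : Set (α i) | MeasurableSet s}) :=
    ⟨fun _ => Set.univ, fun _ => ⟨fun _ => Set.univ, by simp, by simp⟩,
      fun _ => measure_lt_top _ _, Set.iUnion_const _⟩
  have hν : (Measure.pi ν).FiniteSpanningSetsIn
      (Set.pi Set.univ '' Set.pi Set.univ fun i => {s : Set (β i) | MeasurableSet s}) :=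
    ⟨fun _ => Set.univ, fun _ => ⟨fun _ => Set.univ, by simp, by simp⟩,
      fun _ => measure_lt_top _ _, Set.iUnion_const _⟩
  refine Measure.prod_eq_generateFrom generateFrom_pi generateFrom_pi isPiSystem_pi
    isPiSystem_pi hμ hν ?_
  rintro _ ⟨s, hs, rfl⟩ _ ⟨t, ht, rfl⟩
  simp only [Set.mem_univ_pi, Set.mem_ofPred_eq] at hs ht
  rw [Measure.map_apply (by fun_prop)
    ((MeasurableSet.univ_pi hs).prod (MeasurableSet.univ_pi ht))]
  have : (fun z : ∀ i, α i × β i => ((fun i => (z i).1, fun i => (z i).2) :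
      (∀ i, α i) × (∀ i, β i))) ⁻¹' (Set.univ.pi s ×ˢ Set.univ.pi t) =
      Set.univ.pi fun i => s i ×ˢ t i := by
    ext z; simp [Set.mem_pi, forall_and]
  rw [this, Measure.pi_pi, Measure.pi_pi, Measure.pi_pi]
  simp [Measure.prod_prod, Finset.prod_mul_distrib]

/-- Exchange the samples of two datasets at the places where the sign is negative. -/
def exchange (τ : Fin M → Fin n → Bool) (q : Dataset env n × Dataset env n) :
    Dataset env n × Dataset env n :=
  (fun m i => if τ m i then q.1 m i else q.2 m i, fun m i => if τ m i then q.2 m i else q.1 m i)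

theorem measurable_exchange (τ : Fin M → Fin n → Bool) :
    Measurable (exchange (env := env) τ) := by
  refine Measurable.prodMk ?_ ?_ <;>
  · refine measurable_pi_lambda _ fun m => measurable_pi_lambda _ fun i => ?_
    cases τ m i <;> simp <;> fun_prop

theorem IsPolicy.measurePreserving_exchange (hp : IsPolicy p) (τ : Fin M → Fin n → Bool) :
    MeasurePreserving (exchange τ) ((dataLaw env n p).prod (dataLaw env n p))
      ((dataLaw env n p).prod (dataLaw env n p)) := by
  have := fun m => hp.isProbabilityMeasure_sampleLaw m
  let Q := Measure.pi fun m => Measure.pi fun _ : Fin n =>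
    (sampleLaw env p m).prod (sampleLaw env p m)
  let e : (∀ m, Fin n → Sample env m × Sample env m) → Dataset env n × Dataset env n :=
    fun z => (fun m i => (z m i).1, fun m i => (z m i).2)
  have he : MeasurePreserving e Q ((dataLaw env n p).prod (dataLaw env n p)) := by
    have h1 := measurePreserving_pi (fun m => Measure.pi fun _ : Fin n =>
        (sampleLaw env p m).prod (sampleLaw env p m)) _ fun m =>
      measurePreserving_unzip (fun _ : Fin n => sampleLaw env p m) (fun _ => sampleLaw env p m)
    exact (measurePreserving_unzip
      (fun m => Measure.pi fun _ : Fin n => sampleLaw env p m)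
      (fun m => Measure.pi fun _ : Fin n => sampleLaw env p m)).comp h1
  -- In paired coordinates the exchange acts on each pair separately, as the identity or as a swap,
  -- and both preserve the product of a law with itself.
  let T : (∀ m, Fin n → Sample env m × Sample env m) →
      (∀ m, Fin n → Sample env m × Sample env m) :=
    fun z m i => if τ m i then z m i else (z m i).swap
  have hT : MeasurePreserving T Q Q := by
    refine measurePreserving_pi
      (fun m => Measure.pi fun _ : Fin n => (sampleLaw env p m).prod (sampleLaw env p m))
      (fun m => Measure.pi fun _ : Fin n => (sampleLaw env p m).prod (sampleLaw env p m))
      (f := fun m z i => if τ m i then z i else (z i).swap) fun m => ?_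
    refine measurePreserving_pi (fun _ : Fin n => (sampleLaw env p m).prod (sampleLaw env p m))
      (fun _ : Fin n => (sampleLaw env p m).prod (sampleLaw env p m))
      (f := fun i z => if τ m i then z else z.swap) fun i => ?_
    cases τ m i
    · simpa using Measure.measurePreserving_swap
    · simp only [if_true]
      exact MeasurePreserving.id _
  refine ⟨measurable_exchange τ, ?_⟩
  have hcomm : exchange τ ∘ e = e ∘ T := by
    funext z
    refine Prod.ext ?_ ?_ <;> funext m i <;> simp only [exchange, e, T, Function.comp] <;>
      cases τ m i <;> simp
  calc ((dataLaw env n p).prod (dataLaw env n p)).map (exchange τ)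
      = (Q.map e).map (exchange τ) := by rw [he.map_eq]
    _ = (Q.map T).map e := by
      rw [Measure.map_map (measurable_exchange τ) he.measurable, hcomm,
        Measure.map_map he.measurable hT.measurable]
    _ = _ := by rw [hT.map_eq, he.map_eq]

end FedIGW

end

/-! ### Generalization: from Rademacher complexity to squared error. -/

noncomputable section

namespace FedIGW

variable {M K d n : ℕ} {env : Environment.{u} M K} {p : Predictor env}
  {f : Param d → Predictor env} {loss : Fin M → ℝ → ℝ → ℝ} {Θ : Set (Param d)} {μf : ℝ}
  {ωs : Param d}

/-! ### Rademacher averages of loss differences -/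

/-- Flip the signs in the places marked by `τ`. -/
def flipSigns (τ σ : Fin M → Fin n → Bool) : Fin M → Fin n → Bool :=
  fun m i => xor (τ m i) (σ m i)

theorem flipSigns_involutive (τ : Fin M → Fin n → Bool) : Function.Involutive (flipSigns τ) := by
  intro σ; funext m i; simp [flipSigns]

theorem sum_flipSigns (τ : Fin M → Fin n → Bool) (F : (Fin M → Fin n → Bool) → ℝ) :
    ∑ σ, F (flipSigns τ σ) = ∑ σ, F σ :=
  Equiv.sum_comp (flipSigns_involutive τ).toPerm F

@[simp] theorem rsign_not (b : Bool) : rsign (!b) = -rsign b := by cases b <;> simp [rsign]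

/-- The sign pattern that marks only the place `(m, i)`. -/
def markAt (m : Fin M) (i : Fin n) : Fin M → Fin n → Bool :=
  fun m' i' => decide (m' = m ∧ i' = i)

/-- Flipping the sign at the single place `(m, i)` is a bijection of the patterns that negates every
summand. -/
theorem sum_rsign_mul_eq_zero (m : Fin M) (i : Fin n) (h : (Fin M → Fin n → Bool) → ℝ)
    (hh : ∀ σ, h (flipSigns (markAt m i) σ) = h σ) : ∑ σ, rsign (σ m i) * h σ = 0 := by
  have h1 := sum_flipSigns (markAt m i) fun σ => rsign (σ m i) * h σ
  have h2 : ∀ σ : Fin M → Fin n → Bool, rsign (flipSigns (markAt m i) σ m i) = -rsign (σ m i) := by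
    intro σ; simp [flipSigns, markAt]
  simp only [h2, hh, neg_mul, Finset.sum_neg_distrib] at h1
  linarith

/-- The difference of the losses of `ω` and of `ωs` at a sample. -/
def lossDiff (f : Param d → Predictor env) (loss : Fin M → ℝ → ℝ → ℝ) (ωs ω : Param d) (m : Fin M)
    (s : Sample env m) : ℝ :=
  loss m (f ω m s.1 s.2.1) s.2.2 - loss m (f ωs m s.1 s.2.1) s.2.2

theorem WellSpecified.measurable_lossDiff (h : WellSpecified env f loss Θ μf ωs) (m : Fin M) :
    Measurable fun q : Param d × Sample env m => lossDiff f loss ωs q.1 m q.2 := by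
  have hf : Measurable fun q : (Param d × env.Ctx m) × Fin K => f q.1.1 m q.1.2 q.2 :=
    measurable_from_prod_countable_left fun a => h.measurable_f m a
  have h1 : ∀ g : Param d × Sample env m → Param d, Measurable g →
      Measurable fun q : Param d × Sample env m =>
        loss m (f (g q) m q.2.1 q.2.2.1) q.2.2.2 := fun g hg =>
    (h.measurable_loss m).comp ((hf.comp
      ((hg.prodMk (by fun_prop)).prodMk (by fun_prop) :
        Measurable fun q : Param d × Sample env m => ((g q, q.2.1), q.2.2.1))).prodMk
      (by fun_prop : Measurable fun q : Param d × Sample env m => q.2.2.2))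
  exact (h1 _ measurable_fst).sub (h1 _ measurable_const)

/-- Subtracting the loss of the fixed `ωs` is free, because its signed average vanishes. The choice
`W` may depend on the signs, as the supremum does; later arguments use such selections in place of
the supremum. -/
theorem avg_le_empRademacher {W : (Fin M → Fin n → Bool) → Param d} (hW : ∀ σ, W σ ∈ Θ)
    (S : Dataset env n) :
    ENNReal.ofReal ((1 / 2 ^ (M * n)) * ∑ σ : Fin M → Fin n → Bool, (1 / ((M : ℝ) * n)) *
      ∑ m, ∑ i, rsign (σ m i) * lossDiff f loss ωs (W σ) m (S m i)) ≤
      (empRademacher f loss Θ S).toENNReal := by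
  have h0 : ∑ σ : Fin M → Fin n → Bool, (1 / ((M : ℝ) * n)) *
      ∑ m, ∑ i, rsign (σ m i) * lossDiff f loss ωs (W σ) m (S m i) =
      ∑ σ : Fin M → Fin n → Bool, (1 / ((M : ℝ) * n)) *
      ∑ m, ∑ i, rsign (σ m i) * loss m (f (W σ) m (S m i).1 (S m i).2.1) (S m i).2.2 := by
    rw [← Finset.mul_sum, ← Finset.mul_sum]
    congr 1
    have : ∑ σ : Fin M → Fin n → Bool, ∑ m, ∑ i,
        rsign (σ m i) * loss m (f ωs m (S m i).1 (S m i).2.1) (S m i).2.2 = 0 := by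
      rw [Finset.sum_comm]
      refine Finset.sum_eq_zero fun m _ => ?_
      rw [Finset.sum_comm]
      exact Finset.sum_eq_zero fun i _ => sum_rsign_mul_eq_zero m i _ fun _ => rfl
    simp only [lossDiff, mul_sub, Finset.sum_sub_distrib, this, sub_zero]
  have hco : ∀ x : ℝ, ENNReal.ofReal x = (x : EReal).toENNReal := fun x => by
    rw [EReal.toENNReal_of_ne_top (EReal.coe_ne_top x), EReal.toReal_coe]
  rw [h0, hco]
  refine EReal.toENNReal_le_toENNReal ?_
  rw [EReal.coe_mul, empRademacher]
  refine mul_le_mul_of_nonneg_left ?_ (by exact_mod_cast by positivity)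
  have hc : ∀ F : (Fin M → Fin n → Bool) → ℝ,
      ((∑ σ, F σ : ℝ) : EReal) = ∑ σ, (F σ : EReal) := fun F =>
    map_sum (⟨⟨Real.toEReal, rfl⟩, EReal.coe_add⟩ : ℝ →+ EReal) F Finset.univ
  rw [hc]
  refine Finset.sum_le_sum fun σ _ => ?_
  exact le_iSup₂_of_le (f := fun ω (_ : ω ∈ Θ) => (((1 / ((M : ℝ) * n)) * ∑ m, ∑ i,
      rsign (σ m i) * loss m (f ω m (S m i).1 (S m i).2.1) (S m i).2.2 : ℝ) : EReal))
      (W σ) (hW σ) le_rfl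

/-- The selection takes `ω` when this makes the signed difference at `(m, i)` nonnegative and `ωs`
otherwise. It depends on that one sign only, so all other places average to zero. The bound serves
to make loss differences integrable. -/
theorem abs_lossDiff_le_empRademacher {ω : Param d} (hω : ω ∈ Θ) (hs : ωs ∈ Θ)
    (S : Dataset env n) (m : Fin M) (i : Fin n) :
    ENNReal.ofReal ((1 / (2 * ((M : ℝ) * n))) * |lossDiff f loss ωs ω m (S m i)|) ≤
      (empRademacher f loss Θ S).toENNReal := by
  classical
  set D := lossDiff f loss ωs ω m (S m i) with hD
  let W : (Fin M → Fin n → Bool) → Param d := fun σ =>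
    if 0 ≤ rsign (σ m i) * D then ω else ωs
  refine le_trans (ENNReal.ofReal_le_ofReal (le_of_eq ?_))
    (avg_le_empRademacher (W := W) (ωs := ωs) (fun σ => ?_) S)
  swap
  · simp only [W]; split_ifs <;> assumption
  have hself : ∀ m' (s : Sample env m'), lossDiff f loss ωs ωs m' s = 0 := fun _ _ => sub_self _
  rw [← Finset.mul_sum, Finset.sum_comm,
    Finset.sum_eq_single m]
  rotate_left
  · intro m' _ hm
    rw [Finset.sum_comm]
    refine Finset.sum_eq_zero fun i' _ => sum_rsign_mul_eq_zero m' i' _ fun σ => ?_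
    simp [W, flipSigns, markAt, Ne.symm hm]
  · simp
  rw [Finset.sum_comm, Finset.sum_eq_single i]
  rotate_left
  · intro i' _ hi
    refine sum_rsign_mul_eq_zero m i' _ fun σ => ?_
    simp [W, flipSigns, markAt, Ne.symm hi]
  · simp
  -- The positive part of `±D` is `(|D| ± D) / 2`, and the signed half averages out.
  have h1 : ∀ σ : Fin M → Fin n → Bool, rsign (σ m i) * lossDiff f loss ωs (W σ) m (S m i) =
      (1 / 2) * |D| + rsign (σ m i) * (D / 2) := by
    intro σ
    simp only [W]
    cases σ m i <;> simp only [rsign, if_true, Bool.false_eq_true, if_false] <;> split_ifs with h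
    · rw [abs_of_nonpos (by linarith)]; simp only [← hD]; ring
    · rw [hself, abs_of_pos (by linarith)]; ring
    · rw [abs_of_nonneg (by linarith)]; simp only [← hD]; ring
    · rw [hself, abs_of_neg (by linarith)]; ring
  simp only [h1, Finset.sum_add_distrib]
  rw [sum_rsign_mul_eq_zero m i (fun _ => D / 2) fun _ => rfl]
  have : (Fintype.card (Fin M → Fin n → Bool) : ℝ) = 2 ^ (M * n) := by
    simp [Fintype.card_pi, mul_comm M n, pow_mul]
  simp only [Finset.sum_const, Finset.card_univ, nsmul_eq_mul, this, add_zero]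
  field_simp

end FedIGW

end

noncomputable section

namespace FedIGW

variable {M K d n : ℕ} {env : Environment.{u} M K} {p : Predictor env}
  {f : Param d → Predictor env} {loss : Fin M → ℝ → ℝ → ℝ} {Θ : Set (Param d)} {μf : ℝ}
  {ωs : Param d} {R : ℝ≥0}

/-! ### Symmetrization -/

theorem ofReal_integral_le_lintegral {α : Type*} [MeasurableSpace α] {μ : Measure α} {g : α → ℝ}
    (hg : Integrable g μ) : ENNReal.ofReal (∫ x, g x ∂μ) ≤ ∫⁻ x, ENNReal.ofReal (g x) ∂μ := by
  have h1 : ∫ x, g x ∂μ ≤ ∫ x, max (g x) 0 ∂μ :=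
    integral_mono hg hg.pos_part fun x => le_max_left _ _
  refine (ENNReal.ofReal_le_ofReal h1).trans (le_of_eq ?_)
  rw [ofReal_integral_eq_lintegral_ofReal hg.pos_part (ae_of_all _ fun x => le_max_right _ _)]
  simp

/-- Only monotonicity of the lower integral enters, so the empirical complexity need not be
measurable. -/
theorem lintegral_le_of_le_empRademacher (hp : IsPolicy p)
    (hR : rademacher env f loss Θ n ≤ R) {g : Dataset env n → ℝ≥0∞}
    (hg : ∀ S, g S ≤ (empRademacher f loss Θ S).toENNReal) :
    ∫⁻ S, g S ∂(dataLaw env n p) ≤ R :=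
  (lintegral_mono hg).trans ((le_iSup₂ (f := fun (p : Predictor env) (_ : IsPolicy p) =>
    ∫⁻ S, (empRademacher f loss Θ S).toENNReal ∂(dataLaw env n p)) p hp).trans hR)

theorem enorm_lossDiff_le (hM : 0 < M) (hn : 0 < n) {ω : Param d} (hω : ω ∈ Θ) (hs : ωs ∈ Θ)
    (S : Dataset env n) (m : Fin M) (i : Fin n) :
    ‖lossDiff f loss ωs ω m (S m i)‖ₑ ≤
      ENNReal.ofReal (2 * ((M : ℝ) * n)) * (empRademacher f loss Θ S).toENNReal := by
  have hpos : (0 : ℝ) < 2 * ((M : ℝ) * n) := by positivity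
  refine le_trans (le_of_eq ?_)
    (mul_le_mul_right (abs_lossDiff_le_empRademacher (f := f) (loss := loss) hω hs S m i) _)
  rw [← ENNReal.ofReal_mul hpos.le, Real.enorm_eq_ofReal_abs]
  congr 1
  field_simp

theorem lintegral_enorm_lossDiff_le (hM : 0 < M) (hn : 0 < n) (hp : IsPolicy p)
    (hR : rademacher env f loss Θ n ≤ R) (hs : ωs ∈ Θ) {W : Dataset env n → Param d}
    (hWΘ : ∀ S, W S ∈ Θ) (m : Fin M) (i : Fin n) :
    ∫⁻ S, ‖lossDiff f loss ωs (W S) m (S m i)‖ₑ ∂(dataLaw env n p) ≤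
      ENNReal.ofReal (2 * ((M : ℝ) * n)) * R := by
  have hpos : (0 : ℝ) < 2 * ((M : ℝ) * n) := by positivity
  set c := ENNReal.ofReal (2 * ((M : ℝ) * n)) with hc
  have hc0 : c ≠ 0 := (ENNReal.ofReal_pos.2 hpos).ne'
  have hct : c ≠ ∞ := ENNReal.ofReal_ne_top
  have h1 := lintegral_le_of_le_empRademacher (g := fun S =>
    c⁻¹ * ‖lossDiff f loss ωs (W S) m (S m i)‖ₑ) hp hR fun S => by
      refine (mul_le_mul_right (enorm_lossDiff_le hM hn (hWΘ S) hs S m i) _).trans (le_of_eq ?_)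
      rw [← mul_assoc, ENNReal.inv_mul_cancel hc0 hct, one_mul]
  rw [lintegral_const_mul' _ _ (by simpa using hc0)] at h1
  calc _ = c * (c⁻¹ * ∫⁻ S, ‖lossDiff f loss ωs (W S) m (S m i)‖ₑ ∂(dataLaw env n p)) := by
        rw [← mul_assoc, ENNReal.mul_inv_cancel hc0 hct, one_mul]
    _ ≤ _ := mul_le_mul_right h1 _

/-- The losses have no a priori bound; finiteness of the Rademacher complexity supplies the
domination. -/
theorem WellSpecified.integrable_lossDiff_self (h : WellSpecified env f loss Θ μf ωs)
    (hM : 0 < M) (hn : 0 < n) (hp : IsPolicy p) (hR : rademacher env f loss Θ n ≤ R)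
    {W : Dataset env n → Param d} (hW : Measurable W)
    (hWΘ : ∀ S, W S ∈ Θ) (m : Fin M) (i : Fin n) :
    Integrable (fun S => lossDiff f loss ωs (W S) m (S m i)) (dataLaw env n p) := by
  refine ⟨Measurable.aestronglyMeasurable ?_, ?_⟩
  · exact (h.measurable_lossDiff m).comp (hW.prodMk (by fun_prop))
  · exact (lintegral_enorm_lossDiff_le hM hn hp hR h.mem hWΘ m i).trans_lt
      (ENNReal.mul_lt_top ENNReal.ofReal_lt_top ENNReal.coe_lt_top)

theorem WellSpecified.integrable_lossDiff (h : WellSpecified env f loss Θ μf ωs)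
    (hM : 0 < M) (hn : 0 < n) (hp : IsPolicy p) (hR : rademacher env f loss Θ n ≤ R)
    {ω : Param d} (hω : ω ∈ Θ) (m : Fin M) :
    Integrable (lossDiff f loss ωs ω m) (sampleLaw env p m) :=
  ((hp.measurePreserving_eval m (⟨0, hn⟩ : Fin n)).integrable_comp
    ((h.measurable_lossDiff m).comp measurable_prodMk_left).aestronglyMeasurable).1
    (h.integrable_lossDiff_self hM hn hp hR measurable_const (fun _ => hω) m ⟨0, hn⟩)

theorem WellSpecified.integrable_lossDiff_prod (h : WellSpecified env f loss Θ μf ωs)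
    (hM : 0 < M) (hn : 0 < n) (hp : IsPolicy p) (hR : rademacher env f loss Θ n ≤ R)
    {W : Dataset env n → Param d} (hW : Measurable W)
    (hWΘ : ∀ S, W S ∈ Θ) (m : Fin M) (i : Fin n) :
    Integrable (fun q : Dataset env n × Dataset env n => lossDiff f loss ωs (W q.1) m (q.2 m i))
      ((dataLaw env n p).prod (dataLaw env n p)) := by
  have := hp.isProbabilityMeasure_dataLaw n
  have hmeas : Measurable fun q : Dataset env n × Dataset env n =>
      lossDiff f loss ωs (W q.1) m (q.2 m i) :=
    (h.measurable_lossDiff m).comp ((hW.comp measurable_fst).prodMk (by fun_prop))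
  refine ⟨hmeas.aestronglyMeasurable, ?_⟩
  rw [HasFiniteIntegral, lintegral_prod _ hmeas.enorm.aemeasurable]
  refine (lintegral_mono fun S =>
    lintegral_enorm_lossDiff_le (W := fun _ => W S) hM hn hp hR h.mem (fun _ => hWΘ S) m i).trans_lt
    ?_
  rw [lintegral_const, measure_univ, mul_one]
  exact ENNReal.mul_lt_top ENNReal.ofReal_lt_top ENNReal.coe_lt_top

/-- The generalization gap of a data-dependent parameter, measured by loss differences. -/
theorem WellSpecified.ofReal_integral_gap_le (h : WellSpecified env f loss Θ μf ωs)
    (hM : 0 < M) (hn : 0 < n) (hp : IsPolicy p) (hR : rademacher env f loss Θ n ≤ R)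
    {W : Dataset env n → Param d} (hW : Measurable W)
    (hWΘ : ∀ S, W S ∈ Θ) :
    ENNReal.ofReal (∫ q, (1 / ((M : ℝ) * n)) * ∑ m, ∑ i,
      (lossDiff f loss ωs (W q.1) m (q.2 m i) - lossDiff f loss ωs (W q.1) m (q.1 m i))
      ∂((dataLaw env n p).prod (dataLaw env n p))) ≤ 2 * R := by
  have := hp.isProbabilityMeasure_dataLaw n
  set P2 := (dataLaw env n p).prod (dataLaw env n p) with hP2
  set H : Dataset env n × Dataset env n → ℝ := fun q => (1 / ((M : ℝ) * n)) * ∑ m, ∑ i,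
      (lossDiff f loss ωs (W q.1) m (q.2 m i) - lossDiff f loss ωs (W q.1) m (q.1 m i)) with hH
  have hHint : Integrable H P2 := by
    refine Integrable.const_mul ?_ _
    refine integrable_finsetSum _ fun m _ => integrable_finsetSum _ fun i _ => ?_
    refine (h.integrable_lossDiff_prod hM hn hp hR hW hWΘ m i).sub ?_
    exact (h.integrable_lossDiff_self hM hn hp hR hW hWΘ m i).comp_fst _
  -- The exchange preserves the law of the two independent datasets, so `H` may be averaged over all
  -- exchange patterns.
  have hcomp : ∀ σ, Integrable (fun q => H (exchange σ q)) P2 ∧ ∫ q, H (exchange σ q) ∂P2 =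
      ∫ q, H q ∂P2 := by
    intro σ
    have he := hp.measurePreserving_exchange (n := n) σ
    refine ⟨(he.integrable_comp hHint.aestronglyMeasurable).2 hHint, ?_⟩
    rw [← integral_map he.measurable.aemeasurable (by rw [he.map_eq]; exact hHint.1), he.map_eq]
  have hcard : (Fintype.card (Fin M → Fin n → Bool) : ℝ) = 2 ^ (M * n) := by
    simp [Fintype.card_pi, mul_comm M n, pow_mul]
  have hav : ∫ q, H q ∂P2 =
      ∫ q, (1 / 2 ^ (M * n)) * ∑ σ : Fin M → Fin n → Bool, H (exchange σ q) ∂P2 := by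
    rw [integral_const_mul (1 / 2 ^ (M * n) : ℝ) fun q => ∑ σ, H (exchange σ q),
      integral_finsetSum _ fun σ _ => (hcomp σ).1]
    simp only [(hcomp _).2, Finset.sum_const, Finset.card_univ, nsmul_eq_mul, hcard]
    field_simp
  have hint : Integrable
      (fun q => (1 / 2 ^ (M * n)) * ∑ σ : Fin M → Fin n → Bool, H (exchange σ q)) P2 :=
    (integrable_finsetSum _ fun σ _ => (hcomp σ).1).const_mul _
  rw [hav]
  refine (ofReal_integral_le_lintegral hint).trans ?_
  let F : ((Fin M → Fin n → Bool) → Param d) → Dataset env n → ℝ := fun V S =>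
    (1 / 2 ^ (M * n)) * ∑ σ : Fin M → Fin n → Bool, (1 / ((M : ℝ) * n)) *
      ∑ m, ∑ i, rsign (σ m i) * lossDiff f loss ωs (V σ) m (S m i)
  -- An exchange at `(m, i)` reverses the sign of the difference there. Terms on `q.2` carry the
  -- sign `σ`, those on `q.1` the opposite one, so the second sum is reindexed by flipping all
  -- signs.
  have hF : ∀ q, (1 / 2 ^ (M * n)) * ∑ σ : Fin M → Fin n → Bool, H (exchange σ q) =
      F (fun σ => W (exchange σ q).1) q.2 +
      F (fun σ => W (exchange (flipSigns (fun _ _ => true) σ) q).1) q.1 := by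
    intro q
    have h2 := sum_flipSigns (fun _ _ => true) fun σ : Fin M → Fin n → Bool =>
      (1 / ((M : ℝ) * n)) * ∑ m, ∑ i, rsign (flipSigns (fun _ _ => true) σ m i) *
        lossDiff f loss ωs (W (exchange σ q).1) m (q.1 m i)
    simp only [flipSigns_involutive _ _] at h2
    simp only [F]
    rw [h2, ← mul_add, ← Finset.sum_add_distrib]
    congr 1
    refine Finset.sum_congr rfl fun σ _ => ?_
    rw [← mul_add, ← Finset.sum_add_distrib]
    simp only [hH]
    refine congrArg _ (Finset.sum_congr rfl fun m _ => ?_)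
    rw [← Finset.sum_add_distrib]
    refine Finset.sum_congr rfl fun i _ => ?_
    cases hσ : σ m i <;> (simp [exchange, flipSigns, hσ, rsign]; ring)
  have hFm : ∀ V : Dataset env n × Dataset env n → (Fin M → Fin n → Bool) → Param d,
      (∀ σ, Measurable fun q => V q σ) → ∀ g : Dataset env n × Dataset env n → Dataset env n,
      Measurable g → Measurable fun q => ENNReal.ofReal (F (V q) (g q)) := by
    intro V hV g hg
    refine Measurable.ennreal_ofReal (Measurable.const_mul (Finset.measurable_fun_sum _ fun σ _ =>
      Measurable.const_mul (Finset.measurable_fun_sum _ fun m _ =>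
        Finset.measurable_fun_sum _ fun i _ => Measurable.const_mul ?_ _) _) _)
    exact (h.measurable_lossDiff m).comp ((hV σ).prodMk (by fun_prop))
  have hVm : ∀ σ : Fin M → Fin n → Bool, Measurable fun q : Dataset env n × Dataset env n =>
      W (exchange σ q).1 := fun σ => hW.comp (measurable_exchange σ).fst
  have hm1 := hFm _ hVm _ measurable_snd
  have hm2 := hFm (fun q σ => W (exchange (flipSigns (fun _ _ => true) σ) q).1)
    (fun σ => hVm _) _ measurable_fst
  calc ∫⁻ q, ENNReal.ofReal
        ((1 / 2 ^ (M * n)) * ∑ σ : Fin M → Fin n → Bool, H (exchange σ q)) ∂P2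
      ≤ ∫⁻ q, (ENNReal.ofReal (F (fun σ => W (exchange σ q).1) q.2) + ENNReal.ofReal
          (F (fun σ => W (exchange (flipSigns (fun _ _ => true) σ) q).1) q.1)) ∂P2 :=
        lintegral_mono fun q => by rw [hF]; exact ENNReal.ofReal_add_le
    _ = (∫⁻ q, ENNReal.ofReal (F (fun σ => W (exchange σ q).1) q.2) ∂P2) + ∫⁻ q, ENNReal.ofReal
          (F (fun σ => W (exchange (flipSigns (fun _ _ => true) σ) q).1) q.1) ∂P2 :=
        lintegral_add_left hm1 _
    _ ≤ R + R := by
        refine add_le_add ?_ ?_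
        -- The selected parameter depends on both datasets, which is harmless: pointwise it is a
        -- sign-dependent element of `Θ`, and the bound by the complexity of the other dataset holds
        -- for every such choice.
        · rw [hP2, lintegral_prod _ hm1.aemeasurable]
          refine (lintegral_mono fun S => lintegral_le_of_le_empRademacher hp hR fun S' =>
            avg_le_empRademacher (fun σ => hWΘ _) S').trans ?_
          simp
        · rw [hP2, lintegral_prod_symm _ hm2.aemeasurable]
          refine (lintegral_mono fun S => lintegral_le_of_le_empRademacher hp hR fun S' =>
            avg_le_empRademacher (fun σ => hWΘ _) S').trans ?_
          simp
    _ = 2 * R := (two_mul _).symm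

end FedIGW

end

noncomputable section

namespace FedIGW

variable {M K d n : ℕ} {env : Environment.{u} M K} {p : Predictor env}
  {f : Param d → Predictor env} {loss : Fin M → ℝ → ℝ → ℝ} {Θ : Set (Param d)} {μf : ℝ}
  {ωs : Param d} {R : ℝ≥0}

/-! ### Excess risk and squared error -/

theorem integral_sampleLaw (hp : IsPolicy p) (m : Fin M) {g : Sample env m → ℝ}
    (hgm : Measurable g) (hg : Integrable g (sampleLaw env p m)) :
    Integrable (fun x => ∑ a, p m x a * ∫ r, g (x, a, r a) ∂(env.rewardLaw m x)) (env.ctxLaw m) ∧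
    ∫ s, g s ∂(sampleLaw env p m) =
      ∫ x, ∑ a, p m x a * ∫ r, g (x, a, r a) ∂(env.rewardLaw m x) ∂(env.ctxLaw m) := by
  have hmap : ∀ a : Fin K, Measurable
      fun z : env.Ctx m × (Fin K → ℝ) => ((z.1, a, z.2 a) : Sample env m) := fun a => by
    fun_prop
  have hw : ∀ a : Fin K, Measurable
      fun z : env.Ctx m × (Fin K → ℝ) => ENNReal.ofReal (p m z.1 a) := fun a =>
    ((hp.measurable m a).comp measurable_fst).ennreal_ofReal
  have hwt : ∀ a : Fin K, ∀ᵐ z ∂(env.ctxLaw m ⊗ₘ env.rewardLaw m),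
      ENNReal.ofReal (p m z.1 a) < ∞ := fun a => ae_of_all _ fun _ => ENNReal.ofReal_lt_top
  rw [sampleLaw] at hg ⊢
  have hga := integrable_finsetSum_measure.1 hg
  have hint : ∀ a, Integrable (fun z : env.Ctx m × (Fin K → ℝ) => p m z.1 a * g (z.1, a, z.2 a))
      (env.ctxLaw m ⊗ₘ env.rewardLaw m) := by
    intro a
    have h1 := (integrable_map_measure hgm.aestronglyMeasurable (hmap a).aemeasurable).1
      (hga a (Finset.mem_univ a))
    rw [integrable_withDensity_iff_integrable_smul' (hw a) (hwt a)] at h1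
    simpa [ENNReal.toReal_ofReal (hp.nonneg _ _ _)] using h1
  have hx : ∀ a, Integrable (fun x => p m x a * ∫ r, g (x, a, r a) ∂(env.rewardLaw m x))
      (env.ctxLaw m) := by
    intro a
    have h1 := (hint a).integral_compProd
    simpa [integral_const_mul] using h1
  refine ⟨integrable_finsetSum _ fun a _ => hx a, ?_⟩
  rw [integral_finsetSum_measure hga, integral_finsetSum _ fun a _ => hx a]
  refine Finset.sum_congr rfl fun a _ => ?_
  rw [integral_map (hmap a).aemeasurable hgm.aestronglyMeasurable,
    integral_withDensity_eq_integral_toReal_smul (hw a) (hwt a)]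
  simp only [ENNReal.toReal_ofReal (hp.nonneg _ _ _), smul_eq_mul]
  rw [Measure.integral_compProd (hint a)]
  simp only [integral_const_mul]

/-- Strong convexity passes to the conditional mean `g` of the loss. Comparing `g` at its minimizer
`z₀` with `g` at `(1 - t) z₀ + t z` and dividing by `t` gives the bound with the factor `1 - t`,
which tends to one. -/
theorem WellSpecified.sq_le_integral (h : WellSpecified env f loss Θ μf ωs) (m : Fin M)
    (x : env.Ctx m) (a : Fin K) (z : ℝ) :
    μf / 2 * (z - f ωs m x a) ^ 2 ≤
      ∫ r, loss m z (r a) - loss m (f ωs m x a) (r a) ∂(env.rewardLaw m x) := by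
  set z₀ := f ωs m x a with hz
  set g : ℝ → ℝ := fun z => ∫ r, loss m z (r a) ∂(env.rewardLaw m x) with hg
  have hmin : ∀ z, g z₀ ≤ g z := h.optimal m x a
  have hconv : ∀ t : ℝ, 0 < t → t < 1 →
      g ((1 - t) * z₀ + t * z) ≤ (1 - t) * g z₀ + t * g z - (1 - t) * t * (μf / 2 * (z - z₀) ^ 2) := by
    intro t h0 h1
    have hi : Integrable (fun r => (1 - t) * loss m z₀ (r a) + t * loss m z (r a) -
        (1 - t) * t * (μf / 2 * (z - z₀) ^ 2)) (env.rewardLaw m x) :=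
      (((h.integrable m x a z₀).const_mul _).add ((h.integrable m x a z).const_mul _)).sub
        (integrable_const _)
    have h2 := integral_mono (h.integrable m x a ((1 - t) * z₀ + t * z)) hi fun r => by
      have := (h.strongConvex m (r a)).2 (Set.mem_univ z₀) (Set.mem_univ z)
        (by linarith : 0 ≤ 1 - t) h0.le (by ring)
      simp only [smul_eq_mul, Real.norm_eq_abs, sq_abs] at this
      rw [show (z - z₀) ^ 2 = (z₀ - z) ^ 2 by ring]
      exact this
    refine h2.trans (le_of_eq ?_)
    have hadd : Integrable (fun r => (1 - t) * loss m z₀ (r a) + t * loss m z (r a))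
        (env.rewardLaw m x) :=
      ((h.integrable m x a z₀).const_mul _).add ((h.integrable m x a z).const_mul _)
    rw [integral_sub hadd (integrable_const _),
      integral_add ((h.integrable m x a z₀).const_mul _) ((h.integrable m x a z).const_mul _),
      integral_const_mul, integral_const_mul, integral_const]
    simp [hg]
  rw [integral_sub (h.integrable m x a z) (h.integrable m x a z₀)]
  change μf / 2 * (z - z₀) ^ 2 ≤ g z - g z₀
  set c := μf / 2 * (z - z₀) ^ 2
  have hc : ∀ t : ℝ, 0 < t → t < 1 → (1 - t) * c ≤ g z - g z₀ := by
    intro t h0 h1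
    have h3 := (hmin _).trans (hconv t h0 h1)
    have : t * ((1 - t) * c) ≤ t * (g z - g z₀) := by linarith
    exact le_of_mul_le_mul_left this h0
  by_contra hcon
  push Not at hcon
  have hge : 0 ≤ g z - g z₀ := sub_nonneg.2 (hmin z)
  have hcpos : 0 < c := lt_of_le_of_lt hge hcon
  -- For this `t` the left side `(1 - t) * c` is the midpoint of `c` and `g z - g z₀`, a
  -- contradiction if `c` is the larger.
  have := hc ((c - (g z - g z₀)) / (2 * c)) (by apply div_pos <;> linarith)
    (by rw [div_lt_one (by positivity)]; linarith)
  rw [sub_mul, one_mul, div_mul_eq_mul_div, mul_div_mul_right _ _ hcpos.ne'] at this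
  linarith

/-- The squared error of the prediction with parameter `ω`, under the action selection `p`, summed
over the agents. -/
def sqError (f : Param d → Predictor env) (ωs : Param d) (p : Predictor env) (ω : Param d) :
    ℝ≥0∞ :=
  ∑ m, ∫⁻ x, ENNReal.ofReal (∑ a, p m x a * (f ω m x a - f ωs m x a) ^ 2) ∂(env.ctxLaw m)

theorem globalLoss_sub_eq (S : Dataset env n) (ω : Param d) :
    globalLoss loss S (f ω) - globalLoss loss S (f ωs) =
      (1 / ((M : ℝ) * n)) * ∑ m, ∑ i, lossDiff f loss ωs ω m (S m i) := by
  simp only [globalLoss, localLoss, lossDiff, Finset.sum_sub_distrib, ← Finset.mul_sum,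
    one_div, mul_inv]
  ring

theorem WellSpecified.mul_sqError_le (h : WellSpecified env f loss Θ μf ωs) (hμ : 0 ≤ μf)
    (hM : 0 < M) (hn : 0 < n) (hp : IsPolicy p) (hR : rademacher env f loss Θ n ≤ R)
    {ω : Param d} (hω : ω ∈ Θ) (m : Fin M) :
    0 ≤ ∫ s, lossDiff f loss ωs ω m s ∂(sampleLaw env p m) ∧
    ENNReal.ofReal (μf / 2) *
      ∫⁻ x, ENNReal.ofReal (∑ a, p m x a * (f ω m x a - f ωs m x a) ^ 2) ∂(env.ctxLaw m) ≤
      ENNReal.ofReal (∫ s, lossDiff f loss ωs ω m s ∂(sampleLaw env p m)) := by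
  obtain ⟨hi, he⟩ := integral_sampleLaw hp m
    ((h.measurable_lossDiff m).comp measurable_prodMk_left)
    (h.integrable_lossDiff hM hn hp hR hω m)
  simp only [Function.comp_def] at hi he
  have hpt : ∀ x, μf / 2 * ∑ a, p m x a * (f ω m x a - f ωs m x a) ^ 2 ≤ ∑ a, p m x a *
      ∫ r, lossDiff f loss ωs ω m (x, a, r a) ∂(env.rewardLaw m x) := by
    intro x
    rw [Finset.mul_sum]
    refine Finset.sum_le_sum fun a _ => ?_
    rw [mul_left_comm]
    exact mul_le_mul_of_nonneg_left (h.sq_le_integral m x a _) (hp.nonneg m x a)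
  have h0 : ∀ x, 0 ≤ μf / 2 * ∑ a, p m x a * (f ω m x a - f ωs m x a) ^ 2 := fun x =>
    mul_nonneg (by positivity) (Finset.sum_nonneg fun a _ =>
      mul_nonneg (hp.nonneg m x a) (sq_nonneg _))
  rw [he]
  refine ⟨integral_nonneg fun x => (h0 x).trans (hpt x), ?_⟩
  rw [ofReal_integral_eq_lintegral_ofReal hi (ae_of_all _ fun x => (h0 x).trans (hpt x)),
    ← lintegral_const_mul' _ _ ENNReal.ofReal_ne_top]
  refine lintegral_mono fun x => ?_
  rw [← ENNReal.ofReal_mul (by positivity)]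
  exact ENNReal.ofReal_le_ofReal (hpt x)

/-- The expected squared error of a data-dependent parameter, in terms of the Rademacher complexity
and of its empirical suboptimality. -/
theorem WellSpecified.lintegral_sqError_le (h : WellSpecified env f loss Θ μf ωs) (hμ : 0 ≤ μf)
    (hM : 0 < M) (hn : 0 < n) (hp : IsPolicy p) (hR : rademacher env f loss Θ n ≤ R)
    {W : Dataset env n → Param d} (hW : Measurable W) (hWΘ : ∀ S, W S ∈ Θ) :
    ENNReal.ofReal (μf / 2) * ∫⁻ S, sqError f ωs p (W S) ∂(dataLaw env n p) ≤
      M * (2 * R + ∫⁻ S, ENNReal.ofReal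
        (globalLoss loss S (f (W S)) - globalLoss loss S (f ωs)) ∂(dataLaw env n p)) := by
  have hprob := hp.isProbabilityMeasure_dataLaw n
  have hsamp := fun m => hp.isProbabilityMeasure_sampleLaw m
  set P := dataLaw env n p with hP
  let D : Fin M → Param d → ℝ := fun m ω => ∫ s, lossDiff f loss ωs ω m s ∂(sampleLaw env p m)
  have hprod := fun m i => h.integrable_lossDiff_prod hM hn hp hR hW hWΘ m i
  have hself := fun m i => h.integrable_lossDiff_self hM hn hp hR hW hWΘ m i
  have hDS : ∀ m (i : Fin n) S, ∫ S', lossDiff f loss ωs (W S) m (S' m i) ∂P = D m (W S) := by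
    intro m i S
    have he := hp.measurePreserving_eval (n := n) m i
    have hms : Measurable fun s => lossDiff f loss ωs (W S) m s :=
      (h.measurable_lossDiff m).comp measurable_prodMk_left
    rw [← integral_map (f := fun s => lossDiff f loss ωs (W S) m s) he.measurable.aemeasurable
      hms.aestronglyMeasurable, he.map_eq]
  have hDint : ∀ m, Integrable (fun S => D m (W S)) P := by
    intro m
    have := (hprod m ⟨0, hn⟩).integral_prod_left
    simpa only [← hP, hDS] using this
  have hsumint : Integrable (fun S => ∑ m, D m (W S)) P := integrable_finsetSum _ fun m _ => hDint m
  have hDprod : ∀ m i, ∫ q, lossDiff f loss ωs (W q.1) m (q.2 m i) ∂(P.prod P) =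
      ∫ S, D m (W S) ∂P := by
    intro m i
    rw [integral_prod _ (hprod m i)]
    simp only [← hP, hDS]
  have hD0 : ∀ S, 0 ≤ ∑ m, D m (W S) := fun S => Finset.sum_nonneg fun m _ =>
    (h.mul_sqError_le hμ hM hn hp hR (hWΘ S) m).1
  have hgl : Integrable (fun S => globalLoss loss S (f (W S)) - globalLoss loss S (f ωs)) P := by
    simp only [globalLoss_sub_eq]
    exact (integrable_finsetSum _ fun m _ => integrable_finsetSum _ fun i _ =>
      hself m i).const_mul _
  have hgap := h.ofReal_integral_gap_le hM hn hp hR hW hWΘ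
  set I := ∫ q, (1 / ((M : ℝ) * n)) * ∑ m, ∑ i,
      (lossDiff f loss ωs (W q.1) m (q.2 m i) - lossDiff f loss ωs (W q.1) m (q.1 m i))
      ∂(P.prod P) with hI
  -- Excess risk is generalization gap plus empirical excess. The factor `M` appears because risks
  -- are summed over the agents and losses are averaged.
  have hIeq : ∫ S, ∑ m, D m (W S) ∂P = M * (I + ∫ S, (globalLoss loss S (f (W S)) -
      globalLoss loss S (f ωs)) ∂P) := by
    have h1 : I = (1 / ((M : ℝ) * n)) * ∑ m, ∑ i : Fin n, (∫ S, D m (W S) ∂P -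
        ∫ S, lossDiff f loss ωs (W S) m (S m i) ∂P) := by
      have hd : ∀ m (i : Fin n), Integrable (fun q : Dataset env n × Dataset env n =>
          lossDiff f loss ωs (W q.1) m (q.2 m i) - lossDiff f loss ωs (W q.1) m (q.1 m i))
          (P.prod P) := fun m i => (hprod m i).sub ((hself m i).comp_fst _)
      rw [hI, integral_const_mul, integral_finsetSum _ fun m _ => integrable_finsetSum _ fun i _ =>
        hd m i]
      congr 1
      refine Finset.sum_congr rfl fun m _ => ?_
      rw [integral_finsetSum _ fun i _ => hd m i]
      refine Finset.sum_congr rfl fun i _ => ?_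
      rw [integral_sub (hprod m i) ((hself m i).comp_fst _), ← hP, hDprod,
        integral_fun_fst (fun S => lossDiff f loss ωs (W S) m (S m i))]
      simp
    rw [h1]
    simp only [globalLoss_sub_eq]
    rw [integral_const_mul, integral_finsetSum _ fun m _ => integrable_finsetSum _ fun i _ =>
      hself m i]
    simp only [integral_finsetSum _ fun i _ => hself _ i]
    rw [integral_finsetSum _ fun m _ => hDint m]
    simp only [Finset.sum_sub_distrib, Finset.sum_const, Finset.card_univ, Fintype.card_fin,
      nsmul_eq_mul, ← Finset.mul_sum]
    field_simp
    ring
  calc ENNReal.ofReal (μf / 2) * ∫⁻ S, sqError f ωs p (W S) ∂P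
      = ∫⁻ S, ENNReal.ofReal (μf / 2) * sqError f ωs p (W S) ∂P :=
        (lintegral_const_mul' _ _ ENNReal.ofReal_ne_top).symm
    _ ≤ ∫⁻ S, ENNReal.ofReal (∑ m, D m (W S)) ∂P := by
        refine lintegral_mono fun S => ?_
        rw [sqError, Finset.mul_sum, ENNReal.ofReal_sum_of_nonneg fun m _ =>
          (h.mul_sqError_le hμ hM hn hp hR (hWΘ S) m).1]
        exact Finset.sum_le_sum fun m _ => (h.mul_sqError_le hμ hM hn hp hR (hWΘ S) m).2
    _ = ENNReal.ofReal (M * (I + ∫ S, (globalLoss loss S (f (W S)) -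
          globalLoss loss S (f ωs)) ∂P)) := by
        rw [← hIeq, ofReal_integral_eq_lintegral_ofReal hsumint (ae_of_all _ hD0)]
    _ ≤ M * (2 * R + ∫⁻ S, ENNReal.ofReal
        (globalLoss loss S (f (W S)) - globalLoss loss S (f ωs)) ∂P) := by
        rw [ENNReal.ofReal_mul (by positivity), ENNReal.ofReal_natCast]
        gcongr
        refine ENNReal.ofReal_add_le.trans ?_
        gcongr
        exact ofReal_integral_le_lintegral hgl

end FedIGW

end

/-! ### Squared error of a protocol's output, and inverse gap weighting for a single context. -/

noncomputable section

namespace FedIGW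

variable {M K d n : ℕ} {env : Environment.{u} M K} {p : Predictor env}
  {f : Param d → Predictor env} {loss : Fin M → ℝ → ℝ → ℝ} {Θ : Set (Param d)} {μf : ℝ}
  {ωs : Param d} {R ε : ℝ≥0}

theorem WellSpecified.measurable_true (h : WellSpecified env f loss Θ μf ωs) (m : Fin M)
    (a : Fin K) : Measurable fun x => f ωs m x a :=
  (h.measurable_f m a).comp (measurable_const.prodMk measurable_id)

theorem WellSpecified.measurable_sqError {α : Type*} [MeasurableSpace α]
    (h : WellSpecified env f loss Θ μf ωs) {π : α → Predictor env}
    (hπ : ∀ m a, Measurable fun q : α × env.Ctx m => π q.1 m q.2 a) {W : α → Param d}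
    (hW : Measurable W) : Measurable fun q => sqError f ωs (π q) (W q) := by
  refine Finset.measurable_fun_sum _ fun m _ => ?_
  refine Measurable.lintegral_prod_right' (f := fun q : α × env.Ctx m => ENNReal.ofReal
    (∑ a, π q.1 m q.2 a * (f (W q.1) m q.2 a - f ωs m q.2 a) ^ 2)) ?_
  refine Measurable.ennreal_ofReal (Finset.measurable_fun_sum _ fun a _ => (hπ m a).mul ?_)
  exact (((h.measurable_f m a).comp ((hW.comp measurable_fst).prodMk measurable_snd)).sub
    ((h.measurable_true m a).comp measurable_snd)).pow_const 2

/-- The expected squared error of the output of a federated learning protocol. -/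
theorem WellSpecified.lintegral_sqError_out_le (h : WellSpecified env f loss Θ μf ωs)
    (hμ : 0 ≤ μf) (hM : 0 < M) (hn : 0 < n) (hp : IsPolicy p)
    (hR : rademacher env f loss Θ n ≤ R) (FL : FLProtocol (Dataset env n) (Param d))
    (hout : Measurable fun q : Dataset env n × FL.Seed => FL.out q.1 q.2)
    (hΘ : ∀ S ξ, ValidData S → FL.out S ξ ∈ Θ) (hε : optError env f loss Θ n FL ≤ ε) :
    ENNReal.ofReal (μf / 2) * ∫⁻ S, ∫⁻ ξ, sqError f ωs p (FL.out S ξ) ∂FL.law ∂(dataLaw env n p) ≤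
      M * (2 * R + ε) := by
  classical
  have hprob := hp.isProbabilityMeasure_dataLaw n
  have hsq : Measurable fun q : Dataset env n × FL.Seed => sqError f ωs p (FL.out q.1 q.2) :=
    h.measurable_sqError (π := fun _ => p) (fun m a => (hp.measurable m a).comp measurable_snd) hout
  have hgl : Measurable fun q : Dataset env n × FL.Seed => ENNReal.ofReal
      (globalLoss loss q.1 (f (FL.out q.1 q.2)) - globalLoss loss q.1 (f ωs)) := by
    simp only [globalLoss_sub_eq]
    refine Measurable.ennreal_ofReal (Measurable.const_mul (Finset.measurable_fun_sum _ fun m _ =>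
        Finset.measurable_fun_sum _ fun i _ => ?_) _)
    exact (h.measurable_lossDiff m).comp (hout.prodMk (by fun_prop))
  -- With the seed frozen the output is a function of the dataset alone; the seed is integrated
  -- afterwards by Tonelli.
  have hξ : ∀ ξ, ENNReal.ofReal (μf / 2) * ∫⁻ S, sqError f ωs p (FL.out S ξ) ∂(dataLaw env n p) ≤
      M * (2 * R + ∫⁻ S, ENNReal.ofReal (globalLoss loss S (f (FL.out S ξ)) -
        globalLoss loss S (f ωs)) ∂(dataLaw env n p)) := by
    intro ξ
    -- The output is known to lie in `Θ` only for rewards in `[0,1]`. Redefining it on the remaining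
    -- null set gives a selection with values in `Θ` everywhere.
    let W : Dataset env n → Param d := fun S => if ValidData S then FL.out S ξ else ωs
    have hW : Measurable W := Measurable.ite measurableSet_validData
      (hout.comp measurable_prodMk_right) measurable_const
    have hWΘ : ∀ S, W S ∈ Θ := fun S => by
      by_cases hS : ValidData S
      · simpa [W, hS] using hΘ S ξ hS
      · simpa [W, hS] using h.mem
    have hae : ∀ᵐ S ∂(dataLaw env n p), FL.out S ξ = W S := by
      filter_upwards [hp.ae_validData] with S hS
      simp [W, hS]
    have h1 := h.lintegral_sqError_le hμ hM hn hp hR hW hWΘ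
    rw [lintegral_congr_ae (f := fun S => sqError f ωs p (FL.out S ξ))
        (g := fun S => sqError f ωs p (W S)) (hae.mono fun S hS => by simp only [hS]),
      lintegral_congr_ae (f := fun S => ENNReal.ofReal (globalLoss loss S (f (FL.out S ξ)) -
        globalLoss loss S (f ωs))) (g := fun S => ENNReal.ofReal (globalLoss loss S (f (W S)) -
        globalLoss loss S (f ωs))) (hae.mono fun S hS => by simp only [hS])]
    exact h1
  calc ENNReal.ofReal (μf / 2) * ∫⁻ S, ∫⁻ ξ, sqError f ωs p (FL.out S ξ) ∂FL.law ∂(dataLaw env n p)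
      = ∫⁻ ξ, ENNReal.ofReal (μf / 2) * ∫⁻ S, sqError f ωs p (FL.out S ξ)
          ∂(dataLaw env n p) ∂FL.law := by
        rw [lintegral_lintegral_swap hsq.aemeasurable, lintegral_const_mul' _ _ ENNReal.ofReal_ne_top]
    _ ≤ ∫⁻ ξ, M * (2 * R + ∫⁻ S, ENNReal.ofReal (globalLoss loss S (f (FL.out S ξ)) -
        globalLoss loss S (f ωs)) ∂(dataLaw env n p)) ∂FL.law := lintegral_mono hξ
    _ = M * (2 * R + ∫⁻ S, ∫⁻ ξ, ENNReal.ofReal (globalLoss loss S (f (FL.out S ξ)) -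
        globalLoss loss S (f ωs)) ∂FL.law ∂(dataLaw env n p)) := by
        rw [lintegral_const_mul' _ _ (ENNReal.natCast_ne_top M), lintegral_add_left measurable_const,
          ← lintegral_lintegral_swap hgl.aemeasurable]
        simp
    _ ≤ M * (2 * R + ε) := by
        gcongr
        refine le_trans ?_ hε
        refine le_trans (lintegral_mono fun S => lintegral_mono fun ξ => ?_)
          (le_iSup₂ (f := fun (p : Predictor env) (_ : IsPolicy p) => ∫⁻ S, ∫⁻ ξ,
            optGap f loss Θ S (FL.out S ξ) ∂FL.law ∂(dataLaw env n p)) p hp)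
        exact le_iSup₂ (f := fun (ω : Param d) (_ : ω ∈ Θ) => ENNReal.ofReal
          (globalLoss loss S (f (FL.out S ξ)) - globalLoss loss S (f ω))) ωs h.mem

/-! ### Inverse gap weighting -/

variable {sel : (Fin K → ℝ) → Fin K} {γ : ℝ} {y : Fin K → ℝ}

theorem one_div_le_one_div_card (hγ : ∀ b, 0 ≤ γ * (y (sel y) - y b)) (b : Fin K) :
    1 / ((K : ℝ) + γ * (y (sel y) - y b)) ≤ 1 / K := by
  have hK : (0 : ℝ) < K := by exact_mod_cast b.pos
  exact one_div_le_one_div_of_le hK (by linarith [hγ b])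

/-- Each of the other `K - 1` actions receives at most `1 / K`. -/
theorem one_div_card_le_igwProb (hγ : ∀ b, 0 ≤ γ * (y (sel y) - y b)) :
    1 / (K : ℝ) ≤ igwProb sel γ y (sel y) := by
  have hK : (0 : ℝ) < K := by exact_mod_cast (sel y).pos
  rw [igwProb, if_pos rfl]
  have h1 : ∑ b ∈ Finset.univ.erase (sel y), 1 / ((K : ℝ) + γ * (y (sel y) - y b)) ≤
      ∑ _b ∈ Finset.univ.erase (sel y), 1 / (K : ℝ) :=
    Finset.sum_le_sum fun b _ => one_div_le_one_div_card hγ b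
  have h2 : ∑ _b : Fin K, 1 / (K : ℝ) = 1 := by simp [hK.ne']
  have h3 := Finset.add_sum_erase Finset.univ (fun _ : Fin K => 1 / (K : ℝ))
    (Finset.mem_univ (sel y))
  linarith

theorem igwProb_nonneg (hγ : ∀ b, 0 ≤ γ * (y (sel y) - y b)) (a : Fin K) :
    0 ≤ igwProb sel γ y a := by
  by_cases ha : a = sel y
  · rw [ha]
    exact le_trans (by positivity) (one_div_card_le_igwProb hγ)
  · rw [igwProb, if_neg ha]
    have := hγ a
    positivity

theorem sum_igwProb (sel : (Fin K → ℝ) → Fin K) (γ : ℝ) (y : Fin K → ℝ) :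
    ∑ a, igwProb sel γ y a = 1 := by
  rw [← Finset.add_sum_erase _ _ (Finset.mem_univ (sel y))]
  have : ∑ a ∈ Finset.univ.erase (sel y), igwProb sel γ y a =
      ∑ b ∈ Finset.univ.erase (sel y), 1 / ((K : ℝ) + γ * (y (sel y) - y b)) :=
    Finset.sum_congr rfl fun a ha => by rw [igwProb, if_neg (Finset.ne_of_mem_erase ha)]
  rw [this, igwProb, if_pos rfl]
  ring

/-- The exploration guarantee: it lets an error measured under the sampling probabilities control
the error at each single action. -/
theorem one_le_igwProb_mul (hγ : ∀ b, 0 ≤ γ * (y (sel y) - y b)) (a : Fin K) :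
    1 ≤ igwProb sel γ y a * (K + γ * (y (sel y) - y a)) := by
  have hK : (0 : ℝ) < K := by exact_mod_cast a.pos
  by_cases ha : a = sel y
  · have := one_div_card_le_igwProb hγ
    rw [ha, sub_self, mul_zero, add_zero]
    rwa [div_le_iff₀ hK] at this
  · rw [igwProb, if_neg ha, one_div_mul_cancel]
    have := hγ a
    positivity

/-- The price of exploration: a non-greedy action of estimated gap `g` contributes `γ g / (K + γ g)
≤ 1`. -/
theorem sum_igwProb_mul_gap_le (hγ : ∀ b, 0 ≤ γ * (y (sel y) - y b)) :
    ∑ a, igwProb sel γ y a * (γ * (y (sel y) - y a)) ≤ K := by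
  have h1 : ∀ a, igwProb sel γ y a * (γ * (y (sel y) - y a)) ≤ 1 := by
    intro a
    have hK : (0 : ℝ) < K := by exact_mod_cast a.pos
    by_cases ha : a = sel y
    · simp [ha]
    · have := hγ a
      rw [igwProb, if_neg ha, one_div_mul_eq_div, div_le_one (by positivity)]
      linarith
  calc _ ≤ ∑ _a : Fin K, (1 : ℝ) := Finset.sum_le_sum fun a _ => h1 a
    _ = K := by simp

theorem IsArgmax.measurable_igwProb (hs : IsArgmax sel) (γ : ℝ) (a : Fin K) :
    Measurable fun y => igwProb sel γ y a := by
  have hev : Measurable fun y : Fin K → ℝ => y (sel y) :=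
    (measurable_from_prod_countable_left fun b : Fin K => measurable_pi_apply b :
      Measurable fun q : (Fin K → ℝ) × Fin K => q.1 q.2).comp (measurable_id.prodMk hs.measurable)
  have hterm : ∀ b, Measurable fun y : Fin K → ℝ => 1 / ((K : ℝ) + γ * (y (sel y) - y b)) := by
    exact fun b => (((hev.sub (measurable_pi_apply b)).const_mul γ).const_add _).const_div 1
  have hsum : (fun y : Fin K → ℝ => ∑ b ∈ Finset.univ.erase (sel y),
      1 / ((K : ℝ) + γ * (y (sel y) - y b))) = fun y => ∑ b, 1 / ((K : ℝ) + γ * (y (sel y) - y b)) -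
        1 / ((K : ℝ) + γ * (y (sel y) - y (sel y))) := by
    funext y
    rw [← Finset.add_sum_erase _ _ (Finset.mem_univ (sel y))]
    ring
  have hset : MeasurableSet {y : Fin K → ℝ | a = sel y} :=
    measurableSet_eq_fun measurable_const hs.measurable
  refine Measurable.ite hset (measurable_const.sub ?_) (hterm a)
  rw [hsum]
  refine (Finset.measurable_fun_sum _ fun b _ => hterm b).sub ?_
  exact (((hev.sub hev).const_mul γ).const_add _).const_div 1

/-- One step of the comparison of true and estimated gaps: if the sampling probabilities `p` are
bounded below in terms of the true gaps, then an estimate `y'` with small squared error under `p`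
has gaps close to the true ones. -/
theorem gap_compare {q fs y' : Fin K → ℝ} {Y γ' : ℝ} (hq : ∀ a, 0 ≤ q a) (hY : 0 ≤ Y)
    (hγ' : 0 < γ') {G : Fin K → ℝ} (hG : ∀ a, G a = (⨆ b, fs b) - fs a)
    (hinv : ∀ a, 1 ≤ q a * (K + (Y + 2 * γ' * G a))) (hs : ∀ b, y' b ≤ y' (sel y')) :
    ∀ a, G a ≤ 2 * (y' (sel y') - y' a) + ((K + Y) / 3 + 16 / 3 * γ' ^ 2 *
        ∑ b, q b * (y' b - fs b) ^ 2) / γ' ∧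
      y' (sel y') - y' a ≤ 2 * G a + ((K + Y) / 3 + 16 / 3 * γ' ^ 2 *
        ∑ b, q b * (y' b - fs b) ^ 2) / γ' := by
  have : Nonempty (Fin K) := ⟨sel y'⟩
  set δ := ∑ b, q b * (y' b - fs b) ^ 2 with hδ
  have hδ1 : ∀ a, q a * (y' a - fs a) ^ 2 ≤ δ := fun a =>
    Finset.single_le_sum (f := fun b => q b * (y' b - fs b) ^ 2)
      (fun b _ => mul_nonneg (hq b) (sq_nonneg _)) (Finset.mem_univ a)
  have hle : ∀ a, fs a ≤ ⨆ b, fs b := fun a => le_ciSup (Set.finite_range fs).bddAbove a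
  have hG0 : ∀ a, 0 ≤ G a := fun a => by rw [hG]; linarith [hle a]
  -- This is `8 γ' |e| ≤ 1 / q + 16 γ' ^ 2 q e ^ 2`, the arithmetic-geometric mean inequality,
  -- combined with the bound on `1 / q` from `hinv`. The weights leave only a quarter of the true
  -- gap on the right.
  have habs : ∀ a, |y' a - fs a| ≤ (K + Y) / (8 * γ') + G a / 4 + 2 * γ' * δ := by
    intro a
    have hqa : 0 < q a := by
      rcases (hq a).eq_or_lt with h0 | h0
      · have := hinv a
        rw [← h0] at this
        linarith
      · exact h0
    have h1 : 8 * γ' * |y' a - fs a| ≤ (K + Y + 2 * γ' * G a) + 16 * γ' ^ 2 *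
        (q a * (y' a - fs a) ^ 2) := by
      refine le_of_mul_le_mul_left ?_ hqa
      have h2 := sq_nonneg (4 * γ' * (q a * |y' a - fs a|) - 1)
      have h3 := hinv a
      rw [← sq_abs (y' a - fs a)]
      nlinarith
    have h4 : 8 * γ' * |y' a - fs a| ≤ 8 * γ' * ((K + Y) / (8 * γ') + G a / 4 + 2 * γ' * δ) := by
      have h5 : 8 * γ' * ((K + Y) / (8 * γ') + G a / 4 + 2 * γ' * δ) =
          K + Y + 2 * γ' * G a + 16 * γ' ^ 2 * δ := by field_simp; ring
      rw [h5]
      have h6 : 16 * γ' ^ 2 * (q a * (y' a - fs a) ^ 2) ≤ 16 * γ' ^ 2 * δ :=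
        mul_le_mul_of_nonneg_left (hδ1 a) (by positivity)
      linarith
    exact le_of_mul_le_mul_left h4 (by positivity)
  obtain ⟨as, has⟩ := exists_eq_ciSup_of_finite (f := fs)
  have hGs : G as = 0 := by rw [hG, has, sub_self]
  -- Two errors of size `X` arise, and absorbing `G a / 4` multiplies them by `4/3`. The resulting
  -- `8/3 * X` explains the coefficients `1/3` and `16/3` of `igwError`; that `Y` returns with a
  -- factor below one keeps the error bounded over the epochs.
  have hX : ((K + Y) / 3 + 16 / 3 * γ' ^ 2 * δ) / γ' =
      8 / 3 * ((K + Y) / (8 * γ') + 2 * γ' * δ) := by field_simp; ring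
  rw [hX]
  set X := (K + Y) / (8 * γ') + 2 * γ' * δ
  have hX0 : 0 ≤ X := by
    have : 0 ≤ δ := Finset.sum_nonneg fun b _ => mul_nonneg (hq b) (sq_nonneg _)
    positivity
  have habs' : ∀ a, y' a - fs a ≤ X + G a / 4 ∧ fs a - y' a ≤ X + G a / 4 := fun a => by
    have := abs_le.1 (habs a)
    constructor <;> simp only [X] <;> linarith
  have first : ∀ a, G a ≤ 2 * (y' (sel y') - y' a) + 8 / 3 * X := by
    intro a
    have h1 := (habs' as).2
    have h2 := (habs' a).1
    have h3 := hs as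
    have h4 := hs a
    have h5 := hG a
    rw [← has] at h5
    rw [hGs] at h1
    linarith
  intro a
  refine ⟨first a, ?_⟩
  have h1 := (habs' (sel y')).1
  have h2 := (habs' a).2
  have h3 := first (sel y')
  have h5 := hG a
  have h6 := hG (sel y')
  have h7 := hG0 a
  have h8 := hG0 (sel y')
  linarith

/-- The accumulated error of the estimates `y l`, multiplied by the learning rate. -/
def igwError (sel : (Fin K → ℝ) → Fin K) (γ : ℕ → ℝ) (fs : Fin K → ℝ) (y : ℕ → Fin K → ℝ) : ℕ → ℝ
  | 0 => 0
  | l + 1 => (K + igwError sel γ fs y l) / 3 + 16 / 3 * γ (l + 1) ^ 2 *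
      ∑ b, igwProb sel (γ l) (y l) b * (y (l + 1) b - fs b) ^ 2

section Epochs

variable {γ : ℕ → ℝ} {y : ℕ → Fin K → ℝ} {fs : Fin K → ℝ}

/-- Nothing is known about `γ 0`, but the zero estimate of epoch `0` has no gaps. -/
theorem gamma_mul_gap_nonneg (hs : IsArgmax sel) (hγ : ∀ l, 0 < γ (l + 1)) (h0 : y 0 = 0) (l : ℕ)
    (b : Fin K) : 0 ≤ γ l * (y l (sel (y l)) - y l b) := by
  cases l with
  | zero => simp [h0]
  | succ l => exact mul_nonneg (hγ l).le (sub_nonneg.2 (hs.le _ _))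

theorem igwError_nonneg (hs : IsArgmax sel) (hγ : ∀ l, 0 < γ (l + 1)) (h0 : y 0 = 0) (l : ℕ) :
    0 ≤ igwError sel γ fs y l := by
  induction l with
  | zero => simp [igwError]
  | succ l ih =>
    have : 0 ≤ ∑ b, igwProb sel (γ l) (y l) b * (y (l + 1) b - fs b) ^ 2 :=
      Finset.sum_nonneg fun b _ =>
        mul_nonneg (igwProb_nonneg (gamma_mul_gap_nonneg hs hγ h0 l) b) (sq_nonneg _)
    simp only [igwError]
    positivity

/-- The two comparisons propagate together: the upper bound on the estimated gaps of one epoch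
bounds the inverse sampling probabilities by true gaps, which is what `gap_compare` needs for the
next estimate. -/
theorem gap_le_igwError (hs : IsArgmax sel) (hγ : ∀ l, 0 < γ (l + 1))
    (hmono : ∀ l, γ (l + 1) ≤ γ (l + 2)) (h0 : y 0 = 0) (l : ℕ) :
    ∀ a, (⨆ b, fs b) - fs a ≤ 2 * (y (l + 1) (sel (y (l + 1))) - y (l + 1) a) +
        igwError sel γ fs y (l + 1) / γ (l + 1) ∧
      y (l + 1) (sel (y (l + 1))) - y (l + 1) a ≤ 2 * ((⨆ b, fs b) - fs a) +
        igwError sel γ fs y (l + 1) / γ (l + 1) := by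
  have hle : ∀ a, fs a ≤ ⨆ b, fs b := fun a => le_ciSup (Set.finite_range fs).bddAbove a
  induction l with
  | zero =>
    refine gap_compare (q := igwProb sel (γ 0) (y 0))
      (igwProb_nonneg (gamma_mul_gap_nonneg hs hγ h0 0)) (igwError_nonneg hs hγ h0 0) (hγ 0)
      (fun a => rfl) (fun a => ?_) (hs.le _)
    have hg := gamma_mul_gap_nonneg hs hγ h0 0
    refine (one_le_igwProb_mul hg a).trans
      (mul_le_mul_of_nonneg_left ?_ (igwProb_nonneg hg a))
    have h1 := mul_nonneg (hγ 0).le (sub_nonneg.2 (hle a))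
    -- Epoch `0` explores uniformly, so the requirement reduces to `K ≤ K + 2 γ G`.
    simp only [h0, igwError, Pi.zero_apply]
    linarith
  | succ l ih =>
    refine gap_compare (q := igwProb sel (γ (l + 1)) (y (l + 1)))
      (igwProb_nonneg (gamma_mul_gap_nonneg hs hγ h0 (l + 1))) (igwError_nonneg hs hγ h0 (l + 1))
      (hγ (l + 1)) (fun a => rfl) (fun a => ?_) (hs.le _)
    have hg := gamma_mul_gap_nonneg hs hγ h0 (l + 1)
    refine (one_le_igwProb_mul hg a).trans
      (mul_le_mul_of_nonneg_left ?_ (igwProb_nonneg hg a))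
    have h1 := mul_le_mul_of_nonneg_left (ih a).2 (hγ l).le
    rw [mul_add, mul_div_cancel₀ _ (hγ l).ne'] at h1
    -- Monotonicity of the learning rates replaces the old rate in front of the true gap by the new
    -- one.
    have h2 := mul_le_mul_of_nonneg_right (hmono l) (sub_nonneg.2 (hle a))
    linarith

/-- The instantaneous regret of inverse gap weighting, for one context. -/
theorem sum_igwProb_mul_le (hs : IsArgmax sel) (hγ : ∀ l, 0 < γ (l + 1))
    (hmono : ∀ l, γ (l + 1) ≤ γ (l + 2)) (h0 : y 0 = 0) (l : ℕ) :
    ∑ a, igwProb sel (γ (l + 1)) (y (l + 1)) a * ((⨆ b, fs b) - fs a) ≤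
      (2 * K + igwError sel γ fs y (l + 1)) / γ (l + 1) := by
  have hg := gamma_mul_gap_nonneg hs hγ h0 (l + 1)
  rw [le_div_iff₀ (hγ l), Finset.sum_mul]
  have h1 : ∀ a, igwProb sel (γ (l + 1)) (y (l + 1)) a * ((⨆ b, fs b) - fs a) * γ (l + 1) ≤
      2 * (igwProb sel (γ (l + 1)) (y (l + 1)) a *
        (γ (l + 1) * (y (l + 1) (sel (y (l + 1))) - y (l + 1) a))) +
      igwProb sel (γ (l + 1)) (y (l + 1)) a * igwError sel γ fs y (l + 1) := by
    intro a
    have h2 := mul_le_mul_of_nonneg_right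
      (mul_le_mul_of_nonneg_left (gap_le_igwError (fs := fs) hs hγ hmono h0 l a).1
        (igwProb_nonneg hg a)) (hγ l).le
    refine h2.trans (le_of_eq ?_)
    have := (hγ l).ne'
    field_simp
  refine (Finset.sum_le_sum fun a _ => h1 a).trans ?_
  rw [Finset.sum_add_distrib, ← Finset.mul_sum, ← Finset.sum_mul, sum_igwProb, one_mul]
  linarith [sum_igwProb_mul_gap_le hg]

end Epochs

end FedIGW

end

noncomputable section

namespace FedIGW

variable {M K d : ℕ} {env : Environment.{u} M K}
  {f : Param d → Predictor env} {loss : Fin M → ℝ → ℝ → ℝ} {Θ : Set (Param d)} {μf : ℝ}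
  {ωs : Param d} {E : ℕ → ℕ} {FL : ∀ l, FLProtocol (Dataset env (E l)) (Param d)}
  {sel : Fin M → (Fin K → ℝ) → Fin K} {γ : ℕ → ℝ} {Ω : Type v}
  {data : ∀ l, Ω → Dataset env (E l)} {seed : ∀ l, Ω → (FL l).Seed}

/-! ### The regret of a run -/

/-- The estimate of epoch `l` as a function of the history. -/
def historyEstimate (f : Param d → Predictor env)
    (FL : ∀ l, FLProtocol (Dataset env (E l)) (Param d)) :
    ∀ l : ℕ, (∀ j : Fin l, Dataset env (E j) × (FL j).Seed) → Predictor env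
  | 0, _ => 0
  | l + 1, h => f ((FL l).out (h (Fin.last l)).1 (h (Fin.last l)).2)

theorem estimate_eq_historyEstimate (l : ℕ) (w : Ω) :
    estimate f FL data seed l w = historyEstimate f FL l (history FL data seed l w) := by
  cases l <;> rfl

theorem WellSpecified.measurable_historyEstimate (h : WellSpecified env f loss Θ μf ωs)
    (hout : ∀ l, Measurable fun q : Dataset env (E l) × (FL l).Seed => (FL l).out q.1 q.2)
    (l : ℕ) (m : Fin M) (a : Fin K) :
    Measurable fun q : (∀ j : Fin l, Dataset env (E j) × (FL j).Seed) × env.Ctx m =>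
      historyEstimate f FL l q.1 m q.2 a := by
  cases l with
  | zero => exact measurable_const
  | succ l =>
    have h1 : Measurable fun q : (∀ j : Fin (l + 1), Dataset env (E j) × (FL j).Seed) × env.Ctx m =>
        (FL l).out (q.1 (Fin.last l)).1 (q.1 (Fin.last l)).2 :=
      (hout l).comp ((measurable_pi_apply (Fin.last l)).comp measurable_fst)
    exact (h.measurable_f m a).comp (h1.prodMk measurable_snd)

theorem measurable_history [MeasurableSpace Ω] (hd : ∀ l, Measurable (data l))
    (hs : ∀ l, Measurable (seed l)) (l : ℕ) : Measurable (history FL data seed l) :=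
  measurable_pi_lambda _ fun j => (hd j).prodMk (hs j)

theorem measurable_igwPolicy {α : Type*} [MeasurableSpace α] (hsel : ∀ m, IsArgmax (sel m))
    {η : α → Predictor env} (hη : ∀ m a, Measurable fun q : α × env.Ctx m => η q.1 m q.2 a)
    (c : ℝ) (m : Fin M) (a : Fin K) :
    Measurable fun q : α × env.Ctx m => igwPolicy sel c (η q.1) m q.2 a :=
  ((hsel m).measurable_igwProb c a).comp (measurable_pi_lambda _ fun b => hη m b)

theorem isPolicy_igwPolicy (hsel : ∀ m, IsArgmax (sel m)) {η : Predictor env}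
    (hη : ∀ m a, Measurable fun x => η m x a) {c : ℝ}
    (hc : ∀ m x b, 0 ≤ c * (η m x (sel m (η m x)) - η m x b)) :
    IsPolicy (igwPolicy sel c η) where
  measurable m a := ((hsel m).measurable_igwProb c a).comp (measurable_pi_lambda _ fun b => hη m b)
  nonneg m x a := igwProb_nonneg (hc m x) a
  sum_eq_one _ _ := sum_igwProb _ _ _

theorem gamma_mul_estimate_nonneg (hsel : ∀ m, IsArgmax (sel m)) (hγ : ∀ l, 0 < γ (l + 1))
    (l : ℕ) (w : Ω) (m : Fin M) (x : env.Ctx m) (b : Fin K) :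
    0 ≤ γ l * (estimate f FL data seed l w m x (sel m (estimate f FL data seed l w m x)) -
      estimate f FL data seed l w m x b) :=
  gamma_mul_gap_nonneg (y := fun j => estimate f FL data seed j w m x) (hsel m) hγ rfl l b

section

variable [MeasurableSpace Ω] {P : Measure Ω} {R ε : ℝ≥0}

theorem IsFedIGWRun.measurable_estimate (hrun : IsFedIGWRun P f sel γ FL data seed)
    (h : WellSpecified env f loss Θ μf ωs)
    (hout : ∀ l, Measurable fun q : Dataset env (E l) × (FL l).Seed => (FL l).out q.1 q.2)
    (l : ℕ) (m : Fin M) (a : Fin K) :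
    Measurable fun q : Ω × env.Ctx m => estimate f FL data seed l q.1 m q.2 a := by
  simp only [estimate_eq_historyEstimate]
  exact (h.measurable_historyEstimate hout l m a).comp
    (((measurable_history hrun.measurable_data hrun.measurable_seed l).comp
      measurable_fst).prodMk measurable_snd)

theorem IsFedIGWRun.isPolicy (hrun : IsFedIGWRun P f sel γ FL data seed)
    (h : WellSpecified env f loss Θ μf ωs)
    (hout : ∀ l, Measurable fun q : Dataset env (E l) × (FL l).Seed => (FL l).out q.1 q.2)
    (hsel : ∀ m, IsArgmax (sel m)) (hγ : ∀ l, 0 < γ (l + 1)) (l : ℕ) (w : Ω) :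
    IsPolicy (igwPolicy sel (γ l) (estimate f FL data seed l w)) :=
  isPolicy_igwPolicy hsel
    (fun m a => (hrun.measurable_estimate h hout l m a).comp measurable_prodMk_left)
    fun m x b => gamma_mul_estimate_nonneg hsel hγ l w m x b

/-- Given the past, the sampling policy is fixed and the seed is independent of the data. The
one-epoch bound holds uniformly over policies, so it holds conditionally on every history. -/
theorem IsFedIGWRun.lintegral_sqError_le [IsProbabilityMeasure P]
    (hrun : IsFedIGWRun P f sel γ FL data seed)
    (h : WellSpecified env f loss Θ μf ωs) (hμ : 0 ≤ μf) (hM : 0 < M)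
    (hout : ∀ l, Measurable fun q : Dataset env (E l) × (FL l).Seed => (FL l).out q.1 q.2)
    (hsel : ∀ m, IsArgmax (sel m)) (hγ : ∀ l, 0 < γ (l + 1)) (l : ℕ) (hE : 0 < E l)
    (hΘ : ∀ S ξ, ValidData S → (FL l).out S ξ ∈ Θ)
    (hR : rademacher env f loss Θ (E l) ≤ R) (hε : optError env f loss Θ (E l) (FL l) ≤ ε) :
    ENNReal.ofReal (μf / 2) * ∫⁻ w, sqError f ωs
        (igwPolicy sel (γ l) (estimate f FL data seed l w)) ((FL l).out (data l w) (seed l w)) ∂P ≤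
      M * (2 * R + ε) := by
  let Φ : ((∀ j : Fin l, Dataset env (E j) × (FL j).Seed) × Dataset env (E l)) × (FL l).Seed →
      ℝ≥0∞ := fun q => sqError f ωs (igwPolicy sel (γ l) (historyEstimate f FL l q.1.1))
        ((FL l).out q.1.2 q.2)
  have hΦ : Measurable Φ := by
    refine h.measurable_sqError (π := fun q : ((∀ j : Fin l, Dataset env (E j) × (FL j).Seed) ×
        Dataset env (E l)) × (FL l).Seed => igwPolicy sel (γ l) (historyEstimate f FL l q.1.1))
      (fun m a => ?_) ((hout l).comp (measurable_fst.snd.prodMk measurable_snd))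
    refine measurable_igwPolicy (η := fun q : ((∀ j : Fin l, Dataset env (E j) × (FL j).Seed) ×
        Dataset env (E l)) × (FL l).Seed => historyEstimate f FL l q.1.1) hsel (fun m a => ?_) _ m a
    exact (h.measurable_historyEstimate hout l m a).comp
      (measurable_fst.fst.fst.prodMk measurable_snd)
  have hhd : Measurable fun w => (history FL data seed l w, data l w) :=
    (measurable_history hrun.measurable_data hrun.measurable_seed l).prodMk
      (hrun.measurable_data l)
  have hind := (indepFun_iff_map_prod_eq_prod_map_map hhd.aemeasurable
    (hrun.measurable_seed l).aemeasurable).1 (hrun.seed_indep l).symm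
  have : IsProbabilityMeasure (P.map (seed l)) := by rw [hrun.seed_law]; infer_instance
  have hg : Measurable fun q => ∫⁻ ξ, Φ (q, ξ) ∂(FL l).law := hΦ.lintegral_prod_right'
  -- Independence replaces the seed by an integral over its law; then the conditional law of the
  -- data is applied to the resulting function of history and dataset.
  have key : ∫⁻ w, sqError f ωs (igwPolicy sel (γ l) (estimate f FL data seed l w))
      ((FL l).out (data l w) (seed l w)) ∂P = ∫⁻ w, ∫⁻ S, ∫⁻ ξ, Φ ((history FL data seed l w, S), ξ)
        ∂(FL l).law ∂(dataLaw env (E l) (igwPolicy sel (γ l) (estimate f FL data seed l w))) ∂P := by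
    rw [← hrun.data_law l _ hg,
      ← lintegral_map (f := fun q => ∫⁻ ξ, Φ (q, ξ) ∂(FL l).law) hg hhd, ← hrun.seed_law l,
      ← lintegral_prod _ hΦ.aemeasurable, ← hind,
      lintegral_map hΦ (hhd.prodMk (hrun.measurable_seed l))]
    simp only [Φ, estimate_eq_historyEstimate]
  rw [key, ← lintegral_const_mul' _ _ ENNReal.ofReal_ne_top]
  refine (lintegral_mono fun w => ?_).trans (le_of_eq (lintegral_const (μ := P) _)) |>.trans
    (by rw [measure_univ, mul_one])
  simp only [Φ, ← estimate_eq_historyEstimate]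
  exact h.lintegral_sqError_out_le hμ hM hE (hrun.isPolicy h hout hsel hγ l w) hR (FL l) (hout l)
    hΘ hε

theorem IsFedIGWRun.measurable_igwError (hrun : IsFedIGWRun P f sel γ FL data seed)
    (h : WellSpecified env f loss Θ μf ωs)
    (hout : ∀ l, Measurable fun q : Dataset env (E l) × (FL l).Seed => (FL l).out q.1 q.2)
    (hsel : ∀ m, IsArgmax (sel m)) (m : Fin M) (l : ℕ) :
    Measurable fun q : Ω × env.Ctx m => igwError (sel m) γ (f ωs m q.2)
      (fun j => estimate f FL data seed j q.1 m q.2) l := by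
  induction l with
  | zero => exact measurable_const
  | succ l ih =>
    simp only [igwError]
    refine ((measurable_const.add ih).div_const _).add
      ((Finset.measurable_fun_sum _ fun b _ => ?_).const_mul _)
    refine (measurable_igwPolicy hsel (hrun.measurable_estimate h hout l) (γ l) m b).mul ?_
    exact ((hrun.measurable_estimate h hout (l + 1) m b).sub
      ((h.measurable_true m b).comp measurable_snd)).pow_const 2

/-- With fresh contexts, independent of the run, the mean error per agent obeys `v ↦ (K + v) / 3 +
64/3 * c ^ 2 * K`. The stated constant `K * (1/2 + 32 * c ^ 2)` is the fixed point of this map. -/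
theorem IsFedIGWRun.lintegral_igwError_le [IsProbabilityMeasure P]
    (hrun : IsFedIGWRun P f sel γ FL data seed)
    (h : WellSpecified env f loss Θ μf ωs) (hμ : 0 < μf) (hM : 0 < M)
    (hout : ∀ l, Measurable fun q : Dataset env (E l) × (FL l).Seed => (FL l).out q.1 q.2)
    (hsel : ∀ m, IsArgmax (sel m)) (hγ : ∀ l, 0 < γ (l + 1)) (hE : ∀ l, 0 < E l)
    (hΘ : ∀ l S ξ, ValidData S → (FL l).out S ξ ∈ Θ) {R ε : ℕ → ℝ≥0}
    (hR : ∀ l, rademacher env f loss Θ (E l) ≤ R l)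
    (hε : ∀ l, optError env f loss Θ (E l) (FL l) ≤ ε (l + 1))
    (hpos : ∀ l, 0 < R l + ε (l + 1)) {c : ℝ}
    (hγc : ∀ l, γ (l + 1) ^ 2 ≤ c ^ 2 * (K * μf / (R l + ε (l + 1)))) (l : ℕ) :
    ∑ m, ∫⁻ q, ENNReal.ofReal (igwError (sel m) γ (f ωs m q.2)
      (fun j => estimate f FL data seed j q.1 m q.2) l) ∂(P.prod (env.ctxLaw m)) ≤
      ENNReal.ofReal (M * (K * (1 / 2 + 32 * c ^ 2))) := by
  induction l with
  | zero => simp [igwError]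
  | succ l ih =>
    let Y : ∀ m, Ω × env.Ctx m → ℝ := fun m q => igwError (sel m) γ (f ωs m q.2)
      (fun j => estimate f FL data seed j q.1 m q.2) l
    let δ : ∀ m, Ω × env.Ctx m → ℝ := fun m q => ∑ b,
      igwProb (sel m) (γ l) (estimate f FL data seed l q.1 m q.2) b *
        (estimate f FL data seed (l + 1) q.1 m q.2 b - f ωs m q.2 b) ^ 2
    have hY0 : ∀ m q, 0 ≤ Y m q := fun m q =>
      igwError_nonneg (y := fun j => estimate f FL data seed j q.1 m q.2) (hsel m) hγ rfl l
    have hYm : ∀ m, Measurable (Y m) := fun m => hrun.measurable_igwError h hout hsel m l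
    have hδ0 : ∀ m q, 0 ≤ δ m q := fun m q => Finset.sum_nonneg fun b _ => mul_nonneg
      (igwProb_nonneg (fun b => gamma_mul_estimate_nonneg hsel hγ l q.1 m q.2 b) b) (sq_nonneg _)
    have hδm : ∀ m, Measurable (δ m) := fun m => Finset.measurable_fun_sum _ fun b _ =>
      (measurable_igwPolicy hsel (hrun.measurable_estimate h hout l) (γ l) m b).mul
        (((hrun.measurable_estimate h hout (l + 1) m b).sub
          ((h.measurable_true m b).comp measurable_snd)).pow_const 2)
    have hsplit : ∀ m, ∫⁻ q, ENNReal.ofReal (igwError (sel m) γ (f ωs m q.2)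
        (fun j => estimate f FL data seed j q.1 m q.2) (l + 1)) ∂(P.prod (env.ctxLaw m)) =
        ENNReal.ofReal (K / 3) + ENNReal.ofReal (1 / 3) *
          ∫⁻ q, ENNReal.ofReal (Y m q) ∂(P.prod (env.ctxLaw m)) +
        ENNReal.ofReal (16 / 3 * γ (l + 1) ^ 2) *
          ∫⁻ q, ENNReal.ofReal (δ m q) ∂(P.prod (env.ctxLaw m)) := by
      intro m
      have hpt : ∀ q : Ω × env.Ctx m, ENNReal.ofReal (igwError (sel m) γ (f ωs m q.2)
          (fun j => estimate f FL data seed j q.1 m q.2) (l + 1)) =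
          (ENNReal.ofReal (K / 3) + ENNReal.ofReal (1 / 3) * ENNReal.ofReal (Y m q)) +
          ENNReal.ofReal (16 / 3 * γ (l + 1) ^ 2) * ENNReal.ofReal (δ m q) := by
        intro q
        have := hY0 m q
        have := hδ0 m q
        rw [← ENNReal.ofReal_mul (by positivity), ← ENNReal.ofReal_mul (by positivity),
          ← ENNReal.ofReal_add (by positivity) (by positivity),
          ← ENNReal.ofReal_add (by positivity) (by positivity)]
        congr 1
        simp only [igwError, Y, δ]
        ring
      simp only [hpt]
      rw [lintegral_add_right _ ((hδm m).ennreal_ofReal.const_mul _),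
        lintegral_add_left measurable_const, lintegral_const_mul' _ _ ENNReal.ofReal_ne_top,
        lintegral_const_mul' _ _ ENNReal.ofReal_ne_top]
      simp
    have hδsum : ∑ m, ∫⁻ q, ENNReal.ofReal (δ m q) ∂(P.prod (env.ctxLaw m)) =
        ∫⁻ w, sqError f ωs (igwPolicy sel (γ l) (estimate f FL data seed l w))
          ((FL l).out (data l w) (seed l w)) ∂P := by
      simp only [sqError]
      rw [lintegral_finsetSum _ fun m _ => ?_]
      · refine Finset.sum_congr rfl fun m _ => ?_
        rw [lintegral_prod _ (hδm m).ennreal_ofReal.aemeasurable]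
        rfl
      · exact (hδm m).ennreal_ofReal.lintegral_prod_right'
    simp only [hsplit]
    rw [Finset.sum_add_distrib, Finset.sum_add_distrib, ← Finset.mul_sum, ← Finset.mul_sum, hδsum]
    set I := ∫⁻ w, sqError f ωs (igwPolicy sel (γ l) (estimate f FL data seed l w))
          ((FL l).out (data l w) (seed l w)) ∂P with hI
    have hIle := hrun.lintegral_sqError_le h hμ.le hM hout hsel hγ l (hE l) (hΘ l) (hR l) (hε l)
    rw [← hI] at hIle
    have hr : (0 : ℝ) < R l + ε (l + 1) := by exact_mod_cast hpos l
    -- The rate satisfies `γ² ≤ c² K μf / (R + ε)` and the squared error is at most `(2 / μf) M (2R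
    -- + ε) ≤ (4 / μf) M (R + ε)`, so `μf`, `R` and `ε` cancel.
    have hthird : ENNReal.ofReal (16 / 3 * γ (l + 1) ^ 2) * I ≤
        ENNReal.ofReal (M * (64 / 3 * c ^ 2 * K)) := by
      have h1 : ENNReal.ofReal (16 / 3 * γ (l + 1) ^ 2) =
          ENNReal.ofReal (32 / 3 * γ (l + 1) ^ 2 / μf) * ENNReal.ofReal (μf / 2) := by
        rw [← ENNReal.ofReal_mul (by positivity)]
        congr 1
        field_simp
        ring
      rw [h1, mul_assoc]
      refine (mul_le_mul_right hIle _).trans ?_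
      have h2 : (M : ℝ≥0∞) * (2 * R l + ε (l + 1)) =
          ENNReal.ofReal (M * (2 * R l + ε (l + 1))) := by
        rw [ENNReal.ofReal_mul (by positivity), ENNReal.ofReal_natCast,
          ENNReal.ofReal_add (by positivity) (by positivity), ENNReal.ofReal_mul (by positivity)]
        simp
      rw [h2, ← ENNReal.ofReal_mul (by positivity)]
      refine ENNReal.ofReal_le_ofReal ?_
      have h3 : 32 / 3 * γ (l + 1) ^ 2 / μf ≤ 32 / 3 * (c ^ 2 * (K / (R l + ε (l + 1)))) := by
        rw [div_le_iff₀ hμ]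
        refine (mul_le_mul_of_nonneg_left (hγc l) (by positivity)).trans (le_of_eq ?_)
        field_simp
      have h4 : (M : ℝ) * (2 * R l + ε (l + 1)) ≤ M * (2 * (R l + ε (l + 1))) := by
        gcongr
        have : (0 : ℝ) ≤ ε (l + 1) := NNReal.coe_nonneg _
        linarith
      refine (mul_le_mul h3 h4 (by positivity) (by positivity)).trans (le_of_eq ?_)
      field_simp
      ring
    refine (add_le_add (add_le_add le_rfl (mul_le_mul_right ih _)) hthird).trans (le_of_eq ?_)
    rw [Finset.sum_const, Finset.card_univ, Fintype.card_fin, nsmul_eq_mul,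
      ← ENNReal.ofReal_natCast M, ← ENNReal.ofReal_mul (by positivity),
      ← ENNReal.ofReal_mul (by positivity), ← ENNReal.ofReal_add (by positivity) (by positivity),
      ← ENNReal.ofReal_add (by positivity) (by positivity)]
    congr 1
    ring

end

end FedIGW

end

/-! ### From the error recursion to the regret of a step, an epoch and the whole run. -/

noncomputable section

namespace FedIGW

variable {M K d : ℕ} {env : Environment.{u} M K}
  {f : Param d → Predictor env} {loss : Fin M → ℝ → ℝ → ℝ} {Θ : Set (Param d)} {μf : ℝ}
  {ωs : Param d} {E : ℕ → ℕ} {FL : ∀ l, FLProtocol (Dataset env (E l)) (Param d)}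
  {sel : Fin M → (Fin K → ℝ) → Fin K} {γ : ℕ → ℝ} {Ω : Type v} [MeasurableSpace Ω] {P : Measure Ω}
  {data : ∀ l, Ω → Dataset env (E l)} {seed : ∀ l, Ω → (FL l).Seed}

theorem meanReward_mem (m : Fin M) (x : env.Ctx m) (a : Fin K) :
    meanReward env m x a ∈ Set.Icc (0 : ℝ) 1 := by
  have h1 : ∀ᵐ r ∂(env.rewardLaw m x), r a ∈ Set.Icc (0 : ℝ) 1 :=
    (env.reward_mem m x).mono fun r hr => hr a
  refine ⟨integral_nonneg_of_ae (h1.mono fun r hr => hr.1), ?_⟩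
  have hint : Integrable (fun r : Fin K → ℝ => r a) (env.rewardLaw m x) :=
    Integrable.of_bound (measurable_pi_apply a).aestronglyMeasurable 1 (h1.mono fun r hr => by
      rw [Real.norm_eq_abs, abs_of_nonneg hr.1]; exact hr.2)
  refine (integral_mono_ae hint (integrable_const 1) (h1.mono fun r hr => hr.2)).trans ?_
  simp

theorem actionGap_nonneg (m : Fin M) (s : Sample env m) : 0 ≤ actionGap env m s :=
  sub_nonneg.2 (le_ciSup (f := fun a => meanReward env m s.1 a)
    (Set.finite_range _).bddAbove s.2.1)

theorem actionGap_le_one (m : Fin M) (s : Sample env m) : actionGap env m s ≤ 1 := by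
  have : Nonempty (Fin K) := ⟨s.2.1⟩
  have h1 : (⨆ a, meanReward env m s.1 a) ≤ 1 := ciSup_le fun a => (meanReward_mem m s.1 a).2
  have h2 := (meanReward_mem m s.1 s.2.1).1
  unfold actionGap
  linarith

theorem WellSpecified.actionGap_eq (h : WellSpecified env f loss Θ μf ωs) (m : Fin M)
    (s : Sample env m) :
    actionGap env m s = (⨆ a, f ωs m s.1 a) - f ωs m s.1 s.2.1 := by
  simp only [actionGap, h.realizable]

theorem WellSpecified.measurable_actionGap (h : WellSpecified env f loss Θ μf ωs) (m : Fin M) :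
    Measurable (actionGap env m) := by
  have hf : Measurable fun q : env.Ctx m × Fin K => f ωs m q.1 q.2 :=
    measurable_from_prod_countable_left fun a => h.measurable_true m a
  have h1 : Measurable fun s : Sample env m => ⨆ a, f ωs m s.1 a :=
    Measurable.iSup fun a => (h.measurable_true m a).comp measurable_fst
  have h2 : Measurable fun s : Sample env m => f ωs m s.1 s.2.1 :=
    hf.comp (by fun_prop : Measurable fun s : Sample env m => (s.1, s.2.1))
  have : actionGap env m = fun s => (⨆ a, f ωs m s.1 a) - f ωs m s.1 s.2.1 :=
    funext fun s => h.actionGap_eq m s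
  rw [this]
  exact h1.sub h2

theorem lintegral_const_add_of_isProbabilityMeasure {α : Type*} [MeasurableSpace α] (μ : Measure α)
    [IsProbabilityMeasure μ] (c : ℝ≥0∞) (g : α → ℝ≥0∞) :
    ∫⁻ x, (c + g x) ∂μ = c + ∫⁻ x, g x ∂μ := by
  rw [lintegral_add_left measurable_const]
  simp

/-- The regret of the agents at one time step of an epoch after the first. -/
theorem IsFedIGWRun.sum_lintegral_actionGap_le [IsProbabilityMeasure P]
    (hrun : IsFedIGWRun P f sel γ FL data seed)
    (h : WellSpecified env f loss Θ μf ωs) (hμ : 0 < μf) (hM : 0 < M)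
    (hout : ∀ l, Measurable fun q : Dataset env (E l) × (FL l).Seed => (FL l).out q.1 q.2)
    (hsel : ∀ m, IsArgmax (sel m)) (hγ : ∀ l, 0 < γ (l + 1))
    (hmono : ∀ l, γ (l + 1) ≤ γ (l + 2)) (hE : ∀ l, 0 < E l)
    (hΘ : ∀ l S ξ, ValidData S → (FL l).out S ξ ∈ Θ) {R ε : ℕ → ℝ≥0}
    (hR : ∀ l, rademacher env f loss Θ (E l) ≤ R l)
    (hε : ∀ l, optError env f loss Θ (E l) (FL l) ≤ ε (l + 1))
    (hpos : ∀ l, 0 < R l + ε (l + 1)) {c : ℝ}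
    (hγc : ∀ l, γ (l + 1) ^ 2 ≤ c ^ 2 * (K * μf / (R l + ε (l + 1)))) (l : ℕ)
    (i : Fin (E (l + 1))) :
    ∑ m, ∫⁻ w, ENNReal.ofReal (actionGap env m (data (l + 1) w m i)) ∂P ≤
      ENNReal.ofReal (M * (K / γ (l + 1) * (5 / 2 + 32 * c ^ 2))) := by
  have hstep : ∀ m, ∫⁻ w, ENNReal.ofReal (actionGap env m (data (l + 1) w m i)) ∂P ≤
      ENNReal.ofReal (2 * K / γ (l + 1)) + ENNReal.ofReal (1 / γ (l + 1)) *
      ∫⁻ q, ENNReal.ofReal (igwError (sel m) γ (f ωs m q.2)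
        (fun j => estimate f FL data seed j q.1 m q.2) (l + 1)) ∂(P.prod (env.ctxLaw m)) := by
    intro m
    have hgap := (h.measurable_actionGap m).ennreal_ofReal
    have hYm := hrun.measurable_igwError h hout hsel m (l + 1)
    -- The observed sample is exchanged for a fresh context with an action from the current policy,
    -- so that the per-context bound applies.
    rw [hrun.data_law (l + 1) (fun q => ENNReal.ofReal (actionGap env m (q.2 m i)))
      (hgap.comp (by fun_prop)), lintegral_prod _ hYm.ennreal_ofReal.aemeasurable,
      ← lintegral_const_mul' _ _ ENNReal.ofReal_ne_top]
    rw [← lintegral_const_add_of_isProbabilityMeasure]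
    refine lintegral_mono fun w => ?_
    have hp := hrun.isPolicy h hout hsel hγ (l + 1) w
    have he := hp.measurePreserving_eval (n := E (l + 1)) m i
    rw [← lintegral_map (f := fun s => ENNReal.ofReal (actionGap env m s)) hgap he.measurable,
      he.map_eq, lintegral_sampleLaw hp.measurable m hgap,
      ← lintegral_const_mul' _ _ ENNReal.ofReal_ne_top]
    rw [← lintegral_const_add_of_isProbabilityMeasure]
    refine lintegral_mono fun x => ?_
    have hY0 := igwError_nonneg (fs := f ωs m x)
      (y := fun j => estimate f FL data seed j w m x) (hsel m) hγ rfl (l + 1)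
    have hle : ∀ a, f ωs m x a ≤ ⨆ b, f ωs m x b :=
      fun a => le_ciSup (Set.finite_range (f ωs m x)).bddAbove a
    have hγl := hγ l
    have hinner : ∀ a, ∫⁻ r, ENNReal.ofReal (actionGap env m (x, a, r a)) ∂(env.rewardLaw m x) =
        ENNReal.ofReal ((⨆ b, f ωs m x b) - f ωs m x a) := fun a => by simp [h.actionGap_eq]
    simp only [hinner]
    rw [← ENNReal.ofReal_mul (by positivity), ← ENNReal.ofReal_add (by positivity) (by positivity)]
    simp only [← ENNReal.ofReal_mul (hp.nonneg m x _)]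
    rw [← ENNReal.ofReal_sum_of_nonneg fun a _ => mul_nonneg (hp.nonneg m x a)
      (sub_nonneg.2 (hle a))]
    refine ENNReal.ofReal_le_ofReal ?_
    refine (sum_igwProb_mul_le (fs := f ωs m x) (y := fun j => estimate f FL data seed j w m x)
      (hsel m) hγ hmono rfl l).trans (le_of_eq ?_)
    field_simp
  have hsum := hrun.lintegral_igwError_le h hμ hM hout hsel hγ hE hΘ hR hε hpos hγc (l + 1)
  refine (Finset.sum_le_sum fun m _ => hstep m).trans ?_
  rw [Finset.sum_add_distrib, ← Finset.mul_sum]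
  refine (add_le_add le_rfl (mul_le_mul_right hsum _)).trans (le_of_eq ?_)
  have hγl := hγ l
  rw [Finset.sum_const, Finset.card_univ, Fintype.card_fin, nsmul_eq_mul,
      ← ENNReal.ofReal_natCast M, ← ENNReal.ofReal_mul (by positivity),
      ← ENNReal.ofReal_mul (by positivity), ← ENNReal.ofReal_add (by positivity) (by positivity)]
  congr 1
  field_simp
  ring

theorem IsFedIGWRun.regret_le [IsProbabilityMeasure P]
    (hrun : IsFedIGWRun P f sel γ FL data seed)
    (h : WellSpecified env f loss Θ μf ωs) (hμ : 0 < μf)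
    (hout : ∀ l, Measurable fun q : Dataset env (E l) × (FL l).Seed => (FL l).out q.1 q.2)
    (hsel : ∀ m, IsArgmax (sel m)) (hmono : ∀ l, γ (l + 1) ≤ γ (l + 2)) (hE : ∀ l, 0 < E l)
    (hΘ : ∀ l S ξ, ValidData S → (FL l).out S ξ ∈ Θ) {R ε : ℕ → ℝ≥0}
    (hR : ∀ l, rademacher env f loss Θ (E l) ≤ R l)
    (hε : ∀ l, optError env f loss Θ (E l) (FL l) ≤ ε (l + 1))
    (hpos : ∀ l, 0 < R l + ε (l + 1)) {c₁ c₂ : ℝ} (hc₁ : 0 < c₁)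
    (hγ₁ : ∀ l, c₁ * Real.sqrt (K * μf / (R l + ε (l + 1))) ≤ γ (l + 1))
    (hγ₂ : ∀ l, γ (l + 1) ≤ c₂ * Real.sqrt (K * μf / (R l + ε (l + 1)))) (T : ℕ) :
    regret P data T ≤ (1 + (5 / 2 + 32 * c₂ ^ 2) / c₁) * ((M : ℝ) * E 0 +
      ∑ l ∈ Finset.Ico 1 (epochCount E T),
        Real.sqrt (K * (R (l - 1) + ε l) / μf) * ((M : ℝ) * E l)) := by
  -- The case without agents is separate because `0 < K` is read off the argmax rule of some agent.
  rcases Nat.eq_zero_or_pos M with rfl | hM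
  · simp [regret]
  have hK : (0 : ℝ) < K := by exact_mod_cast (sel ⟨0, hM⟩ 0).pos
  have hr : ∀ l, (0 : ℝ) < R l + ε (l + 1) := fun l => by exact_mod_cast hpos l
  have hsq : ∀ l, 0 < Real.sqrt (K * μf / (R l + ε (l + 1))) := fun l =>
    Real.sqrt_pos.2 (div_pos (mul_pos hK hμ) (hr l))
  have hγ : ∀ l, 0 < γ (l + 1) := fun l => (mul_pos hc₁ (hsq l)).trans_le (hγ₁ l)
  have hγc : ∀ l, γ (l + 1) ^ 2 ≤ c₂ ^ 2 * (K * μf / (R l + ε (l + 1))) := fun l => by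
    refine (pow_le_pow_left₀ (hγ l).le (hγ₂ l) 2).trans (le_of_eq ?_)
    rw [mul_pow, Real.sq_sqrt (div_pos (mul_pos hK hμ) (hr l)).le]
  set A := 5 / 2 + 32 * c₂ ^ 2 with hA
  have hA0 : 0 < A := by positivity
  have hKγ : ∀ l, K / γ (l + 1) ≤ Real.sqrt (K * (R l + ε (l + 1)) / μf) / c₁ := fun l => by
    rw [div_le_div_iff₀ (hγ l) hc₁]
    -- The two roots multiply to `K`, so the lower bound on `γ` becomes the wanted upper bound on `K
    -- / γ`.
    have h1 : Real.sqrt (K * (R l + ε (l + 1)) / μf) * Real.sqrt (K * μf / (R l + ε (l + 1))) =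
        K := by
      rw [← Real.sqrt_mul (div_pos (mul_pos hK (hr l)) hμ).le, Real.sqrt_eq_iff_mul_self_eq_of_pos hK]
      have := hr l
      field_simp
    have h2 := mul_le_mul_of_nonneg_left (hγ₁ l) (Real.sqrt_nonneg (K * (R l + ε (l + 1)) / μf))
    nlinarith
  have hgap : ∀ l m (i : Fin (E l)), Measurable fun w => actionGap env m (data l w m i) :=
    fun l m i => ((h.measurable_actionGap m).comp
    (by fun_prop : Measurable fun S : Dataset env (E l) => S m i)).comp (hrun.measurable_data l)
  -- the contribution of one epoch
  let B : ℕ → ℝ := fun l => if l = 0 then (M : ℝ) * E 0 else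
    A / c₁ * (Real.sqrt (K * (R (l - 1) + ε l) / μf) * ((M : ℝ) * E l))
  have hB0 : ∀ l, 0 ≤ B l := fun l => by
    simp only [B]; split_ifs <;> positivity
  have hB : ∀ l, ∑ i : Fin (E l), ∑ m, ∫⁻ w, ENNReal.ofReal (actionGap env m (data l w m i)) ∂P ≤
      ENNReal.ofReal (B l) := by
    intro l
    cases l with
    | zero =>
      have h1 : ∀ (i : Fin (E 0)) m,
          ∫⁻ w, ENNReal.ofReal (actionGap env m (data 0 w m i)) ∂P ≤ 1 := fun i m => by
        refine (lintegral_mono (g := fun _ => 1) fun w => ?_).trans (by simp)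
        simpa using actionGap_le_one m (data 0 w m i)
      refine (Finset.sum_le_sum fun i _ => Finset.sum_le_sum fun m _ => h1 i m).trans ?_
      simp only [B, if_true, Finset.sum_const, Finset.card_univ, Fintype.card_fin, nsmul_eq_mul,
        mul_one]
      rw [ENNReal.ofReal_mul (by positivity), ENNReal.ofReal_natCast, ENNReal.ofReal_natCast,
        mul_comm]
    | succ l =>
      refine (Finset.sum_le_sum fun i _ => hrun.sum_lintegral_actionGap_le h hμ hM hout hsel hγ
        hmono hE hΘ hR hε hpos hγc l i).trans ?_
      rw [Finset.sum_const, Finset.card_univ, Fintype.card_fin, nsmul_eq_mul,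
        ← ENNReal.ofReal_natCast, ← ENNReal.ofReal_mul (by positivity)]
      refine ENNReal.ofReal_le_ofReal ?_
      simp only [B, Nat.add_eq_zero_iff, one_ne_zero, and_false, if_false, Nat.add_sub_cancel]
      calc (E (l + 1) : ℝ) * (M * (K / γ (l + 1) * A)) ≤
          (E (l + 1) : ℝ) * (M * (Real.sqrt (K * (R l + ε (l + 1)) / μf) / c₁ * A)) := by
            have := mul_le_mul_of_nonneg_right (hKγ l) hA0.le
            gcongr
        _ = _ := by ring
  have hfin : regret P data T ≤ ∑ l ∈ Finset.range (epochCount E T), B l := by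
    have hBs : 0 ≤ ∑ l ∈ Finset.range (epochCount E T), B l := Finset.sum_nonneg fun l _ => hB0 l
    rw [regret]
    -- Without integrability the regret would be `0` by convention, below the nonnegative bound.
    by_cases hint : Integrable (fun w => ∑ m, ∑ l ∈ Finset.range (epochCount E T), ∑ i : Fin (E l),
        (if epochStart E l + i < T then actionGap env m (data l w m i) else 0)) P
    swap
    · rwa [integral_undef hint]
    refine (ENNReal.ofReal_le_ofReal_iff hBs).1 ((ofReal_integral_le_lintegral hint).trans ?_)
    calc _ ≤ ∫⁻ w, ∑ l ∈ Finset.range (epochCount E T), ∑ i : Fin (E l), ∑ m,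
          ENNReal.ofReal (actionGap env m (data l w m i)) ∂P := by
          refine lintegral_mono fun w => ?_
          rw [Finset.sum_comm]
          simp only [Finset.sum_comm (s := (Finset.univ : Finset (Fin M)))]
          simp only [← ENNReal.ofReal_sum_of_nonneg fun m _ => actionGap_nonneg m _]
          simp only [← ENNReal.ofReal_sum_of_nonneg fun i _ =>
            Finset.sum_nonneg fun m _ => actionGap_nonneg m _]
          rw [← ENNReal.ofReal_sum_of_nonneg fun l _ => Finset.sum_nonneg fun i _ =>
            Finset.sum_nonneg fun m _ => actionGap_nonneg m _]
          refine ENNReal.ofReal_le_ofReal (Finset.sum_le_sum fun l _ => Finset.sum_le_sum fun i _ =>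
            Finset.sum_le_sum fun m _ => ?_)
          -- Steps after `T` in the last epoch are added at no loss, since gaps are nonnegative;
          -- whole epochs remain.
          split_ifs
          · exact le_rfl
          · exact actionGap_nonneg m _
      _ = ∑ l ∈ Finset.range (epochCount E T), ∑ i : Fin (E l), ∑ m,
          ∫⁻ w, ENNReal.ofReal (actionGap env m (data l w m i)) ∂P := by
          rw [lintegral_finsetSum _ fun l _ => Finset.measurable_fun_sum _ fun i _ =>
            Finset.measurable_fun_sum _ fun m _ => (hgap l m i).ennreal_ofReal]
          refine Finset.sum_congr rfl fun l _ => ?_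
          rw [lintegral_finsetSum _ fun i _ =>
            Finset.measurable_fun_sum _ fun m _ => (hgap l m i).ennreal_ofReal]
          refine Finset.sum_congr rfl fun i _ => ?_
          rw [lintegral_finsetSum _ fun m _ => (hgap l m i).ennreal_ofReal]
      _ ≤ ∑ l ∈ Finset.range (epochCount E T), ENNReal.ofReal (B l) :=
          Finset.sum_le_sum fun l _ => hB l
      _ = _ := (ENNReal.ofReal_sum_of_nonneg fun l _ => hB0 l).symm
  refine hfin.trans ?_
  set U := ∑ l ∈ Finset.Ico 1 (epochCount E T),
        Real.sqrt (K * (R (l - 1) + ε l) / μf) * ((M : ℝ) * E l) with hU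
  have hU0 : 0 ≤ U := Finset.sum_nonneg fun l _ => by positivity
  have hle : ∑ l ∈ Finset.range (epochCount E T), B l ≤ (M : ℝ) * E 0 + A / c₁ * U := by
    rcases Nat.eq_zero_or_pos (epochCount E T) with h0 | h0
    · rw [h0, Finset.sum_range_zero]; positivity
    · rw [Finset.range_eq_Ico, Finset.sum_eq_sum_Ico_succ_bot h0, hU, Finset.mul_sum]
      refine add_le_add (by simp [B]) (le_of_eq (Finset.sum_congr rfl fun l hl => ?_))
      have : l ≠ 0 := by have := (Finset.mem_Ico.1 hl).1; omega
      simp [B, this]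
  refine hle.trans ?_
  have h1 : 0 ≤ A / c₁ * ((M : ℝ) * E 0) := by positivity
  have h2 : (1 + A / c₁) * ((M : ℝ) * E 0 + U) =
    (M : ℝ) * E 0 + A / c₁ * U + (A / c₁ * ((M : ℝ) * E 0) + U) := by ring
  rw [h2]
  linarith

end FedIGW

end

/-! ### Optimization error of FedAvg and SCAFFOLD. -/

noncomputable section

namespace FedIGW

open scoped BigOperators

/-! ### Averages over finite sets of seeds -/

theorem expect_cons {A : Type*} [Fintype A] {κ : ℕ} (h : (Fin (κ + 1) → A) → ℝ) :
    𝔼 ξ, h ξ = 𝔼 a, 𝔼 ξ : Fin κ → A, h (Fin.cons a ξ) := by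
  rw [← Finset.expect_product', Finset.univ_product_univ]
  exact (Fintype.expect_equiv (Fin.consEquiv fun _ : Fin (κ + 1) => A) _ _ fun q => rfl).symm

theorem expect_eval {A : Type*} [Fintype A] [Nonempty A] {κ : ℕ} (k : Fin κ) (h : A → ℝ) :
    𝔼 ξ : Fin κ → A, h (ξ k) = 𝔼 a, h a := by
  induction κ with
  | zero => exact k.elim0
  | succ κ ih =>
    rw [expect_cons]
    refine Fin.cases ?_ (fun k => ?_) k
    · simp
    · simp [ih k]

variable {V : Type*} [NormedAddCommGroup V] [InnerProductSpace ℝ V]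

theorem norm_add_sq_le_two (a b : V) : ‖a + b‖ ^ 2 ≤ 2 * ‖a‖ ^ 2 + 2 * ‖b‖ ^ 2 := by
  have := parallelogram_law_with_norm ℝ a b
  nlinarith [sq_nonneg ‖a - b‖]

theorem norm_add_sq_le_three {V : Type*} [NormedAddCommGroup V] (a b c : V) :
    ‖a + b + c‖ ^ 2 ≤ 3 * ‖a‖ ^ 2 + 3 * ‖b‖ ^ 2 + 3 * ‖c‖ ^ 2 := by
  have h := norm_add₃_le (a := a) (b := b) (c := c)
  have h1 : ‖a + b + c‖ ^ 2 ≤ (‖a‖ + ‖b‖ + ‖c‖) ^ 2 := pow_le_pow_left₀ (norm_nonneg _) h 2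
  nlinarith [sq_nonneg (‖a‖ - ‖b‖), sq_nonneg (‖b‖ - ‖c‖), sq_nonneg (‖a‖ - ‖c‖)]

theorem norm_avg_sq_le {M : ℕ} (hM : 0 < M) (v : Fin M → V) :
    ‖(1 / (M : ℝ)) • ∑ m, v m‖ ^ 2 ≤ (1 / (M : ℝ)) * ∑ m, ‖v m‖ ^ 2 := by
  have hM' : (0 : ℝ) < M := by exact_mod_cast hM
  have h1 : ‖∑ m, v m‖ ^ 2 ≤ (∑ m, ‖v m‖) ^ 2 :=
    pow_le_pow_left₀ (norm_nonneg _) (norm_sum_le _ _) 2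
  have h2 := sq_sum_le_card_mul_sum_sq (s := Finset.univ) (f := fun m => ‖v m‖)
  rw [Finset.card_univ, Fintype.card_fin] at h2
  rw [norm_smul, mul_pow, Real.norm_of_nonneg (by positivity)]
  calc (1 / (M : ℝ)) ^ 2 * ‖∑ m, v m‖ ^ 2 ≤ (1 / (M : ℝ)) ^ 2 * (M * ∑ m, ‖v m‖ ^ 2) := by
        gcongr; exact h1.trans h2
    _ = _ := by field_simp

/-- Independent centered vectors are orthogonal in the mean. -/
theorem expect_norm_sum_sq {B : Type*} [Fintype B] [Nonempty B] {M : ℕ} (N : Fin M → B → V)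
    (hN : ∀ m v, 𝔼 b, inner ℝ (N m b) v = 0) :
    (∀ v, 𝔼 ξ : Fin M → B, inner ℝ (∑ m, N m (ξ m)) v = 0) ∧
    𝔼 ξ : Fin M → B, ‖∑ m, N m (ξ m)‖ ^ 2 = ∑ m, 𝔼 b, ‖N m b‖ ^ 2 := by
  induction M with
  | zero => simp
  | succ M ih =>
    obtain ⟨ih1, ih2⟩ := ih (fun m => N m.succ) fun m => hN m.succ
    constructor
    · intro v
      rw [expect_cons]
      simp only [Fin.sum_univ_succ, Fin.cons_zero, Fin.cons_succ, inner_add_left,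
        Finset.expect_add_distrib, ih1, Fintype.expect_const, hN, add_zero]
    · rw [expect_cons]
      simp only [Fin.sum_univ_succ, Fin.cons_zero, Fin.cons_succ, norm_add_sq_real,
        Finset.expect_add_distrib, ih2, Fintype.expect_const, ← Finset.mul_expect]
      simp only [real_inner_comm _ (N 0 _), ih1]
      simp

/-! ### The local steps of one agent -/

section LocalSteps

variable {n : ℕ} (η : ℝ) (g : Fin n → V → V) (G : V → V) (corr x : V)

/-- The accumulated noise of the stochastic gradients. -/
def localNoise : ∀ {κ : ℕ}, (Fin κ → Fin n) → V → V
  | 0, _, _ => 0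
  | _ + 1, ξ, y => (g (ξ 0) y - G y) +
      localNoise (fun k => ξ k.succ) (y - η • (g (ξ 0) y + corr))

/-- The accumulated change of the gradient against its value at `x`. -/
def localBias : ∀ {κ : ℕ}, (Fin κ → Fin n) → V → V
  | 0, _, _ => 0
  | _ + 1, ξ, y => (G y - G x) + localBias (fun k => ξ k.succ) (y - η • (g (ξ 0) y + corr))

/-- The sum of the squared distances of the local iterates from `x`. -/
def localDrift : ∀ {κ : ℕ}, (Fin κ → Fin n) → V → ℝ
  | 0, _, _ => 0
  | _ + 1, ξ, y => ‖y - x‖ ^ 2 + localDrift (fun k => ξ k.succ) (y - η • (g (ξ 0) y + corr))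

/-- Each stochastic gradient is split into its mean at `x`, the change of the mean since `x`, and
the noise; their sums can then be estimated separately. -/
theorem localSteps_eq {κ : ℕ} (ξ : Fin κ → Fin n) (y : V) :
    localSteps η g corr ξ y = y - η • ((κ : ℝ) • (G x + corr) + localBias η g G corr x ξ y +
      localNoise η g G corr ξ y) := by
  induction κ generalizing y with
  | zero => simp [localSteps, localBias, localNoise]
  | succ κ ih =>
    have h1 : localSteps η g corr ξ y =
        localSteps η g corr (fun k => ξ k.succ) (y - η • (g (ξ 0) y + corr)) := by
      simp only [localSteps, Fin.foldl_succ]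
    rw [h1, ih, localBias, localNoise]
    push_cast
    module

variable {η g G corr x}

/-- Each step costs a factor `2` from `norm_add_sq_le_two`. The exponential constant is harmless
because the local step size is chosen after `κ`. -/
theorem norm_localBias_sq_le {β : ℝ} (hlip : ∀ y z, ‖G y - G z‖ ^ 2 ≤ β ^ 2 * ‖y - z‖ ^ 2) {κ : ℕ}
    (ξ : Fin κ → Fin n) (y : V) :
    ‖localBias η g G corr x ξ y‖ ^ 2 ≤ 2 ^ κ * (β ^ 2 * localDrift η g corr x ξ y) := by
  induction κ generalizing y with
  | zero => simp [localBias, localDrift]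
  | succ κ ih =>
    rw [localBias, localDrift]
    have h1 := ih (fun k => ξ k.succ) (y - η • (g (ξ 0) y + corr))
    have h2 := hlip y x
    refine (norm_add_sq_le_two _ _).trans ?_
    have h3 : (1 : ℝ) ≤ 2 ^ κ := one_le_pow₀ (by norm_num)
    have h4 : β ^ 2 * ‖y - x‖ ^ 2 ≤ 2 ^ κ * (β ^ 2 * ‖y - x‖ ^ 2) :=
      le_mul_of_one_le_left (by positivity) h3
    rw [pow_succ (2 : ℝ) κ]
    linarith

variable [NeZero n] {σ : ℝ}

/-- The noise is a martingale: whatever the first draw, the later noise is centered. Cross terms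
vanish and the variances add up. -/
theorem expect_localNoise (hmean : ∀ y v, 𝔼 i, inner ℝ (g i y - G y) v = 0)
    (hvar : ∀ y, 𝔼 i, ‖g i y - G y‖ ^ 2 ≤ σ ^ 2) {κ : ℕ} (y : V) :
    (∀ v, 𝔼 ξ : Fin κ → Fin n, inner ℝ (localNoise η g G corr ξ y) v = 0) ∧
    𝔼 ξ : Fin κ → Fin n, ‖localNoise η g G corr ξ y‖ ^ 2 ≤ κ * σ ^ 2 := by
  induction κ generalizing y with
  | zero => simp [localNoise]
  | succ κ ih =>
    constructor
    · intro v
      rw [expect_cons]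
      simp only [localNoise, Fin.cons_zero, Fin.cons_succ, inner_add_left,
        Finset.expect_add_distrib, Fintype.expect_const, (ih _).1, hmean, add_zero]
    · rw [expect_cons]
      simp only [localNoise, Fin.cons_zero, Fin.cons_succ, norm_add_sq_real,
        Finset.expect_add_distrib, Fintype.expect_const, ← Finset.mul_expect]
      simp only [real_inner_comm _ (g _ y - G y), (ih _).1]
      have h1 : 𝔼 i : Fin n, 𝔼 ξ : Fin κ → Fin n,
          ‖localNoise η g G corr ξ (y - η • (g i y + corr))‖ ^ 2 ≤ 𝔼 _i : Fin n, κ * σ ^ 2 :=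
        Finset.expect_le_expect fun i _ => (ih _).2
      rw [Fintype.expect_const] at h1
      have h2 := hvar y
      push_cast
      simp only [Finset.expect_const_zero, mul_zero, add_zero]
      linarith

/-- In mean a local step maps `‖y - x‖²` to at most `3 * ‖y - x‖² + 6 * η² * S`. With the term of
the current step this closes the induction, since `3 * 4 ^ κ + 4 ^ κ = 4 ^ (κ + 1)`. -/
theorem expect_localDrift_le {β : ℝ}
    (hvar : ∀ y, 𝔼 i, ‖g i y - G y‖ ^ 2 ≤ σ ^ 2)
    (hlip : ∀ y z, ‖G y - G z‖ ^ 2 ≤ β ^ 2 * ‖y - z‖ ^ 2) (hη : 6 * η ^ 2 * β ^ 2 ≤ 1) {κ : ℕ}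
    (y : V) :
    𝔼 ξ : Fin κ → Fin n, localDrift η g corr x ξ y ≤
      4 ^ κ * (‖y - x‖ ^ 2 + 3 * η ^ 2 * (σ ^ 2 + ‖G x + corr‖ ^ 2)) := by
  induction κ generalizing y with
  | zero => simp [localDrift]; positivity
  | succ κ ih =>
    rw [expect_cons]
    simp only [localDrift, Fin.cons_zero, Fin.cons_succ, Finset.expect_add_distrib,
      Fintype.expect_const]
    set S := σ ^ 2 + ‖G x + corr‖ ^ 2
    have hstep : ∀ i, ‖y - η • (g i y + corr) - x‖ ^ 2 ≤ 2 * ‖y - x‖ ^ 2 +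
        2 * η ^ 2 * (3 * ‖g i y - G y‖ ^ 2 + 3 * (β ^ 2 * ‖y - x‖ ^ 2) + 3 * ‖G x + corr‖ ^ 2) := by
      intro i
      have h1 : y - η • (g i y + corr) - x =
          (y - x) + (-η) • ((g i y - G y) + (G y - G x) + (G x + corr)) := by module
      rw [h1]
      refine (norm_add_sq_le_two _ _).trans ?_
      rw [norm_smul, mul_pow, norm_neg, Real.norm_eq_abs, sq_abs]
      have h2 := norm_add_sq_le_three (g i y - G y) (G y - G x) (G x + corr)
      have h3 := mul_le_mul_of_nonneg_left h2 (sq_nonneg η)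
      have h4 := mul_le_mul_of_nonneg_left (hlip y x) (sq_nonneg η)
      linarith
    have hE : 𝔼 i, ‖y - η • (g i y + corr) - x‖ ^ 2 ≤ 3 * ‖y - x‖ ^ 2 + 6 * η ^ 2 * S := by
      refine (Finset.expect_le_expect fun i _ => hstep i).trans ?_
      simp only [Finset.expect_add_distrib, Fintype.expect_const, ← Finset.mul_expect]
      have h1 := mul_le_mul_of_nonneg_left (hvar y) (by positivity : 0 ≤ 6 * η ^ 2)
      have h2 := mul_le_mul_of_nonneg_right hη (sq_nonneg ‖y - x‖)
      simp only [S]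
      linarith
    have h5 : 𝔼 i : Fin n, 𝔼 ξ : Fin κ → Fin n,
        localDrift η g corr x ξ (y - η • (g i y + corr)) ≤
        4 ^ κ * (𝔼 i, ‖y - η • (g i y + corr) - x‖ ^ 2 + 3 * η ^ 2 * S) := by
      refine (Finset.expect_le_expect fun i _ => ih _).trans (le_of_eq ?_)
      simp only [← Finset.mul_expect, Finset.expect_add_distrib, Fintype.expect_const]
    have hS : 0 ≤ S := by positivity
    have h6 : 4 ^ κ * (𝔼 i, ‖y - η • (g i y + corr) - x‖ ^ 2 + 3 * η ^ 2 * S) ≤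
        4 ^ κ * (3 * (‖y - x‖ ^ 2 + 3 * η ^ 2 * S)) := by
      refine mul_le_mul_of_nonneg_left ?_ (by positivity)
      linarith
    have h7 : ‖y - x‖ ^ 2 ≤ 4 ^ κ * (‖y - x‖ ^ 2 + 3 * η ^ 2 * S) := by
      have h8 : ‖y - x‖ ^ 2 ≤ ‖y - x‖ ^ 2 + 3 * η ^ 2 * S := by
        have : 0 ≤ 3 * η ^ 2 * S := by positivity
        linarith
      exact h8.trans (le_mul_of_one_le_left (by positivity) (one_le_pow₀ (by norm_num)))
    rw [pow_succ (4 : ℝ) κ]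
    linarith

theorem expect_norm_localBias_sq_le {β : ℝ}
    (hvar : ∀ y, 𝔼 i, ‖g i y - G y‖ ^ 2 ≤ σ ^ 2)
    (hlip : ∀ y z, ‖G y - G z‖ ^ 2 ≤ β ^ 2 * ‖y - z‖ ^ 2) (hη : 6 * η ^ 2 * β ^ 2 ≤ 1) (κ : ℕ) :
    𝔼 ξ : Fin κ → Fin n, ‖localBias η g G corr x ξ x‖ ^ 2 ≤
      β ^ 2 * (3 * 8 ^ κ * η ^ 2) * (σ ^ 2 + ‖G x + corr‖ ^ 2) := by
  refine (Finset.expect_le_expect fun ξ _ => norm_localBias_sq_le hlip ξ x).trans ?_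
  simp only [← Finset.mul_expect]
  have h1 := expect_localDrift_le (corr := corr) (x := x) hvar hlip hη (κ := κ) x
  calc _ ≤ 2 ^ κ * (β ^ 2 * (4 ^ κ * (‖x - x‖ ^ 2 + 3 * η ^ 2 * (σ ^ 2 + ‖G x + corr‖ ^ 2)))) := by
        gcongr
    _ = _ := by
        rw [sub_self, norm_zero, show (8 : ℝ) = 2 * 4 by norm_num, mul_pow]
        ring

end LocalSteps

end FedIGW

end

noncomputable section

namespace FedIGW

open scoped BigOperators

variable {V : Type*} [NormedAddCommGroup V] [InnerProductSpace ℝ V] {M n : ℕ}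

/-! ### One communication round -/

/-- The objective `F` is the average of functions with gradients `G m`, estimated by the stochastic
gradients `g m`; `xs` is its minimizer. -/
structure IsFedProblem (F : V → ℝ) (G : Fin M → V → V) (g : Fin M → Fin n → V → V) (xs : V)
    (μ β σ : ℝ) : Prop where
  convexOn : ConvexOn ℝ Set.univ F
  isMin : ∀ x, F xs ≤ F x
  mean : ∀ m y v, 𝔼 i, inner ℝ (g m i y - G m y) v = 0
  variance : ∀ m y, 𝔼 i, ‖g m i y - G m y‖ ^ 2 ≤ σ ^ 2
  lipschitz : ∀ m y z, ‖G m y - G m z‖ ^ 2 ≤ β ^ 2 * ‖y - z‖ ^ 2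
  strong : ∀ x, F x - F xs + μ / 2 * ‖x - xs‖ ^ 2 ≤ inner ℝ ((1 / (M : ℝ)) • ∑ m, G m x) (x - xs)
  norm_grad_sq_le : ∀ x, ‖(1 / (M : ℝ)) • ∑ m, G m x‖ ^ 2 ≤ 2 * β * (F x - F xs)

variable {F : V → ℝ} {G : Fin M → V → V} {g : Fin M → Fin n → V → V} {xs : V} {μ β σ : ℝ}

theorem IsFedProblem.grad_eq_zero (hF : IsFedProblem F G g xs μ β σ) :
    (1 / (M : ℝ)) • ∑ m, G m xs = 0 := by
  have h := hF.norm_grad_sq_le xs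
  rw [sub_self, mul_zero] at h
  exact norm_eq_zero.1 (pow_eq_zero_iff two_ne_zero |>.1 (le_antisymm h (sq_nonneg _)))

/-- The local drift per squared local step size. -/
def driftFactor (κ : ℕ) (ηl : ℝ) : ℝ := 3 * 8 ^ κ * ηl ^ 2

/-- The influence of the local drift on the progress of a round with step size `η`. -/
def driftWeight (μ β η : ℝ) : ℝ := (4 * η / μ + 3 * η ^ 2) * β ^ 2

/-- The deterministic part of the analysis of one round: gradient step with bias `b`, noise `e`. -/
theorem IsFedProblem.norm_step_sq_le (hF : IsFedProblem F G g xs μ β σ) (hμ : 0 < μ) {η : ℝ}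
    (hη : 0 < η) (hηβ : 6 * β * η ≤ 1) (x b e : V) :
    ‖x - η • ((1 / (M : ℝ)) • ∑ m, G m x + b + e) - xs‖ ^ 2 ≤
      (1 - 3 / 4 * (μ * η)) * ‖x - xs‖ ^ 2 - η * (F x - F xs) +
      (4 * η / μ + 3 * η ^ 2) * ‖b‖ ^ 2 + 3 * η ^ 2 * ‖e‖ ^ 2 - 2 * η * inner ℝ e (x - xs) := by
  set gr := (1 / (M : ℝ)) • ∑ m, G m x with hgr
  have h0 : x - η • (gr + b + e) - xs = (x - xs) - η • (gr + b + e) := by abel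
  rw [h0, norm_sub_sq_real, inner_smul_right, norm_smul, mul_pow, Real.norm_eq_abs, sq_abs,
    inner_add_right, inner_add_right, real_inner_comm gr, real_inner_comm e]
  have h1 := mul_le_mul_of_nonneg_left (hF.strong x) hη.le
  rw [← hgr] at h1
  -- The Young weight is set so that the bias uses up a quarter of the contraction `μ * η`.
  have h2 : -(inner ℝ (x - xs) b) ≤ μ / 8 * ‖x - xs‖ ^ 2 + 2 / μ * ‖b‖ ^ 2 := by
    have h3 := (neg_le_abs _).trans (abs_real_inner_le_norm (x - xs) b)
    have h4 : ‖x - xs‖ * ‖b‖ ≤ μ / 8 * ‖x - xs‖ ^ 2 + 2 / μ * ‖b‖ ^ 2 := by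
      have h5 := sq_nonneg (μ * ‖x - xs‖ - 4 * ‖b‖)
      have h6 : μ / 8 * ‖x - xs‖ ^ 2 + 2 / μ * ‖b‖ ^ 2 - ‖x - xs‖ * ‖b‖ =
          (μ * ‖x - xs‖ - 4 * ‖b‖) ^ 2 / (8 * μ) := by field_simp; ring
      have h7 : 0 ≤ (μ * ‖x - xs‖ - 4 * ‖b‖) ^ 2 / (8 * μ) := by positivity
      linarith
    linarith
  have h3 := mul_le_mul_of_nonneg_left (norm_add_sq_le_three gr b e) (sq_nonneg η)
  have h4 := mul_le_mul_of_nonneg_left (hF.norm_grad_sq_le x) (by positivity : 0 ≤ 3 * η ^ 2)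
  rw [← hgr] at h4
  -- Half of the descent `2 * η * (F x - F xs)` pays for the squared gradient.
  have h5 : 3 * η ^ 2 * (2 * β * (F x - F xs)) ≤ η * (F x - F xs) := by
    have h6 := mul_le_mul_of_nonneg_right hηβ (mul_nonneg hη.le (sub_nonneg.2 (hF.isMin x)))
    linarith
  have h6 := mul_le_mul_of_nonneg_left h2 (by positivity : 0 ≤ 2 * η)
  have h7 : 2 * η * (μ / 8 * ‖x - xs‖ ^ 2 + 2 / μ * ‖b‖ ^ 2) =
    μ * η / 4 * ‖x - xs‖ ^ 2 + 4 * η / μ * ‖b‖ ^ 2 := by ring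
  linarith

/-- Corrections summing to zero drop out of the leading term and survive only inside bias and noise.
FedAvg and SCAFFOLD thus share one analysis, with effective step `ηg * ηl * κ`. -/
theorem server_update_eq (hM : 0 < M) {κ : ℕ} (hκ : 0 < κ) (ηl ηg : ℝ) (corr : Fin M → V)
    (hcorr : ∑ m, corr m = 0) (ξ : Fin M → Fin κ → Fin n) (x : V) :
    x + (ηg / (M : ℝ)) • ∑ m, (localSteps ηl (g m) (corr m) (ξ m) x - x) =
      x - (ηg * ηl * κ) • ((1 / (M : ℝ)) • ∑ m, G m x +
        (1 / (M : ℝ)) • ∑ m, (1 / (κ : ℝ)) • localBias ηl (g m) (G m) (corr m) x (ξ m) x +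
        (1 / ((M : ℝ) * κ)) • ∑ m, localNoise ηl (g m) (G m) (corr m) (ξ m) x) := by
  have hM' : (M : ℝ) ≠ 0 := by exact_mod_cast hM.ne'
  have hκ' : (κ : ℝ) ≠ 0 := by exact_mod_cast hκ.ne'
  have h1 : ∀ m, localSteps ηl (g m) (corr m) (ξ m) x - x = -(ηl * κ) • G m x +
      -(ηl * κ) • corr m + -ηl • localBias ηl (g m) (G m) (corr m) x (ξ m) x +
      -ηl • localNoise ηl (g m) (G m) (corr m) (ξ m) x := by
    intro m
    rw [localSteps_eq ηl (g m) (G m) (corr m) x (ξ m) x]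
    module
  simp only [h1, Finset.sum_add_distrib, ← Finset.smul_sum, hcorr]
  match_scalars <;> field_simp

/-- The squared distance of the control variates from the local gradients at the minimizer. -/
def controlError (G : Fin M → V → V) (xs : V) (c : Fin M → V) : ℝ :=
  (1 / (M : ℝ)) * ∑ m, ‖c m - G m xs‖ ^ 2

theorem controlError_nonneg {V : Type*} [NormedAddCommGroup V] (G : Fin M → V → V) (xs : V) (c : Fin M → V) :
    0 ≤ controlError G xs c := by unfold controlError; positivity

/-- The local gradients average to zero at the minimizer, so the mean control variate is itself an
average of control errors. -/
theorem IsFedProblem.corrected_grad_le (hF : IsFedProblem F G g xs μ β σ) (hM : 0 < M) (x : V)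
    (c : Fin M → V) :
    (1 / (M : ℝ)) * ∑ m, ‖G m x + ((1 / (M : ℝ)) • ∑ k, c k - c m)‖ ^ 2 ≤
      3 * β ^ 2 * ‖x - xs‖ ^ 2 + 6 * controlError G xs c := by
  have hM' : (0 : ℝ) < M := by exact_mod_cast hM
  set cb := (1 / (M : ℝ)) • ∑ k, c k with hcb
  have hcb' : ‖cb‖ ^ 2 ≤ controlError G xs c := by
    have h1 : cb = (1 / (M : ℝ)) • ∑ m, (c m - G m xs) := by
      rw [Finset.sum_sub_distrib, smul_sub, hF.grad_eq_zero, sub_zero]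
    rw [h1]
    exact norm_avg_sq_le hM _
  have h1 : ∀ m, ‖G m x + (cb - c m)‖ ^ 2 ≤
      3 * (β ^ 2 * ‖x - xs‖ ^ 2) + 3 * ‖cb‖ ^ 2 + 3 * ‖c m - G m xs‖ ^ 2 := by
    intro m
    have h2 : G m x + (cb - c m) = (G m x - G m xs) + cb + -(c m - G m xs) := by abel
    rw [h2]
    refine (norm_add_sq_le_three _ _ _).trans ?_
    rw [norm_neg]
    linarith [hF.lipschitz m x xs]
  calc (1 / (M : ℝ)) * ∑ m, ‖G m x + (cb - c m)‖ ^ 2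
      ≤ (1 / (M : ℝ)) * ∑ m, (3 * (β ^ 2 * ‖x - xs‖ ^ 2) + 3 * ‖cb‖ ^ 2 + 3 * ‖c m - G m xs‖ ^ 2) :=
        by gcongr with m; exact h1 m
    _ = 3 * (β ^ 2 * ‖x - xs‖ ^ 2) + 3 * ‖cb‖ ^ 2 + 3 * controlError G xs c := by
        rw [Finset.sum_add_distrib, Finset.sum_const, Finset.card_univ, Fintype.card_fin,
          nsmul_eq_mul, ← Finset.mul_sum, controlError]
        field_simp
    _ ≤ _ := by linarith

variable [NeZero n] {κ : ℕ} {ηl : ℝ}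

/-- Bias and noise of a round are dependent, which is why `norm_step_sq_le` separates their squares.
Only the linear noise term must vanish in mean, and it does since `x` is fixed before the round. -/
theorem IsFedProblem.expect_round_le (hF : IsFedProblem F G g xs μ β σ) (hμ : 0 < μ) (hM : 0 < M)
    (hκ : 0 < κ) {ηg η : ℝ} (hη : 0 < η) (hηβ : 6 * β * η ≤ 1) (hη_eq : ηg * ηl * κ = η)
    (hηl : 6 * ηl ^ 2 * β ^ 2 ≤ 1) (corr : Fin M → V) (hcorr : ∑ m, corr m = 0) (x : V) :
    𝔼 ξ : Fin M → Fin κ → Fin n,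
      ‖x + (ηg / (M : ℝ)) • ∑ m, (localSteps ηl (g m) (corr m) (ξ m) x - x) - xs‖ ^ 2 ≤
      (1 - 3 / 4 * (μ * η)) * ‖x - xs‖ ^ 2 - η * (F x - F xs) +
      driftWeight μ β η * (driftFactor κ ηl *
        (σ ^ 2 + (1 / (M : ℝ)) * ∑ m, ‖G m x + corr m‖ ^ 2)) +
      3 * η ^ 2 * (σ ^ 2 / (κ * M)) := by
  have hM' : (0 : ℝ) < M := by exact_mod_cast hM
  have hκ' : (0 : ℝ) < κ := by exact_mod_cast hκ
  have hκ1 : (1 : ℝ) ≤ κ := by exact_mod_cast hκ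
  have hnoise := expect_norm_sum_sq
    (fun m (ζ : Fin κ → Fin n) => localNoise ηl (g m) (G m) (corr m) ζ x)
    fun m => (expect_localNoise (hF.mean m) (hF.variance m) x).1
  let b : (Fin M → Fin κ → Fin n) → V := fun ξ =>
    (1 / (M : ℝ)) • ∑ m, (1 / (κ : ℝ)) • localBias ηl (g m) (G m) (corr m) x (ξ m) x
  let e : (Fin M → Fin κ → Fin n) → V := fun ξ =>
    (1 / ((M : ℝ) * κ)) • ∑ m, localNoise ηl (g m) (G m) (corr m) (ξ m) x
  have he0 : 𝔼 ξ, inner ℝ (e ξ) (x - xs) = 0 := by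
    simp only [e, inner_smul_left, ← Finset.mul_expect, hnoise.1, mul_zero]
  have he : 𝔼 ξ, ‖e ξ‖ ^ 2 ≤ σ ^ 2 / (κ * M) := by
    simp only [e, norm_smul, mul_pow, ← Finset.mul_expect, hnoise.2]
    have h1 : ∑ m, 𝔼 ζ : Fin κ → Fin n, ‖localNoise ηl (g m) (G m) (corr m) ζ x‖ ^ 2 ≤
        ∑ _m : Fin M, κ * σ ^ 2 :=
      Finset.sum_le_sum fun m _ => (expect_localNoise (hF.mean m) (hF.variance m) x).2
    rw [Finset.sum_const, Finset.card_univ, Fintype.card_fin, nsmul_eq_mul] at h1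
    refine (mul_le_mul_of_nonneg_left h1 (by positivity)).trans (le_of_eq ?_)
    rw [Real.norm_of_nonneg (by positivity)]
    field_simp
  have hb : 𝔼 ξ, ‖b ξ‖ ^ 2 ≤ β ^ 2 * (driftFactor κ ηl *
      (σ ^ 2 + (1 / (M : ℝ)) * ∑ m, ‖G m x + corr m‖ ^ 2)) := by
    have h1 : ∀ ξ, ‖b ξ‖ ^ 2 ≤ (1 / (M : ℝ)) *
        ∑ m, ‖localBias ηl (g m) (G m) (corr m) x (ξ m) x‖ ^ 2 := by
      intro ξ
      refine (norm_avg_sq_le hM _).trans ?_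
      gcongr with m
      rw [norm_smul, Real.norm_of_nonneg (by positivity)]
      exact mul_le_of_le_one_left (norm_nonneg _) ((div_le_one hκ').2 hκ1)
    refine (Finset.expect_le_expect fun ξ _ => h1 ξ).trans ?_
    rw [← Finset.mul_expect, Finset.expect_sum_comm]
    have h2 : ∀ m, 𝔼 ξ : Fin M → Fin κ → Fin n,
        ‖localBias ηl (g m) (G m) (corr m) x (ξ m) x‖ ^ 2 ≤
        β ^ 2 * driftFactor κ ηl * (σ ^ 2 + ‖G m x + corr m‖ ^ 2) := by
      intro m
      rw [expect_eval m fun ζ : Fin κ → Fin n => ‖localBias ηl (g m) (G m) (corr m) x ζ x‖ ^ 2]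
      exact expect_norm_localBias_sq_le (hF.variance m) (hF.lipschitz m) hηl κ
    refine (mul_le_mul_of_nonneg_left (Finset.sum_le_sum fun m _ => h2 m)
      (by positivity)).trans (le_of_eq ?_)
    rw [← Finset.mul_sum, Finset.sum_add_distrib, Finset.sum_const, Finset.card_univ,
      Fintype.card_fin, nsmul_eq_mul]
    field_simp
  have hpt : ∀ ξ : Fin M → Fin κ → Fin n,
      ‖x + (ηg / (M : ℝ)) • ∑ m, (localSteps ηl (g m) (corr m) (ξ m) x - x) - xs‖ ^ 2 ≤
      ((1 - 3 / 4 * (μ * η)) * ‖x - xs‖ ^ 2 - η * (F x - F xs)) +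
      (4 * η / μ + 3 * η ^ 2) * ‖b ξ‖ ^ 2 + 3 * η ^ 2 * ‖e ξ‖ ^ 2 -
        2 * η * inner ℝ (e ξ) (x - xs) := by
    intro ξ
    rw [server_update_eq (G := G) hM hκ ηl ηg corr hcorr ξ x, hη_eq]
    exact hF.norm_step_sq_le hμ hη hηβ x (b ξ) (e ξ)
  refine (Finset.expect_le_expect fun ξ _ => hpt ξ).trans ?_
  rw [Finset.expect_sub_distrib, Finset.expect_add_distrib, Finset.expect_add_distrib,
    Fintype.expect_const, ← Finset.mul_expect, ← Finset.mul_expect, ← Finset.mul_expect, he0,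
    mul_zero, sub_zero]
  have h1 := mul_le_mul_of_nonneg_left hb (by positivity : 0 ≤ 4 * η / μ + 3 * η ^ 2)
  have h2 := mul_le_mul_of_nonneg_left he (by positivity : 0 ≤ 3 * η ^ 2)
  rw [driftWeight, mul_assoc]
  linarith

/-- Expected progress of one round of FedAvg. -/
theorem IsFedProblem.expect_fedAvgRound_le (hF : IsFedProblem F G g xs μ β σ) (hμ : 0 < μ)
    (hM : 0 < M) (hκ : 0 < κ) {ηg η : ℝ} (hη : 0 < η) (hηβ : 6 * β * η ≤ 1)
    (hη_eq : ηg * ηl * κ = η) (hηl : 6 * ηl ^ 2 * β ^ 2 ≤ 1) {Gd B A : ℝ}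
    (hdis : ∀ x, (1 / (M : ℝ)) * ∑ m, ‖G m x‖ ^ 2 ≤
      Gd ^ 2 + B ^ 2 * ‖(1 / (M : ℝ)) • ∑ m, G m x‖ ^ 2)
    (h1 : driftWeight μ β η * driftFactor κ ηl * (2 * β * B ^ 2) ≤ η / 2)
    (h2 : driftWeight μ β η * driftFactor κ ηl ≤ η ^ 2 / (κ * M))
    (h3 : driftWeight μ β η * driftFactor κ ηl ≤ η * A) (x : V) :
    𝔼 ξ : Fin M → Fin κ → Fin n, ‖fedAvgRound ηl ηg g ξ x - xs‖ ^ 2 ≤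
      (1 - μ * η / 2) * ‖x - xs‖ ^ 2 - η / 2 * (F x - F xs) +
      (4 * η ^ 2 * (σ ^ 2 / (κ * M)) + η * (A * Gd ^ 2)) := by
  have h := hF.expect_round_le hμ hM hκ hη hηβ hη_eq hηl (fun _ => 0) (by simp) x
  simp only [add_zero] at h
  simp only [fedAvgRound]
  refine h.trans ?_
  set w := driftWeight μ β η * driftFactor κ ηl with hw
  have hw0 : 0 ≤ w := by
    have : 0 ≤ driftWeight μ β η := by unfold driftWeight; positivity
    have : 0 ≤ driftFactor κ ηl := by unfold driftFactor; positivity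
    positivity
  -- The part proportional to the gap is absorbed by half of the remaining descent through `h1`.
  have h4 : (1 / (M : ℝ)) * ∑ m, ‖G m x‖ ^ 2 ≤ Gd ^ 2 + 2 * β * B ^ 2 * (F x - F xs) := by
    have h5 := mul_le_mul_of_nonneg_left (hF.norm_grad_sq_le x) (sq_nonneg B)
    linarith [hdis x]
  have h5 := mul_le_mul_of_nonneg_left h4 hw0
  have h6 := mul_le_mul_of_nonneg_right h1 (sub_nonneg.2 (hF.isMin x))
  have h7 := mul_le_mul_of_nonneg_right h2 (sq_nonneg σ)
  have h8 := mul_le_mul_of_nonneg_right h3 (sq_nonneg Gd)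
  have h9 : η ^ 2 / (κ * M) * σ ^ 2 = η ^ 2 * (σ ^ 2 / (κ * M)) := by ring
  have h10 : 0 ≤ μ * η * ‖x - xs‖ ^ 2 := by positivity
  have h11 : driftWeight μ β η * (driftFactor κ ηl * (σ ^ 2 + 1 / (M : ℝ) * ∑ m, ‖G m x‖ ^ 2)) =
      w * σ ^ 2 + w * ((1 / (M : ℝ)) * ∑ m, ‖G m x‖ ^ 2) := by rw [hw]; ring
  rw [h11]
  linarith

/-- Expected squared error of the control variates after a round of SCAFFOLD. -/
theorem IsFedProblem.expect_controlError_le (hF : IsFedProblem F G g xs μ β σ) (hM : 0 < M)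
    (hκ : 0 < κ) {ηg : ℝ} (hηl0 : ηl ≠ 0) (hηl : 6 * ηl ^ 2 * β ^ 2 ≤ 1) (x : V) (c : Fin M → V) :
    𝔼 ξ : Fin M → Fin κ → Fin n, controlError G xs (scaffoldRound ηl ηg g ξ (x, c)).2 ≤
      3 * β ^ 2 * ‖x - xs‖ ^ 2 + 3 * σ ^ 2 + 3 * β ^ 2 * (driftFactor κ ηl *
        (σ ^ 2 + (1 / (M : ℝ)) * ∑ m, ‖G m x + ((1 / (M : ℝ)) • ∑ k, c k - c m)‖ ^ 2)) := by
  have hM' : (0 : ℝ) < M := by exact_mod_cast hM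
  have hκ' : (0 : ℝ) < κ := by exact_mod_cast hκ
  have hκ1 : (1 : ℝ) ≤ κ := by exact_mod_cast hκ
  set cb := (1 / (M : ℝ)) • ∑ k, c k with hcb
  have h1 : ∀ (ξ : Fin M → Fin κ → Fin n) m, ‖(scaffoldRound ηl ηg g ξ (x, c)).2 m - G m xs‖ ^ 2 ≤
      3 * (β ^ 2 * ‖x - xs‖ ^ 2) + 3 * ‖localBias ηl (g m) (G m) (cb - c m) x (ξ m) x‖ ^ 2 +
      3 * ((1 / (κ : ℝ)) ^ 2 * ‖localNoise ηl (g m) (G m) (cb - c m) (ξ m) x‖ ^ 2) := by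
    intro ξ m
    -- The correction cancels the old control variate: the new one is the mean of the local
    -- stochastic gradients, and the old one matters only through the drift.
    have h2 : (scaffoldRound ηl ηg g ξ (x, c)).2 m - G m xs = (G m x - G m xs) +
        (1 / (κ : ℝ)) • localBias ηl (g m) (G m) (cb - c m) x (ξ m) x +
        (1 / (κ : ℝ)) • localNoise ηl (g m) (G m) (cb - c m) (ξ m) x := by
      simp only [scaffoldRound, ← hcb]
      rw [localSteps_eq ηl (g m) (G m) (cb - c m) x (ξ m) x]
      match_scalars <;> field_simp <;> ring
    rw [h2]
    refine (norm_add_sq_le_three _ _ _).trans ?_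
    rw [norm_smul, norm_smul, mul_pow, mul_pow, Real.norm_of_nonneg (by positivity)]
    have h3 : (1 / (κ : ℝ)) ^ 2 ≤ 1 := pow_le_one₀ (by positivity) ((div_le_one hκ').2 hκ1)
    have h4 := mul_le_mul_of_nonneg_right h3
      (sq_nonneg ‖localBias ηl (g m) (G m) (cb - c m) x (ξ m) x‖)
    linarith [hF.lipschitz m x xs]
  have h2 : ∀ m, 𝔼 ξ : Fin M → Fin κ → Fin n,
      ‖(scaffoldRound ηl ηg g ξ (x, c)).2 m - G m xs‖ ^ 2 ≤
      3 * (β ^ 2 * ‖x - xs‖ ^ 2) + 3 * (β ^ 2 * driftFactor κ ηl *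
        (σ ^ 2 + ‖G m x + (cb - c m)‖ ^ 2)) + 3 * σ ^ 2 := by
    intro m
    refine (Finset.expect_le_expect fun ξ _ => h1 ξ m).trans ?_
    rw [Finset.expect_add_distrib, Finset.expect_add_distrib, Fintype.expect_const,
      ← Finset.mul_expect, ← Finset.mul_expect, ← Finset.mul_expect,
      expect_eval m fun ζ : Fin κ → Fin n => ‖localBias ηl (g m) (G m) (cb - c m) x ζ x‖ ^ 2,
      expect_eval m fun ζ : Fin κ → Fin n => ‖localNoise ηl (g m) (G m) (cb - c m) ζ x‖ ^ 2]
    have h3 := expect_norm_localBias_sq_le (corr := cb - c m) (x := x) (hF.variance m)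
      (hF.lipschitz m) hηl κ
    have h4 := (expect_localNoise (η := ηl) (corr := cb - c m) (hF.mean m) (hF.variance m)
      (κ := κ) x).2
    have h5 : (1 / (κ : ℝ)) ^ 2 * (κ * σ ^ 2) ≤ σ ^ 2 := by
      have : (1 / (κ : ℝ)) ^ 2 * (κ * σ ^ 2) = σ ^ 2 / κ := by field_simp
      rw [this]
      exact div_le_self (sq_nonneg σ) hκ1
    have h6 := mul_le_mul_of_nonneg_left h4 (by positivity : 0 ≤ (1 / (κ : ℝ)) ^ 2)
    rw [driftFactor]
    linarith
  simp only [controlError]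
  rw [← Finset.mul_expect, Finset.expect_sum_comm]
  refine (mul_le_mul_of_nonneg_left (Finset.sum_le_sum fun m _ => h2 m)
      (by positivity)).trans (le_of_eq ?_)
  simp only [Finset.sum_add_distrib, ← Finset.mul_sum, Finset.sum_const, Finset.card_univ,
      Fintype.card_fin, nsmul_eq_mul]
  field_simp
  ring

/-- Expected progress of one round of SCAFFOLD. -/
theorem IsFedProblem.expect_scaffoldRound_le (hF : IsFedProblem F G g xs μ β σ) (hμ : 0 < μ)
    (hM : 0 < M) (hκ : 0 < κ) {ηg η s : ℝ} (hη : 0 < η) (hηβ : 6 * β * η ≤ 1)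
    (hη_eq : ηg * ηl * κ = η) (hηl : 6 * ηl ^ 2 * β ^ 2 ≤ 1) (hs : 0 < s) (hμη : μ * η ≤ 1)
    (hs1 : 3 * s * β ^ 2 ≤ μ * η / 8) (hs2 : 3 * s ≤ η ^ 2 / (κ * M) / 2)
    (h1 : 3 * β ^ 2 * ((driftWeight μ β η + 3 * s * β ^ 2) * driftFactor κ ηl) ≤ μ * η / 8)
    (h2 : (driftWeight μ β η + 3 * s * β ^ 2) * driftFactor κ ηl ≤ η ^ 2 / (κ * M) / 2)
    (h3 : 6 * ((driftWeight μ β η + 3 * s * β ^ 2) * driftFactor κ ηl) ≤ s / 2)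
    (z : V × (Fin M → V)) :
    𝔼 ξ : Fin M → Fin κ → Fin n, (‖(scaffoldRound ηl ηg g ξ z).1 - xs‖ ^ 2 +
      s * controlError G xs (scaffoldRound ηl ηg g ξ z).2) ≤
      (1 - μ * η / 2) * (‖z.1 - xs‖ ^ 2 + s * controlError G xs z.2) - η / 2 * (F z.1 - F xs) +
      4 * η ^ 2 * (σ ^ 2 / (κ * M)) := by
  obtain ⟨x, c⟩ := z
  have hM' : (M : ℝ) ≠ 0 := by exact_mod_cast hM.ne'
  have hηl0 : ηl ≠ 0 := by
    rintro rfl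
    simp at hη_eq
    exact hη.ne hη_eq
  set cb := (1 / (M : ℝ)) • ∑ k, c k with hcb
  have hcorr : ∑ m, (cb - c m) = 0 := by
    rw [Finset.sum_sub_distrib, Finset.sum_const, Finset.card_univ, Fintype.card_fin,
      ← Nat.cast_smul_eq_nsmul ℝ, hcb, smul_smul, mul_one_div_cancel hM', one_smul, sub_self]
  have hx := hF.expect_round_le hμ hM hκ hη hηβ hη_eq hηl (fun m => cb - c m) hcorr x
  have hc := hF.expect_controlError_le hM hκ (ηg := ηg) hηl0 hηl x c
  have hZ := hF.corrected_grad_le hM x c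
  rw [← hcb] at hc hZ
  rw [Finset.expect_add_distrib, ← Finset.mul_expect]
  have hx' : 𝔼 ξ : Fin M → Fin κ → Fin n, ‖(scaffoldRound ηl ηg g ξ (x, c)).1 - xs‖ ^ 2 ≤ _ := hx
  set Z := (1 / (M : ℝ)) * ∑ m, ‖G m x + (cb - c m)‖ ^ 2
  set X := ‖x - xs‖ ^ 2
  have hX0 : 0 ≤ X := sq_nonneg _
  set C := controlError G xs c
  have hC0 : 0 ≤ C := controlError_nonneg G xs c
  -- `W` collects the drift's influence on the model and, weighted by `s`, on the control variates.
  set W := (driftWeight μ β η + 3 * s * β ^ 2) * driftFactor κ ηl with hW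
  have hW0 : 0 ≤ W := by
    have : 0 ≤ driftWeight μ β η := by unfold driftWeight; positivity
    have : 0 ≤ driftFactor κ ηl := by unfold driftFactor; positivity
    positivity
  have e1 := mul_le_mul_of_nonneg_left hc hs.le
  have e2 := mul_le_mul_of_nonneg_left hZ hW0
  have e3 := mul_le_mul_of_nonneg_right h1 hX0
  have e4 := mul_le_mul_of_nonneg_right h2 (sq_nonneg σ)
  have e5 := mul_le_mul_of_nonneg_right h3 hC0
  have e6 := mul_le_mul_of_nonneg_right hs1 hX0
  have e7 := mul_le_mul_of_nonneg_right hs2 (sq_nonneg σ)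
  have e8 : η ^ 2 / (κ * M) / 2 * σ ^ 2 = η ^ 2 * (σ ^ 2 / (κ * M)) / 2 := by ring
  have e9 : driftWeight μ β η * (driftFactor κ ηl * (σ ^ 2 + Z)) +
      s * (3 * β ^ 2 * (driftFactor κ ηl * (σ ^ 2 + Z))) = W * σ ^ 2 + W * Z := by
    rw [hW]; ring
  have e10 : s / 2 * C ≤ (1 - μ * η / 2) * (s * C) := by
    have : 1 / 2 * (s * C) ≤ (1 - μ * η / 2) * (s * C) :=
      mul_le_mul_of_nonneg_right (by linarith) (mul_nonneg hs.le hC0)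
    linarith
  have e11 : 0 ≤ η / 2 * (F x - F xs) := mul_nonneg (by positivity) (sub_nonneg.2 (hF.isMin x))
  simp only
  linarith

end FedIGW

end

noncomputable section

namespace FedIGW

open scoped BigOperators

/-! ### Telescoping over the rounds -/

theorem iterates_cons_succ {α A : Type*} {ρ : ℕ} (step : A → α → α) (a : A) (ξ : Fin ρ → A) (s : α)
    (r : Fin (ρ + 1)) :
    iterates (fun k => step ((Fin.cons a ξ : Fin (ρ + 1) → A) k)) s r.succ =
      iterates (fun k => step (ξ k)) (step a s) r := by
  induction r using Fin.induction with
  | zero => rfl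
  | succ r ih =>
    have h1 : iterates (fun k => step ((Fin.cons a ξ : Fin (ρ + 1) → A) k)) s r.succ.succ =
        step (ξ r) (iterates (fun k => step ((Fin.cons a ξ : Fin (ρ + 1) → A) k)) s
          r.castSucc.succ) := rfl
    rw [h1, ih]
    rfl

/-- Weighting the recursion of round `r` by `q⁻¹ ^ (r + 1)` makes the potentials cancel. Peeling off
the first round makes the induction hypothesis available from every state it may reach. -/
theorem expect_telescope {α A : Type*} [Fintype A] [Nonempty A] (step : A → α → α)
    {Φ gap : α → ℝ} {q c N : ℝ} (hq : 0 < q)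
    (h : ∀ s, 𝔼 a, Φ (step a s) ≤ q * Φ s - c * gap s + N) (ρ : ℕ) (s : α) :
    𝔼 ξ : Fin ρ → A, (∑ r : Fin ρ, q⁻¹ ^ (r.val + 1) *
      (c * gap (iterates (fun k => step (ξ k)) s r.castSucc) - N) +
      q⁻¹ ^ ρ * Φ (iterates (fun k => step (ξ k)) s (Fin.last ρ))) ≤ Φ s := by
  induction ρ generalizing s with
  | zero => simp [iterates]
  | succ ρ ih =>
    rw [expect_cons]
    have h1 : ∀ a (ξ : Fin ρ → A), (∑ r : Fin (ρ + 1), q⁻¹ ^ (r.val + 1) *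
        (c * gap (iterates (fun k => step ((Fin.cons a ξ : Fin (ρ + 1) → A) k)) s r.castSucc) - N) +
        q⁻¹ ^ (ρ + 1) * Φ (iterates (fun k => step ((Fin.cons a ξ : Fin (ρ + 1) → A) k)) s
          (Fin.last (ρ + 1)))) = q⁻¹ * (c * gap s - N) + q⁻¹ * (∑ r : Fin ρ, q⁻¹ ^ (r.val + 1) *
        (c * gap (iterates (fun k => step (ξ k)) (step a s) r.castSucc) - N) +
        q⁻¹ ^ ρ * Φ (iterates (fun k => step (ξ k)) (step a s) (Fin.last ρ))) := by
      intro a ξ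
      rw [Fin.sum_univ_succ, ← Fin.succ_last, iterates_cons_succ]
      simp only [← Fin.succ_castSucc, iterates_cons_succ, Fin.val_succ]
      have h0 : iterates (fun k => step ((Fin.cons a ξ : Fin (ρ + 1) → A) k)) s
          (Fin.castSucc 0) = s := rfl
      rw [h0, mul_add q⁻¹, Finset.mul_sum]
      simp only [pow_succ', Fin.val_zero, pow_zero, mul_one, mul_assoc]
      rw [add_assoc]
    simp only [h1, Finset.expect_add_distrib, Fintype.expect_const, ← Finset.mul_expect]
    have h2 : 𝔼 a, 𝔼 ξ : Fin ρ → A, (∑ r : Fin ρ, q⁻¹ ^ (r.val + 1) *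
        (c * gap (iterates (fun k => step (ξ k)) (step a s) r.castSucc) - N) +
        q⁻¹ ^ ρ * Φ (iterates (fun k => step (ξ k)) (step a s) (Fin.last ρ))) ≤
        𝔼 a, Φ (step a s) := Finset.expect_le_expect fun a _ => ih (step a s)
    simp only [Finset.expect_add_distrib, ← Finset.mul_expect] at h2
    have h3 := mul_le_mul_of_nonneg_left (h2.trans (h s)) (inv_pos.2 hq).le
    have h4 : q⁻¹ * (q * Φ s - c * gap s + N) = Φ s - q⁻¹ * (c * gap s - N) := by
      field_simp
      ring
    linarith

/-- Geometrically increasing weights for the average of the server models. -/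
def geomWeight (q : ℝ) (ρ : ℕ) : Fin (ρ + 1) → ℝ :=
  -- The final model has weight zero: the telescoped sum contains only the gaps before each round.
  Fin.snoc (α := fun _ => ℝ)
    (fun r : Fin ρ => q⁻¹ ^ (r.val + 1) / ∑ k : Fin ρ, q⁻¹ ^ (k.val + 1)) 0

theorem geomWeight_sum_pos {q : ℝ} (hq : 0 < q) {ρ : ℕ} (hρ : 0 < ρ) :
    0 < ∑ k : Fin ρ, q⁻¹ ^ (k.val + 1) := by
  have : Nonempty (Fin ρ) := ⟨⟨0, hρ⟩⟩
  exact Finset.sum_pos (fun k _ => by positivity) Finset.univ_nonempty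

theorem geomWeight_nonneg {q : ℝ} (hq : 0 < q) (ρ : ℕ) (r : Fin (ρ + 1)) :
    0 ≤ geomWeight q ρ r := by
  refine Fin.lastCases ?_ (fun r => ?_) r
  · simp [geomWeight]
  · simp only [geomWeight, Fin.snoc_castSucc]
    positivity

theorem sum_geomWeight {q : ℝ} (hq : 0 < q) {ρ : ℕ} (hρ : 0 < ρ) :
    ∑ r, geomWeight q ρ r = 1 := by
  rw [Fin.sum_univ_castSucc]
  simp only [geomWeight, Fin.snoc_castSucc, Fin.snoc_last, add_zero]
  rw [← Finset.sum_div, div_self (geomWeight_sum_pos hq hρ).ne']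

/-- By Jensen the gap of the average is at most the weighted average of the gaps. Dividing the
telescoped bound by the total weight gives exponential decay of the initial potential, and noise of
order `N / η`. -/
theorem expect_gap_average_le {V : Type*} [NormedAddCommGroup V] [InnerProductSpace ℝ V]
    {α A : Type*} [Fintype A] [Nonempty A] (step : A → α → α) (pos : α → V) {F : V → ℝ} {Fs : ℝ}
    (hF : ConvexOn ℝ Set.univ F) {Φ : α → ℝ} (hΦ : ∀ s, 0 ≤ Φ s) {μ η N : ℝ}
    (hμ : 0 < μ) (hη : 0 < η) (hμη : μ * η ≤ 1)
    (h : ∀ s, 𝔼 a, Φ (step a s) ≤ (1 - μ * η / 2) * Φ s - η / 2 * (F (pos s) - Fs) + N) {ρ : ℕ}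
    (hρ : 1 ≤ ρ * (μ * η)) (s : α) :
    𝔼 ξ : Fin ρ → A, (F (∑ r, geomWeight (1 - μ * η / 2) ρ r •
      pos (iterates (fun k => step (ξ k)) s r)) - Fs) ≤
      3 * (μ * Φ s * Real.exp (-(ρ * (μ * η) / 2))) + 2 * (N / η) := by
  have hρ0 : 0 < ρ := Nat.pos_of_ne_zero fun h0 => by simp [h0] at hρ; linarith
  have hμη0 : 0 < μ * η := mul_pos hμ hη
  set q := 1 - μ * η / 2 with hqdef
  have hq : 0 < q := by linarith
  have hq1 : 1 - q = μ * η / 2 := by rw [hqdef]; ring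
  have hT := expect_telescope step (gap := fun s => F (pos s) - Fs) hq h ρ s
  set W := ∑ k : Fin ρ, q⁻¹ ^ (k.val + 1) with hW
  have hW0 : 0 < W := geomWeight_sum_pos hq hρ0
  have hWeq : W * (μ * η / 2) = q⁻¹ ^ ρ - 1 := by
    have h1 := geom_sum_mul q⁻¹ ρ
    rw [← h1, hW, Fin.sum_univ_eq_sum_range (fun k => q⁻¹ ^ (k + 1)) ρ, ← hq1]
    simp only [pow_succ]
    rw [← Finset.sum_mul, mul_assoc]
    congr 1
    field_simp
  set t := ρ * (μ * η) / 2 with ht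
  have hexp : Real.exp t ≤ q⁻¹ ^ ρ := by
    have h1 : Real.exp (μ * η / 2) ≤ q⁻¹ := by
      rw [le_inv_comm₀ (Real.exp_pos _) hq, ← Real.exp_neg]
      exact Real.one_sub_le_exp_neg _
    calc Real.exp t = Real.exp (μ * η / 2) ^ ρ := by rw [← Real.exp_nat_mul, ht]; ring_nf
      _ ≤ _ := pow_le_pow_left₀ (Real.exp_pos _).le h1 _
  have hpt : ∀ ξ : Fin ρ → A, F (∑ r, geomWeight q ρ r •
      pos (iterates (fun k => step (ξ k)) s r)) - Fs ≤
      (2 / (η * W)) * ((∑ r : Fin ρ, q⁻¹ ^ (r.val + 1) *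
        (η / 2 * (F (pos (iterates (fun k => step (ξ k)) s r.castSucc)) - Fs) - N) +
        q⁻¹ ^ ρ * Φ (iterates (fun k => step (ξ k)) s (Fin.last ρ)))) + 2 * (N / η) := by
    intro ξ
    have h1 := hF.map_sum_le (t := Finset.univ) (w := geomWeight q ρ)
      (p := fun r => pos (iterates (fun k => step (ξ k)) s r))
      (fun r _ => geomWeight_nonneg hq ρ r) (sum_geomWeight hq hρ0) fun _ _ => Set.mem_univ _
    simp only [smul_eq_mul] at h1
    rw [Fin.sum_univ_castSucc (f := fun r => geomWeight q ρ r *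
      F (pos (iterates (fun k => step (ξ k)) s r)))] at h1
    simp only [geomWeight, Fin.snoc_castSucc, Fin.snoc_last, zero_mul, add_zero] at h1
    have h2 : 0 ≤ (2 / (η * W)) * (q⁻¹ ^ ρ * Φ (iterates (fun k => step (ξ k)) s (Fin.last ρ))) := by
      have := hΦ (iterates (fun k => step (ξ k)) s (Fin.last ρ))
      positivity
    have h3 : ∑ r : Fin ρ, q⁻¹ ^ (r.val + 1) *
        (η / 2 * (F (pos (iterates (fun k => step (ξ k)) s r.castSucc)) - Fs) - N) =
        η / 2 * (∑ r : Fin ρ, q⁻¹ ^ (r.val + 1) *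
          F (pos (iterates (fun k => step (ξ k)) s r.castSucc))) - (η / 2 * Fs + N) * W := by
      rw [hW, Finset.mul_sum, Finset.mul_sum, ← Finset.sum_sub_distrib]
      exact Finset.sum_congr rfl fun r _ => by ring
    have h4 : ∑ r : Fin ρ, q⁻¹ ^ (r.val + 1) / W *
        F (pos (iterates (fun k => step (ξ k)) s r.castSucc)) =
        (∑ r : Fin ρ, q⁻¹ ^ (r.val + 1) *
          F (pos (iterates (fun k => step (ξ k)) s r.castSucc))) / W := by
      rw [Finset.sum_div]
      exact Finset.sum_congr rfl fun r _ => by ring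
    rw [← hW, h4] at h1
    rw [h3, mul_add]
    have h5 : ∀ x : ℝ, 2 / (η * W) * (η / 2 * x - (η / 2 * Fs + N) * W) =
        x / W - Fs - 2 * (N / η) := by
      intro x
      field_simp
      ring
    rw [h5]
    simp only [geomWeight]
    linarith
  refine (Finset.expect_le_expect fun ξ _ => hpt ξ).trans ?_
  rw [Finset.expect_add_distrib, Fintype.expect_const, ← Finset.mul_expect]
  have h6 := mul_le_mul_of_nonneg_left hT (by positivity : 0 ≤ 2 / (η * W))
  have h7 : 2 / (η * W) * Φ s = μ * Φ s / (q⁻¹ ^ ρ - 1) := by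
    rw [← hWeq]
    field_simp
  -- Hence `exp t - 1 ≥ exp t / 3`, the source of the factor `3`.
  have ht2 : (3 : ℝ) / 2 ≤ Real.exp t := by
    have := Real.add_one_le_exp t
    have : (1 : ℝ) / 2 ≤ t := by rw [ht]; linarith
    linarith
  have h8 : μ * Φ s / (q⁻¹ ^ ρ - 1) ≤ 3 * (μ * Φ s * Real.exp (-t)) := by
    have h9 : 0 ≤ μ * Φ s := mul_nonneg hμ.le (hΦ s)
    have h10 : Real.exp t / 3 ≤ q⁻¹ ^ ρ - 1 := by linarith
    calc μ * Φ s / (q⁻¹ ^ ρ - 1) ≤ μ * Φ s / (Real.exp t / 3) :=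
          div_le_div_of_nonneg_left h9 (by positivity) h10
      _ = _ := by rw [Real.exp_neg]; field_simp
  linarith

/-! ### Tuning of the step sizes -/

theorem one_le_logFactor {μ D A : ℝ} (hμ : 0 < μ) (hA : 0 ≤ A) : 1 ≤ logFactor μ D A := by
  have h : 0 ≤ μ * D ^ 2 / A := by positivity
  rw [logFactor, Real.le_log_iff_exp_le (by positivity)]
  linarith

theorem mul_exp_neg_logFactor_le {μ D A : ℝ} (hμ : 0 < μ) (hA : 0 < A) :
    μ * D ^ 2 * Real.exp (-logFactor μ D A) ≤ A := by
  have h : 0 ≤ μ * D ^ 2 / A := by positivity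
  rw [logFactor, Real.exp_neg, Real.exp_log (by positivity), ← div_eq_mul_inv,
    div_le_iff₀ (by positivity), mul_add, mul_div_cancel₀ _ hA.ne']
  have : 0 ≤ A * Real.exp 1 := by positivity
  linarith

/-- The choice is the smaller of `1 / (8β)` and `2L / (μρ)`. The first leaves the unavoidable
exponential; the second gives `μ D² exp (-L) ≤ A`, which is what the logarithmic factor is made for.
If `A = 0`, the first is taken. -/
theorem exists_stepSize {μ β D A : ℝ} {ρ : ℕ} (hμ : 0 < μ) (hβ : 0 < β) (hA : 0 ≤ A)
    (hρ : 8 * β / μ ≤ ρ) :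
    ∃ η : ℝ, 0 < η ∧ 8 * β * η ≤ 1 ∧ 1 ≤ ρ * (μ * η) ∧
      μ * D ^ 2 * Real.exp (-(ρ * (μ * η) / 2)) ≤
        A + μ * D ^ 2 * Real.exp (-(μ * ρ / (16 * β))) ∧
      (A ≠ 0 → η ≤ 2 * logFactor μ D A / (μ * ρ)) := by
  have hρ0 : (0 : ℝ) < ρ := lt_of_lt_of_le (by positivity) hρ
  have hρ1 : 8 * β ≤ ρ * μ := (div_le_iff₀ hμ).1 hρ
  have hη8 : 1 ≤ ρ * (μ * (1 / (8 * β))) := by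
    have : ρ * (μ * (1 / (8 * β))) = ρ * μ / (8 * β) := by ring
    rw [this, le_div_iff₀ (by positivity)]
    linarith
  have hexp8 : μ * D ^ 2 * Real.exp (-(ρ * (μ * (1 / (8 * β))) / 2)) ≤
      A + μ * D ^ 2 * Real.exp (-(μ * ρ / (16 * β))) := by
    have : ρ * (μ * (1 / (8 * β))) / 2 = μ * ρ / (16 * β) := by field_simp; ring
    rw [this]
    linarith
  have hβ8 : 8 * β * (1 / (8 * β)) ≤ 1 := by
    rw [mul_one_div_cancel (by positivity)]
  rcases hA.eq_or_lt with rfl | hApos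
  · exact ⟨1 / (8 * β), by positivity, hβ8, hη8, hexp8, fun h => absurd rfl h⟩
  set L := logFactor μ D A
  have hL : 1 ≤ L := one_le_logFactor hμ hA
  rcases le_total (1 / (8 * β)) (2 * L / (μ * ρ)) with hle | hle
  · exact ⟨1 / (8 * β), by positivity, hβ8, hη8, hexp8, fun _ => hle⟩
  · refine ⟨2 * L / (μ * ρ), by positivity, ?_, ?_, ?_, fun _ => le_rfl⟩
    · exact (mul_le_mul_of_nonneg_left hle (by positivity)).trans hβ8
    · have : ρ * (μ * (2 * L / (μ * ρ))) = 2 * L := by field_simp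
      rw [this]
      linarith
    · have : ρ * (μ * (2 * L / (μ * ρ))) / 2 = L := by field_simp
      rw [this]
      have h1 := mul_exp_neg_logFactor_le (D := D) hμ hApos
      have h2 : 0 ≤ μ * D ^ 2 * Real.exp (-(μ * ρ / (16 * β))) := by positivity
      linarith

/-- The statistical error of a step size that is bounded as in `exists_stepSize`. -/
theorem stepSize_mul_variance_le {μ D A σ η : ℝ} {M ρ κ : ℕ} (hM : 0 < M) (hκ : 0 < κ)
    (hρ : (0 : ℝ) < ρ) (hμ : 0 < μ) (hσA : σ ^ 2 / (μ * ρ * κ * M) ≤ A)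
    (hη : A ≠ 0 → η ≤ 2 * logFactor μ D A / (μ * ρ)) :
    η * (σ ^ 2 / (κ * M)) ≤ 2 * (logFactor μ D A * (σ ^ 2 / (μ * ρ * κ * M))) := by
  have hM' : (0 : ℝ) < M := by exact_mod_cast hM
  have hκ' : (0 : ℝ) < κ := by exact_mod_cast hκ
  by_cases h0 : A = 0
  · have h1 : σ ^ 2 / (μ * ρ * κ * M) = 0 :=
      le_antisymm (hσA.trans h0.le) (by positivity)
    have h2 : σ ^ 2 = 0 := by
      rcases div_eq_zero_iff.1 h1 with h | h
      · exact h
      · exact absurd h (by positivity)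
    simp [h2]
  · refine (mul_le_mul_of_nonneg_right (hη h0) (by positivity)).trans (le_of_eq ?_)
    field_simp

theorem eventually_mul_sq_le (c : ℝ) {b : ℝ} (hb : 0 < b) :
    ∀ᶠ x in nhdsWithin (0 : ℝ) (Set.Ioi 0), c * x ^ 2 ≤ b := by
  have h : Filter.Tendsto (fun x : ℝ => c * x ^ 2) (nhds 0) (nhds (c * 0 ^ 2)) :=
    (by fun_prop : Continuous fun x : ℝ => c * x ^ 2).tendsto 0
  exact ((h.mono_left nhdsWithin_le_nhds).eventually_lt_const (by simpa using hb)).mono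
    fun x hx => hx.le

theorem eventually_mul_le (c : ℝ) {b : ℝ} (hb : 0 < b) :
    ∀ᶠ x in nhdsWithin (0 : ℝ) (Set.Ioi 0), c * x ≤ b := by
  have h : Filter.Tendsto (fun x : ℝ => c * x) (nhds 0) (nhds (c * 0)) :=
    (by fun_prop : Continuous fun x : ℝ => c * x).tendsto 0
  exact ((h.mono_left nhdsWithin_le_nhds).eventually_lt_const (by simpa using hb)).mono
    fun x hx => hx.le

/-- FedAvg with suitable step sizes, for all problems with the given parameters. -/
theorem exists_fedAvg_stepSizes {M ρ κ : ℕ} {μ β σ Gd B D : ℝ} (hM : 0 < M) (hκ : 0 < κ)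
    (hμ : 0 < μ) (hβ : 0 < β) (hμβ : μ ≤ β) (hρ : 8 * (1 + B ^ 2) * β / μ ≤ ρ) :
    ∃ (ηl ηg : ℝ) (wt : Fin (ρ + 1) → ℝ), 0 < ηl ∧ 1 ≤ ηg ∧ (∀ r, 0 ≤ wt r) ∧ ∑ r, wt r = 1 ∧
      ∀ (d n : ℕ) [NeZero n] (F : Param d → ℝ) (G : Fin M → Param d → Param d)
        (g : Fin M → Fin n → Param d → Param d) (xs x₀ : Param d),
        IsFedProblem F G g xs μ β σ →
        (∀ x, (1 / (M : ℝ)) * ∑ m, ‖G m x‖ ^ 2 ≤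
          Gd ^ 2 + B ^ 2 * ‖(1 / (M : ℝ)) • ∑ m, G m x‖ ^ 2) → ‖x₀ - xs‖ ≤ D →
        𝔼 ξ : Fin ρ → Fin M → Fin κ → Fin n, (F (∑ r, wt r •
          iterates (fun r => fedAvgRound ηl ηg g (ξ r)) x₀ r) - F xs) ≤
          19 * fedAvgBound M ρ κ μ β σ Gd B D := by
  have hM' : (0 : ℝ) < M := by exact_mod_cast hM
  have hκ' : (0 : ℝ) < κ := by exact_mod_cast hκ
  have hρ8 : 8 * β / μ ≤ ρ := le_trans (by gcongr; nlinarith [sq_nonneg B]) hρ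
  have hρ0 : (0 : ℝ) < ρ := lt_of_lt_of_le (by positivity) hρ8
  set A₁ := σ ^ 2 / (μ * ρ * κ * M) with hA₁
  set A₂ := β * Gd ^ 2 / (μ * ρ) ^ 2 with hA₂
  have hA₁0 : 0 ≤ A₁ := by positivity
  have hA₂0 : 0 ≤ A₂ := by positivity
  obtain ⟨η, hη, hηβ, hρη, hexp, hηΛ⟩ :=
    exists_stepSize (D := D) hμ hβ (add_nonneg hA₁0 hA₂0) hρ8
  set L := logFactor μ D (A₁ + A₂)
  have hL : 1 ≤ L := one_le_logFactor hμ (add_nonneg hA₁0 hA₂0)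
  have hvar := stepSize_mul_variance_le (σ := σ) hM hκ hρ0 hμ
    (le_add_of_nonneg_right hA₂0) hηΛ
  -- Allowing a drift of `η * A` makes the heterogeneity contribute a multiple of `A * Gd ^ 2 = A₂`.
  set A := β / (μ * ρ) ^ 2 with hA
  -- Each requirement holds for all small positive `ηl`, with `η` already fixed. The bound `κ * ηl ≤
  -- η` yields `1 ≤ ηg` for `ηg = η / (ηl * κ)`.
  obtain ⟨ηl, hl1, hl2, hl3, hl4, hl5, hl6⟩ := ((eventually_mul_sq_le (6 * β ^ 2) one_pos).and
    ((eventually_mul_le κ hη).and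
    ((eventually_mul_sq_le (driftWeight μ β η * (3 * 8 ^ κ) * (2 * β * B ^ 2))
      (by positivity : 0 < η / 2)).and
    ((eventually_mul_sq_le (driftWeight μ β η * (3 * 8 ^ κ))
      (by positivity : 0 < η ^ 2 / (κ * M))).and
    ((eventually_mul_sq_le (driftWeight μ β η * (3 * 8 ^ κ))
      (by positivity : 0 < η * A)).and self_mem_nhdsWithin))))).exists
  replace hl6 : 0 < ηl := hl6
  have hμη : μ * η ≤ 1 := by
    have := mul_le_mul_of_nonneg_right hμβ hη.le
    linarith [mul_pos hβ hη]
  have hρn : 0 < ρ := by exact_mod_cast hρ0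
  refine ⟨ηl, η / (ηl * κ), geomWeight (1 - μ * η / 2) ρ, hl6, ?_,
    geomWeight_nonneg (by linarith) ρ, sum_geomWeight (by linarith) hρn, ?_⟩
  · rw [le_div_iff₀ (by positivity)]
    linarith
  intro d n _ F G g xs x₀ hF hdis hx₀
  have hround := hF.expect_fedAvgRound_le hμ hM hκ (ηl := ηl) (ηg := η / (ηl * κ)) hη
    (by linarith [mul_pos hβ hη]) (by field_simp) (by linarith) (A := A) hdis
    (by rw [driftFactor]; linarith) (by rw [driftFactor]; linarith)
    (by rw [driftFactor]; linarith)
  have h := expect_gap_average_le (fun ξ x => fedAvgRound ηl (η / (ηl * κ)) g ξ x) (fun x => x)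
    hF.convexOn (Φ := fun x => ‖x - xs‖ ^ 2) (fun x => sq_nonneg _) hμ hη hμη hround hρη x₀
  refine h.trans ?_
  have h1 : μ * ‖x₀ - xs‖ ^ 2 * Real.exp (-(ρ * (μ * η) / 2)) ≤
      μ * D ^ 2 * Real.exp (-(ρ * (μ * η) / 2)) := by gcongr
  have h2 : 2 * ((4 * η ^ 2 * (σ ^ 2 / (κ * M)) + η * (A * Gd ^ 2)) / η) =
      8 * (η * (σ ^ 2 / (κ * M))) + 2 * A₂ := by
    rw [hA₂, hA]
    field_simp
    ring
  have h3 : Real.exp (-(μ * ρ / (16 * β))) ≤ Real.exp (-(μ * ρ / (16 * (1 + B ^ 2) * β))) := by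
    apply Real.exp_le_exp.2
    apply neg_le_neg
    gcongr
    nlinarith [sq_nonneg B]
  have h4 : μ * D ^ 2 * Real.exp (-(μ * ρ / (16 * β))) ≤
      μ * D ^ 2 * Real.exp (-(μ * ρ / (16 * (1 + B ^ 2) * β))) := by gcongr
  have h5 : A₁ ≤ L * A₁ := le_mul_of_one_le_left hA₁0 hL
  have h6 : A₂ ≤ L ^ 2 * A₂ := le_mul_of_one_le_left hA₂0 (one_le_pow₀ hL)
  have h7 : 0 ≤ μ * D ^ 2 * Real.exp (-(μ * ρ / (16 * (1 + B ^ 2) * β))) := by positivity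
  have h8 : fedAvgBound M ρ κ μ β σ Gd B D = L * A₁ + L ^ 2 * A₂ +
    μ * D ^ 2 * Real.exp (-(μ * ρ / (16 * (1 + B ^ 2) * β))) := rfl
  rw [h2, h8]
  -- The constant `19` is `16 + 3` in front of `L * A₁`: `8 * 2` from the noise and `3` from the
  -- decay of the initial potential. The other terms need only `5` and `3`.
  linarith

/-- SCAFFOLD with suitable step sizes, for all problems with the given parameters. -/
theorem exists_scaffold_stepSizes {M ρ κ : ℕ} {μ β σ D : ℝ} (hM : 0 < M) (hκ : 0 < κ)
    (hμ : 0 < μ) (hβ : 0 < β) (hμβ : μ ≤ β) (hρ : max (162 * β / μ) 30 ≤ (ρ : ℝ)) :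
    ∃ (ηl ηg : ℝ) (wt : Fin (ρ + 1) → ℝ), 0 < ηl ∧ 1 ≤ ηg ∧ (∀ r, 0 ≤ wt r) ∧ ∑ r, wt r = 1 ∧
      ∀ (d n : ℕ) [NeZero n] (F : Param d → ℝ) (G : Fin M → Param d → Param d)
        (g : Fin M → Fin n → Param d → Param d) (xs x₀ : Param d) (c₀ : Fin M → Param d),
        IsFedProblem F G g xs μ β σ →
        ‖x₀ - xs‖ ^ 2 + (1 / (2 * (M : ℝ) * β ^ 2)) * ∑ m, ‖c₀ m - G m xs‖ ^ 2 ≤ D ^ 2 →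
        𝔼 ξ : Fin ρ → Fin M → Fin κ → Fin n, (F (∑ r, wt r •
          (iterates (fun r => scaffoldRound ηl ηg g (ξ r)) (x₀, c₀) r).1) - F xs) ≤
          19 * scaffoldBound M ρ κ μ β σ D := by
  have hM' : (0 : ℝ) < M := by exact_mod_cast hM
  have hκ' : (0 : ℝ) < κ := by exact_mod_cast hκ
  have hρ8 : 8 * β / μ ≤ ρ := le_trans (by gcongr; norm_num) ((le_max_left _ _).trans hρ)
  have hρ0 : (0 : ℝ) < ρ := lt_of_lt_of_le (by positivity) hρ8
  set A₁ := σ ^ 2 / (μ * ρ * κ * M) with hA₁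
  have hA₁0 : 0 ≤ A₁ := by positivity
  obtain ⟨η, hη, hηβ, hρη, hexp, hηΛ⟩ := exists_stepSize (D := D) hμ hβ hA₁0 hρ8
  set L := logFactor μ D A₁
  have hL : 1 ≤ L := one_le_logFactor hμ hA₁0
  have hvar := stepSize_mul_variance_le (σ := σ) hM hκ hρ0 hμ le_rfl hηΛ
  -- The weight `s` precedes `ηl`, since the drift must be small against `s`. The condition `2 * β ^
  -- 2 * s ≤ 1` puts the initial potential below `D ^ 2`.
  obtain ⟨s, hs1, hs2, hs3, hs4⟩ := ((eventually_mul_le (3 * β ^ 2)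
    (by positivity : 0 < μ * η / 8)).and
    ((eventually_mul_le 3 (by positivity : 0 < η ^ 2 / (κ * M) / 2)).and
    ((eventually_mul_le (2 * β ^ 2) one_pos).and self_mem_nhdsWithin))).exists
  replace hs4 : 0 < s := hs4
  set w := driftWeight μ β η + 3 * s * β ^ 2 with hw
  obtain ⟨ηl, hl1, hl2, hl3, hl4, hl5, hl6⟩ := ((eventually_mul_sq_le (6 * β ^ 2) one_pos).and
    ((eventually_mul_le κ hη).and
    ((eventually_mul_sq_le (3 * β ^ 2 * (w * (3 * 8 ^ κ))) (by positivity : 0 < μ * η / 8)).and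
    ((eventually_mul_sq_le (w * (3 * 8 ^ κ)) (by positivity : 0 < η ^ 2 / (κ * M) / 2)).and
    ((eventually_mul_sq_le (6 * (w * (3 * 8 ^ κ)))
      (by positivity : 0 < s / 2)).and self_mem_nhdsWithin))))).exists
  replace hl6 : 0 < ηl := hl6
  have hμη : μ * η ≤ 1 := by
    have := mul_le_mul_of_nonneg_right hμβ hη.le
    linarith [mul_pos hβ hη]
  have hρn : 0 < ρ := by exact_mod_cast hρ0
  refine ⟨ηl, η / (ηl * κ), geomWeight (1 - μ * η / 2) ρ, hl6, ?_,
    geomWeight_nonneg (by linarith) ρ, sum_geomWeight (by linarith) hρn, ?_⟩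
  · rw [le_div_iff₀ (by positivity)]
    linarith
  intro d n _ F G g xs x₀ c₀ hF hinit
  have hround := hF.expect_scaffoldRound_le hμ hM hκ (ηl := ηl) (ηg := η / (ηl * κ)) hη
    (by linarith [mul_pos hβ hη]) (by field_simp) (by linarith) hs4 hμη (by linarith) (by linarith)
    (by rw [driftFactor]; linarith) (by rw [driftFactor]; linarith)
    (by rw [driftFactor]; linarith)
  have h := expect_gap_average_le (fun ξ z => scaffoldRound ηl (η / (ηl * κ)) g ξ z) Prod.fst
    hF.convexOn (Φ := fun z => ‖z.1 - xs‖ ^ 2 + s * controlError G xs z.2)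
    (fun z => add_nonneg (sq_nonneg _) (mul_nonneg hs4.le (controlError_nonneg G xs z.2)))
    hμ hη hμη hround hρη (x₀, c₀)
  refine h.trans ?_
  have h0 : ‖x₀ - xs‖ ^ 2 + s * controlError G xs c₀ ≤ D ^ 2 := by
    refine le_trans ?_ hinit
    have h1 : (1 / (2 * (M : ℝ) * β ^ 2)) * ∑ m, ‖c₀ m - G m xs‖ ^ 2 =
        (1 / (2 * β ^ 2)) * controlError G xs c₀ := by
      rw [controlError]
      field_simp
    rw [h1]
    have h2 : s ≤ 1 / (2 * β ^ 2) := by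
      rw [le_div_iff₀ (by positivity)]
      linarith
    have h3 := mul_le_mul_of_nonneg_right h2 (controlError_nonneg G xs c₀)
    linarith
  have h1 : μ * (‖x₀ - xs‖ ^ 2 + s * controlError G xs c₀) * Real.exp (-(ρ * (μ * η) / 2)) ≤
      μ * D ^ 2 * Real.exp (-(ρ * (μ * η) / 2)) := by gcongr
  have h2 : 2 * ((4 * η ^ 2 * (σ ^ 2 / (κ * M))) / η) = 8 * (η * (σ ^ 2 / (κ * M))) := by
    field_simp
    ring
  have h3 : Real.exp (-(μ * ρ / (16 * β))) ≤
      Real.exp (-(min ((ρ : ℝ) / 30) (μ * ρ / (162 * β)))) := by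
    apply Real.exp_le_exp.2
    apply neg_le_neg
    refine (min_le_right _ _).trans ?_
    gcongr
    norm_num
  have h4 : μ * D ^ 2 * Real.exp (-(μ * ρ / (16 * β))) ≤
      μ * D ^ 2 * Real.exp (-(min ((ρ : ℝ) / 30) (μ * ρ / (162 * β)))) := by gcongr
  have h5 : A₁ ≤ L * A₁ := le_mul_of_one_le_left hA₁0 hL
  have h7 : 0 ≤ μ * D ^ 2 * Real.exp (-(min ((ρ : ℝ) / 30) (μ * ρ / (162 * β)))) := by positivity
  have h8 : scaffoldBound M ρ κ μ β σ D = L * A₁ +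
    μ * D ^ 2 * Real.exp (-(min ((ρ : ℝ) / 30) (μ * ρ / (162 * β)))) := rfl
  simp only at *
  rw [h2, h8]
  linarith

end FedIGW

end

noncomputable section

namespace FedIGW

open scoped BigOperators

/-! ### Strongly convex and smooth functions -/

section Smooth

variable {V : Type*} [NormedAddCommGroup V] [InnerProductSpace ℝ V] {h : V → ℝ} {gr : V → V}
  {μ β : ℝ}

theorem add_inner_add_sq_le_of_strongConvexOn [CompleteSpace V] (hc : StrongConvexOn Set.univ μ h)
    {g x : V} (hd : HasGradientAt h g x) (y : V) :
    h x + inner ℝ g (y - x) + μ / 2 * ‖y - x‖ ^ 2 ≤ h y := by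
  have h1 : HasDerivAt (fun t : ℝ => h (x + t • (y - x))) (inner ℝ g (y - x)) 0 :=
    hd.hasFDerivAt.hasLineDerivAt (y - x)
  have h2 := h1.tendsto_slope_zero_right
  have h3 : Filter.Tendsto (fun t : ℝ => h y - h x - (1 - t) * (μ / 2 * ‖y - x‖ ^ 2))
      (nhdsWithin 0 (Set.Ioi 0)) (nhds (h y - h x - (1 - 0) * (μ / 2 * ‖y - x‖ ^ 2))) :=
    ((by fun_prop : Continuous fun t : ℝ =>
      h y - h x - (1 - t) * (μ / 2 * ‖y - x‖ ^ 2)).tendsto 0).mono_left nhdsWithin_le_nhds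
  have h4 := le_of_tendsto_of_tendsto h2 h3 ?_
  · linarith
  filter_upwards [Ioo_mem_nhdsGT (zero_lt_one' ℝ)] with t ht
  have h5 := hc.2 (Set.mem_univ x) (Set.mem_univ y) (sub_nonneg.2 ht.2.le) ht.1.le
    (sub_add_cancel 1 t)
  have h6 : (1 - t) • x + t • y = x + t • (y - x) := by module
  simp only [h6, smul_eq_mul, norm_sub_rev x y] at h5
  simp only [zero_add, zero_smul, add_zero, smul_eq_mul]
  rw [inv_mul_le_iff₀ ht.1]
  linarith

/-- At the point `y - β⁻¹ • (gr y - gr x)` the convex lower bound from `x` is compared with the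
smooth upper bound from `y`. -/
theorem norm_sub_sq_le_bregman (hβ : 0 < β)
    (hlow : ∀ x y, h x + inner ℝ (gr x) (y - x) ≤ h y)
    (hup : ∀ x y, h y - h x ≤ inner ℝ (gr x) (y - x) + β / 2 * ‖y - x‖ ^ 2) (x y : V) :
    ‖gr y - gr x‖ ^ 2 ≤ 2 * β * (h y - h x - inner ℝ (gr x) (y - x)) := by
  have h1 := hlow x (y - β⁻¹ • (gr y - gr x))
  have h2 := hup y (y - β⁻¹ • (gr y - gr x))
  have h3 : y - β⁻¹ • (gr y - gr x) - y = -(β⁻¹ • (gr y - gr x)) := by abel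
  have h4 : y - β⁻¹ • (gr y - gr x) - x = (y - x) - β⁻¹ • (gr y - gr x) := by abel
  rw [h3, inner_neg_right, inner_smul_right, norm_neg, norm_smul, mul_pow, Real.norm_eq_abs,
    sq_abs] at h2
  rw [h4, inner_sub_right, inner_smul_right] at h1
  have h5 : inner ℝ (gr y) (gr y - gr x) - inner ℝ (gr x) (gr y - gr x) = ‖gr y - gr x‖ ^ 2 := by
    rw [← inner_sub_left, real_inner_self_eq_norm_sq]
  have h6 : β / 2 * (β⁻¹ ^ 2 * ‖gr y - gr x‖ ^ 2) = β⁻¹ * (‖gr y - gr x‖ ^ 2 / 2) := by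
    field_simp
  have h7 : β⁻¹ * (‖gr y - gr x‖ ^ 2 / 2) ≤ h y - h x - inner ℝ (gr x) (y - x) := by
    rw [h6] at h2
    rw [← h5] at h2 ⊢
    linarith
  rw [inv_mul_le_iff₀ hβ] at h7
  linarith

theorem norm_sub_sq_le_mul_sq (hβ : 0 < β)
    (hlow : ∀ x y, h x + inner ℝ (gr x) (y - x) ≤ h y)
    (hup : ∀ x y, h y - h x ≤ inner ℝ (gr x) (y - x) + β / 2 * ‖y - x‖ ^ 2) (x y : V) :
    ‖gr x - gr y‖ ^ 2 ≤ β ^ 2 * ‖x - y‖ ^ 2 := by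
  have h1 := norm_sub_sq_le_bregman hβ hlow hup y x
  have h2 := mul_le_mul_of_nonneg_left (hup y x) (by positivity : 0 ≤ 2 * β)
  linarith

/-- A gradient step of length `1 / β` decreases `h` by at least `‖gr x‖² / (2β)`, and `h` cannot
fall below its minimum. -/
theorem norm_sq_le_of_smooth (hβ : 0 < β)
    (hup : ∀ x y, h y - h x ≤ inner ℝ (gr x) (y - x) + β / 2 * ‖y - x‖ ^ 2) {xs : V}
    (hxs : ∀ x, h xs ≤ h x) (x : V) : ‖gr x‖ ^ 2 ≤ 2 * β * (h x - h xs) := by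
  have h1 := hup x (x - β⁻¹ • gr x)
  have h2 := hxs (x - β⁻¹ • gr x)
  rw [sub_sub_cancel_left, inner_neg_right, inner_smul_right, norm_neg, norm_smul, mul_pow,
    Real.norm_eq_abs, sq_abs, real_inner_self_eq_norm_sq] at h1
  have h3 : β / 2 * (β⁻¹ ^ 2 * ‖gr x‖ ^ 2) = β⁻¹ * (‖gr x‖ ^ 2 / 2) := by field_simp
  have h4 : β⁻¹ * (‖gr x‖ ^ 2 / 2) ≤ h x - h xs := by linarith
  rw [inv_mul_le_iff₀ hβ] at h4
  linarith

/-- The quadratic lower bound makes `h` coercive. -/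
theorem exists_forall_le_of_strongly_convex [ProperSpace V] (hμ : 0 < μ) (hcont : Continuous h)
    (g : V) (hlow : ∀ y, h 0 + inner ℝ g y + μ / 2 * ‖y‖ ^ 2 ≤ h y) : ∃ xs, ∀ x, h xs ≤ h x := by
  refine hcont.exists_forall_le ?_
  have h1 : Filter.Tendsto (fun t : ℝ => h 0 + t * (μ / 2 * t - ‖g‖)) Filter.atTop Filter.atTop :=
    Filter.tendsto_atTop_add_const_left _ _ (Filter.tendsto_id.atTop_mul_atTop₀
      (Filter.tendsto_atTop_add_const_right _ (-‖g‖)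
        (Filter.tendsto_id.const_mul_atTop (half_pos hμ))))
  refine Filter.tendsto_atTop_mono (fun y => ?_) (h1.comp (tendsto_norm_cocompact_atTop (E := V)))
  have h2 := (neg_le_abs _).trans (abs_real_inner_le_norm g y)
  have h3 := hlow y
  simp only [Function.comp_apply]
  linarith

end Smooth

/-! ### Regular losses -/

theorem hasGradientAt_const_mul_sum {V ι : Type*} [NormedAddCommGroup V] [InnerProductSpace ℝ V]
    [CompleteSpace V] [Fintype ι] (c : ℝ) {φ : ι → V → ℝ} {gr : ι → V} {x : V}
    (h : ∀ i, HasGradientAt (φ i) (gr i) x) :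
    HasGradientAt (fun y => c * ∑ i, φ i y) (c • ∑ i, gr i) x := by
  rw [hasGradientAt_iff_hasFDerivAt]
  have h1 := (HasFDerivAt.fun_sum fun i (_ : i ∈ Finset.univ) => (h i).hasFDerivAt).const_mul c
  simpa using h1

variable {M K d n : ℕ} {env : Environment.{u} M K} {f : Param d → Predictor env}
  {loss : Fin M → ℝ → ℝ → ℝ} {S : Dataset env n} {μ β σ : ℝ}

/-- The gradient of the local empirical loss of agent `m`. -/
abbrev localGrad (f : Param d → Predictor env) (loss : Fin M → ℝ → ℝ → ℝ) (S : Dataset env n)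
    (m : Fin M) (ω : Param d) : Param d :=
  gradient (fun η => localLoss loss S (f η) m) ω

namespace RegularLosses

theorem hasGradientAt_localLoss_avg (h : RegularLosses f loss S μ β σ) (m : Fin M) (ω : Param d) :
    HasGradientAt (fun η => localLoss loss S (f η) m)
      ((1 / (n : ℝ)) • ∑ i, sampleGrad f loss S m i ω) ω :=
  hasGradientAt_const_mul_sum _ fun i => (h.differentiable m i ω).hasGradientAt

theorem localGrad_eq (h : RegularLosses f loss S μ β σ) (m : Fin M) (ω : Param d) :
    localGrad f loss S m ω = (1 / (n : ℝ)) • ∑ i, sampleGrad f loss S m i ω :=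
  (h.hasGradientAt_localLoss_avg m ω).gradient

theorem hasGradientAt_localLoss (h : RegularLosses f loss S μ β σ) (m : Fin M) (ω : Param d) :
    HasGradientAt (fun η => localLoss loss S (f η) m) (localGrad f loss S m ω) ω :=
  (h.hasGradientAt_localLoss_avg m ω).differentiableAt.hasGradientAt

theorem hasGradientAt_globalLoss (h : RegularLosses f loss S μ β σ) (ω : Param d) :
    HasGradientAt (fun η => globalLoss loss S (f η))
      ((1 / (M : ℝ)) • ∑ m, localGrad f loss S m ω) ω :=
  hasGradientAt_const_mul_sum _ fun m => h.hasGradientAt_localLoss m ω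

theorem localLoss_ge (h : RegularLosses f loss S μ β σ) (m : Fin M) (x y : Param d) :
    localLoss loss S (f x) m + inner ℝ (localGrad f loss S m x) (y - x) + μ / 2 * ‖y - x‖ ^ 2 ≤
      localLoss loss S (f y) m :=
  add_inner_add_sq_le_of_strongConvexOn (h.strongConvex m) (h.hasGradientAt_localLoss m x) y

theorem globalLoss_ge (h : RegularLosses f loss S μ β σ) (hM : 0 < M) (x y : Param d) :
    globalLoss loss S (f x) + inner ℝ ((1 / (M : ℝ)) • ∑ m, localGrad f loss S m x) (y - x) +
      μ / 2 * ‖y - x‖ ^ 2 ≤ globalLoss loss S (f y) := by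
  have hM' : (M : ℝ) ≠ 0 := by exact_mod_cast hM.ne'
  have h1 := mul_le_mul_of_nonneg_left
    (Finset.sum_le_sum fun m (_ : m ∈ Finset.univ) => h.localLoss_ge m x y)
    (by positivity : 0 ≤ 1 / (M : ℝ))
  simp only [Finset.sum_add_distrib, mul_add, Finset.sum_const, Finset.card_univ, Fintype.card_fin,
    nsmul_eq_mul] at h1
  rw [real_inner_smul_left, sum_inner]
  have h2 : 1 / (M : ℝ) * (M * (μ / 2 * ‖y - x‖ ^ 2)) = μ / 2 * ‖y - x‖ ^ 2 := by field_simp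
  rw [h2] at h1
  exact h1

theorem globalLoss_sub_le (h : RegularLosses f loss S μ β σ) (hM : 0 < M) (x y : Param d) :
    globalLoss loss S (f y) - globalLoss loss S (f x) ≤
      inner ℝ ((1 / (M : ℝ)) • ∑ m, localGrad f loss S m x) (y - x) + β / 2 * ‖y - x‖ ^ 2 := by
  have hM' : (M : ℝ) ≠ 0 := by exact_mod_cast hM.ne'
  have h1 := mul_le_mul_of_nonneg_left
    (Finset.sum_le_sum fun m (_ : m ∈ Finset.univ) => h.smooth m x y)
    (by positivity : 0 ≤ 1 / (M : ℝ))
  simp only [Finset.sum_add_distrib, Finset.sum_sub_distrib, mul_add, mul_sub, Finset.sum_const,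
    Finset.card_univ, Fintype.card_fin, nsmul_eq_mul] at h1
  rw [real_inner_smul_left, sum_inner]
  have h2 : 1 / (M : ℝ) * (M * (β / 2 * ‖y - x‖ ^ 2)) = β / 2 * ‖y - x‖ ^ 2 := by field_simp
  rw [h2] at h1
  exact h1

theorem exists_isMinOn (h : RegularLosses f loss S μ β σ) (hM : 0 < M) (hμ : 0 < μ) :
    ∃ xs, ∀ x, globalLoss loss S (f xs) ≤ globalLoss loss S (f x) :=
  exists_forall_le_of_strongly_convex (h := fun η => globalLoss loss S (f η)) hμ
    (continuous_iff_continuousAt.2 fun x => (h.hasGradientAt_globalLoss x).continuousAt) _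
    fun y => by simpa using h.globalLoss_ge hM 0 y

theorem isFedProblem (h : RegularLosses f loss S μ β σ) (hM : 0 < M) (hn : n ≠ 0) (hμ : 0 < μ)
    (hβ : 0 < β) {xs : Param d} (hxs : ∀ x, globalLoss loss S (f xs) ≤ globalLoss loss S (f x)) :
    IsFedProblem (fun η => globalLoss loss S (f η)) (localGrad f loss S) (sampleGrad f loss S)
      xs μ β σ where
  convexOn := by
    refine ⟨convex_univ, fun x _ y _ a b ha hb hab => ?_⟩
    have h1 := Finset.sum_le_sum fun m (_ : m ∈ Finset.univ) =>
      ((h.strongConvex m).convexOn fun r => by positivity).2 (Set.mem_univ x) (Set.mem_univ y)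
        ha hb hab
    have h2 := mul_le_mul_of_nonneg_left h1 (by positivity : 0 ≤ 1 / (M : ℝ))
    simp only [smul_eq_mul, Finset.sum_add_distrib, ← Finset.mul_sum] at h2
    refine h2.trans (le_of_eq ?_)
    simp only [globalLoss, smul_eq_mul]
    ring
  isMin := hxs
  mean m y v := by
    have hn' : (n : ℝ) ≠ 0 := by exact_mod_cast hn
    rw [Fintype.expect_eq_sum_div_card, ← sum_inner, Finset.sum_sub_distrib, Finset.sum_const,
      h.localGrad_eq, Finset.card_univ, Fintype.card_fin, ← Nat.cast_smul_eq_nsmul ℝ, smul_smul,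
      mul_one_div_cancel hn', one_smul, sub_self, inner_zero_left, zero_div]
  variance m y := by
    rw [Fintype.expect_eq_sum_div_card, Fintype.card_fin, div_eq_inv_mul, ← one_div]
    exact h.variance m y
  lipschitz m y z := norm_sub_sq_le_mul_sq (h := fun η => localLoss loss S (f η) m) hβ
    (fun x y => by
      have h1 := h.localLoss_ge m x y
      have : 0 ≤ μ / 2 * ‖y - x‖ ^ 2 := by positivity
      linarith) (h.smooth m) y z
  strong x := by
    have h1 := h.globalLoss_ge hM x xs
    rw [← neg_sub x xs, inner_neg_right, norm_neg] at h1
    linarith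
  norm_grad_sq_le := norm_sq_le_of_smooth (h := fun η => globalLoss loss S (f η)) hβ
    (h.globalLoss_sub_le hM) hxs

/-- The quadratic lower bound exceeds the upper one at any two distinct points. This settles the
degenerate case outside the step size analysis, which needs `μ ≤ β`. -/
theorem eq_of_lt (h : RegularLosses f loss S μ β σ) (hM : 0 < M) (hβμ : β < μ) (x y : Param d) :
    x = y := by
  have h1 := h.localLoss_ge ⟨0, hM⟩ x y
  have h2 := h.smooth ⟨0, hM⟩ x y
  by_contra hne
  have h3 : 0 < ‖y - x‖ ^ 2 := pow_pos (norm_pos_iff.2 (sub_ne_zero.2 (Ne.symm hne))) 2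
  have h4 := mul_lt_mul_of_pos_right hβμ h3
  linarith

end RegularLosses

/-! ### Optimization error of a protocol with finitely many seeds -/

theorem lintegral_uniformOn_univ {A : Type*} [Fintype A] [Nonempty A] [MeasurableSpace A]
    [MeasurableSingletonClass A] {φ : A → ℝ} (hφ : ∀ a, 0 ≤ φ a) :
    ∫⁻ a, ENNReal.ofReal (φ a) ∂(uniformOn Set.univ : Measure A) = ENNReal.ofReal (𝔼 a, φ a) := by
  have hc : (0 : ℝ) < Fintype.card A := by exact_mod_cast Fintype.card_pos
  rw [lintegral_fintype, Fintype.expect_eq_sum_div_card, ENNReal.ofReal_div_of_pos hc,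
    ENNReal.ofReal_sum_of_nonneg fun a _ => hφ a, ENNReal.ofReal_natCast, div_eq_mul_inv,
    Finset.sum_mul]
  refine Finset.sum_congr rfl fun a _ => ?_
  rw [uniformOn_univ, Measure.count_singleton, one_div]

/-- Comparing with the minimum over the whole space only enlarges the gap and makes it nonnegative,
so positive parts no longer obstruct averaging over seeds. -/
theorem optGap_le {Θ : Set (Param d)} {ω xs : Param d}
    (hxs : ∀ x, globalLoss loss S (f xs) ≤ globalLoss loss S (f x)) :
    optGap f loss Θ S ω ≤ ENNReal.ofReal (globalLoss loss S (f ω) - globalLoss loss S (f xs)) :=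
  iSup₂_le fun ω' _ => ENNReal.ofReal_le_ofReal (sub_le_sub_left (hxs ω') _)

theorem lintegral_optGap_le {A : Type*} [Fintype A] [Nonempty A] [MeasurableSpace A]
    [MeasurableSingletonClass A] {Θ : Set (Param d)} {xs : Param d}
    (hxs : ∀ x, globalLoss loss S (f xs) ≤ globalLoss loss S (f x)) (out : A → Param d) {b : ℝ}
    (hb : 𝔼 a, (globalLoss loss S (f (out a)) - globalLoss loss S (f xs)) ≤ b) :
    ∫⁻ a, optGap f loss Θ S (out a) ∂(uniformOn Set.univ : Measure A) ≤ ENNReal.ofReal b :=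
  (lintegral_mono fun _ => optGap_le hxs).trans
    ((lintegral_uniformOn_univ fun a => sub_nonneg.2 (hxs (out a))).le.trans
      (ENNReal.ofReal_le_ofReal hb))

theorem optGap_eq_zero {Θ : Set (Param d)} {ω : Param d} (h : ∀ x y : Param d, x = y) :
    optGap f loss Θ S ω = 0 :=
  le_antisymm (iSup₂_le fun ω' _ => by rw [h ω ω', sub_self, ENNReal.ofReal_zero]) zero_le

theorem optError_le {Θ : Set (Param d)} {FL : FLProtocol (Dataset env n) (Param d)} {b : ℝ≥0∞}
    (h : ∀ S, ValidData S → ∫⁻ ξ, optGap f loss Θ S (FL.out S ξ) ∂FL.law ≤ b) :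
    optError env f loss Θ n FL ≤ b := by
  refine iSup₂_le fun p hp => ?_
  have := hp.isProbabilityMeasure_dataLaw n
  calc _ ≤ ∫⁻ _, b ∂(dataLaw env n p) := lintegral_mono_ae (hp.ae_validData.mono h)
    _ = b := by rw [lintegral_const, measure_univ, mul_one]

theorem exists_fedAvg_optGap_le {M ρ κ : ℕ} {μ β σ G B D : ℝ} (hM : 0 < M) (hκ : 0 < κ)
    (hμ : 0 < μ) (hβ : 0 < β) (hρ : 8 * (1 + B ^ 2) * β / μ ≤ ρ) :
    ∃ (ηl ηg : ℝ) (wt : Fin (ρ + 1) → ℝ), 0 < ηl ∧ 1 ≤ ηg ∧ (∀ r, 0 ≤ wt r) ∧ ∑ r, wt r = 1 ∧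
      ∀ (K d : ℕ) (env : Environment.{u} M K) (f : Param d → Predictor env)
        (loss : Fin M → ℝ → ℝ → ℝ) (Θ : Set (Param d)) (n : ℕ) [NeZero n] (ω₀ : Param d)
        (S : Dataset env n), RegularLosses f loss S μ β σ → BoundedDissimilarity f loss S G B →
          InitWithin f loss S ω₀ D →
          ∫⁻ ξ, optGap f loss Θ S ((fedAvg f loss n ρ κ ηl ηg wt ω₀).out S ξ)
              ∂(fedAvg (env := env) f loss n ρ κ ηl ηg wt ω₀).law ≤
            ENNReal.ofReal (19 * fedAvgBound M ρ κ μ β σ G B D) := by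
  rcases lt_or_ge β μ with hβμ | hμβ
  -- Any admissible step sizes and weights serve here: all parameters coincide, so the gap is zero.
  · refine ⟨1, 1, Pi.single 0 1, one_pos, le_rfl, fun r => ?_, by simp, ?_⟩
    · exact (Pi.single_nonneg.2 zero_le_one : (0 : Fin (ρ + 1) → ℝ) ≤ Pi.single 0 1) r
    · intro K d env f loss Θ n _ ω₀ S hS _ _
      simp [optGap_eq_zero (hS.eq_of_lt hM hβμ)]
  · obtain ⟨ηl, ηg, wt, h1, h2, h3, h4, h5⟩ :=
      exists_fedAvg_stepSizes (σ := σ) (Gd := G) (D := D) hM hκ hμ hβ hμβ hρ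
    refine ⟨ηl, ηg, wt, h1, h2, h3, h4, ?_⟩
    intro K d env f loss Θ n _ ω₀ S hS hdis hinit
    obtain ⟨xs, hxs⟩ := hS.exists_isMinOn hM hμ
    have h6 := h5 d n (fun η => globalLoss loss S (f η)) (localGrad f loss S)
      (sampleGrad f loss S) xs ω₀ (hS.isFedProblem hM (NeZero.ne n) hμ hβ hxs)
      (fun x => by rw [← (hS.hasGradientAt_globalLoss x).gradient]; exact hdis x)
      (hinit xs fun x _ => hxs x)
    exact lintegral_optGap_le hxs (fun ξ : Fin ρ → Fin M → Fin κ → Fin n => ∑ r, wt r •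
      iterates (fun r => fedAvgRound ηl ηg (sampleGrad f loss S) (ξ r)) ω₀ r) h6

theorem exists_scaffold_optGap_le {M ρ κ : ℕ} {μ β σ D : ℝ} (hM : 0 < M) (hκ : 0 < κ)
    (hμ : 0 < μ) (hβ : 0 < β) (hρ : max (162 * β / μ) 30 ≤ (ρ : ℝ)) :
    ∃ (ηl ηg : ℝ) (wt : Fin (ρ + 1) → ℝ), 0 < ηl ∧ 1 ≤ ηg ∧ (∀ r, 0 ≤ wt r) ∧ ∑ r, wt r = 1 ∧
      ∀ (K d : ℕ) (env : Environment.{u} M K) (f : Param d → Predictor env)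
        (loss : Fin M → ℝ → ℝ → ℝ) (Θ : Set (Param d)) (n : ℕ) [NeZero n] (ω₀ : Param d)
        (c₀ : Fin M → Param d) (S : Dataset env n), RegularLosses f loss S μ β σ →
          ControlInitWithin f loss S β ω₀ c₀ D →
          ∫⁻ ξ, optGap f loss Θ S ((scaffold f loss n ρ κ ηl ηg wt ω₀ c₀).out S ξ)
              ∂(scaffold (env := env) f loss n ρ κ ηl ηg wt ω₀ c₀).law ≤
            ENNReal.ofReal (19 * scaffoldBound M ρ κ μ β σ D) := by
  rcases lt_or_ge β μ with hβμ | hμβ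
  · refine ⟨1, 1, Pi.single 0 1, one_pos, le_rfl, fun r => ?_, by simp, ?_⟩
    · exact (Pi.single_nonneg.2 zero_le_one : (0 : Fin (ρ + 1) → ℝ) ≤ Pi.single 0 1) r
    · intro K d env f loss Θ n _ ω₀ c₀ S hS _
      simp [optGap_eq_zero (hS.eq_of_lt hM hβμ)]
  · obtain ⟨ηl, ηg, wt, h1, h2, h3, h4, h5⟩ :=
      exists_scaffold_stepSizes (σ := σ) (D := D) hM hκ hμ hβ hμβ hρ
    refine ⟨ηl, ηg, wt, h1, h2, h3, h4, ?_⟩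
    intro K d env f loss Θ n _ ω₀ c₀ S hS hinit
    obtain ⟨xs, hxs⟩ := hS.exists_isMinOn hM hμ
    have h6 := h5 d n (fun η => globalLoss loss S (f η)) (localGrad f loss S)
      (sampleGrad f loss S) xs ω₀ c₀ (hS.isFedProblem hM (NeZero.ne n) hμ hβ hxs)
      (hinit xs fun x _ => hxs x)
    exact lintegral_optGap_le hxs (fun ξ : Fin ρ → Fin M → Fin κ → Fin n => ∑ r, wt r •
      (iterates (fun r => scaffoldRound ηl ηg (sampleGrad f loss S) (ξ r)) (ω₀, c₀) r).1) h6

end FedIGW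

end

theorem corollary2 :
    -- the regret of FedIGW with an arbitrary protocol
    (∀ c₁ c₂ : ℝ, 0 < c₁ → c₁ ≤ c₂ → ∃ C : ℝ, 0 < C ∧
      ∀ (M K d : ℕ) (env : Environment.{u} M K) (f : Param d → Predictor env)
        (loss : Fin M → ℝ → ℝ → ℝ) (Θ : Set (Param d)) (μf : ℝ) (ωs : Param d)
        (E : ℕ → ℕ) (FL : ∀ l, FLProtocol (Dataset env (E l)) (Param d))
        (R ε : ℕ → ℝ≥0) (γ : ℕ → ℝ) (sel : Fin M → (Fin K → ℝ) → Fin K)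
        (Ω : Type v) (_ : MeasurableSpace Ω) (P : Measure Ω) (_ : IsProbabilityMeasure P)
        (data : ∀ l, Ω → Dataset env (E l)) (seed : ∀ l, Ω → (FL l).Seed),
        0 < μf → WellSpecified env f loss Θ μf ωs →
        (∀ l, 0 < E l) →
        (∀ l, Measurable fun q : Dataset env (E l) × (FL l).Seed => (FL l).out q.1 q.2) →
        (∀ l S ξ, ValidData S → (FL l).out S ξ ∈ Θ) →
        (∀ l, rademacher env f loss Θ (E l) ≤ (R l : ℝ≥0∞)) →
        (∀ l, optError env f loss Θ (E l) (FL l) ≤ (ε (l + 1) : ℝ≥0∞)) →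
        (∀ l, 0 < R l + ε (l + 1)) →
        (∀ l, c₁ * Real.sqrt (K * μf / (R l + ε (l + 1))) ≤ γ (l + 1) ∧
          γ (l + 1) ≤ c₂ * Real.sqrt (K * μf / (R l + ε (l + 1)))) →
        (∀ l, γ (l + 1) ≤ γ (l + 2)) →
        (∀ m, IsArgmax (sel m)) →
        IsFedIGWRun P f sel γ FL data seed →
        ∀ T : ℕ, regret P data T ≤
          C * ((M : ℝ) * E 0 + ∑ l ∈ Finset.Ico 1 (epochCount E T),
            Real.sqrt (K * (R (l - 1) + ε l) / μf) * ((M : ℝ) * E l))) ∧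
    -- the optimization error of FedAvg
    (∃ C : ℝ, 0 < C ∧
      ∀ (M ρ κ : ℕ) (μ β σ G B D : ℝ), 0 < M → 0 < κ → 0 < μ → 0 < β → 0 ≤ σ → 0 ≤ G → 0 ≤ B →
        0 ≤ D → 8 * (1 + B ^ 2) * β / μ ≤ ρ →
        ∃ (ηl ηg : ℝ) (wt : Fin (ρ + 1) → ℝ), 0 < ηl ∧ 1 ≤ ηg ∧ (∀ r, 0 ≤ wt r) ∧ ∑ r, wt r = 1 ∧
          ∀ (K d : ℕ) (env : Environment.{u} M K) (f : Param d → Predictor env)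
            (loss : Fin M → ℝ → ℝ → ℝ) (Θ : Set (Param d)) (n : ℕ) [NeZero n] (ω₀ : Param d),
            (∀ S : Dataset env n, RegularLosses f loss S μ β σ → BoundedDissimilarity f loss S G B →
              InitWithin f loss S ω₀ D →
              ∫⁻ ξ, optGap f loss Θ S ((fedAvg f loss n ρ κ ηl ηg wt ω₀).out S ξ)
                  ∂(fedAvg (env := env) f loss n ρ κ ηl ηg wt ω₀).law ≤
                ENNReal.ofReal (C * fedAvgBound M ρ κ μ β σ G B D)) ∧
            ((∀ S : Dataset env n, ValidData S → RegularLosses f loss S μ β σ ∧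
              BoundedDissimilarity f loss S G B ∧ InitWithin f loss S ω₀ D) →
              optError env f loss Θ n (fedAvg f loss n ρ κ ηl ηg wt ω₀) ≤
                ENNReal.ofReal (C * fedAvgBound M ρ κ μ β σ G B D))) ∧
    -- the optimization error of SCAFFOLD
    (∃ C : ℝ, 0 < C ∧
      ∀ (M ρ κ : ℕ) (μ β σ D : ℝ), 0 < M → 0 < κ → 0 < μ → 0 < β → 0 ≤ σ → 0 ≤ D →
        max (162 * β / μ) 30 ≤ ρ →
        ∃ (ηl ηg : ℝ) (wt : Fin (ρ + 1) → ℝ), 0 < ηl ∧ 1 ≤ ηg ∧ (∀ r, 0 ≤ wt r) ∧ ∑ r, wt r = 1 ∧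
          ∀ (K d : ℕ) (env : Environment.{u} M K) (f : Param d → Predictor env)
            (loss : Fin M → ℝ → ℝ → ℝ) (Θ : Set (Param d)) (n : ℕ) [NeZero n] (ω₀ : Param d)
            (c₀ : Fin M → Param d),
            (∀ S : Dataset env n, RegularLosses f loss S μ β σ →
              ControlInitWithin f loss S β ω₀ c₀ D →
              ∫⁻ ξ, optGap f loss Θ S ((scaffold f loss n ρ κ ηl ηg wt ω₀ c₀).out S ξ)
                  ∂(scaffold (env := env) f loss n ρ κ ηl ηg wt ω₀ c₀).law ≤
                ENNReal.ofReal (C * scaffoldBound M ρ κ μ β σ D)) ∧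
            ((∀ S : Dataset env n, ValidData S → RegularLosses f loss S μ β σ ∧
              ControlInitWithin f loss S β ω₀ c₀ D) →
              optError env f loss Θ n (scaffold f loss n ρ κ ηl ηg wt ω₀ c₀) ≤
                ENNReal.ofReal (C * scaffoldBound M ρ κ μ β σ D))) := by
  refine ⟨fun c₁ c₂ hc₁ _ => ⟨1 + (5 / 2 + 32 * c₂ ^ 2) / c₁, by positivity, ?_⟩,
    ⟨19, by norm_num, ?_⟩, ⟨19, by norm_num, ?_⟩⟩
  · intro M K d env f loss Θ μf ωs E FL R ε γ sel Ω _ P _ data seed hμ h hE hout hΘ hR hε hpos hγ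
      hmono hsel hrun T
    exact hrun.regret_le h hμ hout hsel hmono hE hΘ hR hε hpos hc₁ (fun l => (hγ l).1)
      (fun l => (hγ l).2) T
  · intro M ρ κ μ β σ G B D hM hκ hμ hβ _ _ _ _ hρ
    obtain ⟨ηl, ηg, wt, h1, h2, h3, h4, h5⟩ :=
      exists_fedAvg_optGap_le (σ := σ) (G := G) (D := D) hM hκ hμ hβ hρ
    refine ⟨ηl, ηg, wt, h1, h2, h3, h4, fun K d env f loss Θ n _ ω₀ =>
      ⟨fun S => h5 K d env f loss Θ n ω₀ S, fun hS => optError_le fun S hv => ?_⟩⟩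
    obtain ⟨hreg, hdis, hinit⟩ := hS S hv
    exact h5 K d env f loss Θ n ω₀ S hreg hdis hinit
  · intro M ρ κ μ β σ D hM hκ hμ hβ _ _ hρ
    obtain ⟨ηl, ηg, wt, h1, h2, h3, h4, h5⟩ :=
      exists_scaffold_optGap_le (σ := σ) (D := D) hM hκ hμ hβ hρ
    refine ⟨ηl, ηg, wt, h1, h2, h3, h4, fun K d env f loss Θ n _ ω₀ c₀ =>
      ⟨fun S => h5 K d env f loss Θ n ω₀ c₀ S, fun hS => optError_le fun S hv => ?_⟩⟩
    obtain ⟨hreg, hinit⟩ := hS S hv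
    exact h5 K d env f loss Θ n ω₀ c₀ S hreg hinit
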